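/- **Setting.** Let $\mathcal K$ be an abstract simplicial complex (possibly infinite) with no $n$-simplices for $n>N$ and in which every $n$-simplex is a face of at most $L$ simplices of dimension $n+1$, where $N,L\in\mathbb N$. Choose an orientation of each simplex, let $\mathcal K_n$ be the set of $n$-simplices and $\epsilon_{x,y}\in\{0,\pm1\}$ the incidence numbers ($x\in\mathcal K_n$, $y\in\mathcal K_{n-1}$). Let $(\mathbb G_\bullet,\partial_\bullet)$ be a chain complex of finite abelian groups indexed by $\mathbb Z$, with $\mathbb G_j=0$ for $j<0$ and $j>N$, and let $\widehat{\mathbb G}_j$ be the (additively written) group of characters of $\mathbb G_j$. For $p\in\mathbb Z$ let ${\rm Hom}_0^p$ (resp. ${\rm Hom}_{0,p}$) be the group of finitely supported maps sending each $x\in\mathcal K_n$ to an element of $\mathbb G_{n-p}$ (resp. of $\widehat{\mathbb G}_{n-p}$). Define $\delta^p:{\rm Hom}_0^p\to{\rm Hom}_0^{p+1}$ and $\delta_p:{\rm Hom}_{0,p}\to{\rm Hom}_{0,p-1}$ by $$(\delta^pt)(x)=\sum_{y}\epsilon_{x,y}\,t(y)-(-1)^p\,\partial(t(x)),\qquad(\delta_p\gamma)(x)=\sum_{z}\epsilon_{z,x}\,\gamma(z)-(-1)^{p-1}\,\gamma(x)\circ\partial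 .$$ For $t\in{\rm Hom}_0^p$, $\gamma\in{\rm Hom}_{0,p}$ put $\gamma(t)=\prod_{x}\gamma(x)[t(x)]\in U(1)$; then $\gamma(\delta^pt)=(\delta_{p+1}\gamma)(t)$. Let $\mathring H^0=\ker\delta^0/{\rm Im}\,\delta^{-1}$, $\mathring H_0=\ker\delta_0/{\rm Im}\,\delta_1$, $\mathbb H=\mathring H^0\times\mathring H_0$, $$\mathbb I=\{([t],[\gamma])\in\mathbb H:\ \gamma(t')\,\gamma'(t)=1\ \text{ for all }([t'],[\gamma'])\in\mathbb H\},$$ and, when $\mathbb H$ is finite, $c=\log_2|\mathbb I|$ and $q=\tfrac12\log_2(|\mathbb H|/|\mathbb I|)$. For a finite set $\Lambda$ of simplices let $\mathfrak A_\Lambda=\mathcal B\big(\bigotimes_{x\in\Lambda}L^2(\mathbb G_{\dim x})\big)$; let $\mathfrak A_{\rm loc}=\bigcup_\Lambda\mathfrak A_\Lambda$ (with the inclusions $A\mapsto A\otimes1$), and let the quasi-local $C^*$-algebra $\mathfrak A$ be the norm closure of $\mathfrak A_{\rm loc}$. Let $P_t|s\rangle=|t+s\rangle$ and $Q_\gamma|s\rangle=\gamma(s)|s\rangle$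 for $t\in{\rm Hom}_0^0$, $\gamma\in{\rm Hom}_{0,0}$. For $x\in\mathcal K_n$ put $$A_x^0=\frac1{|\mathbb G_{n+1}|}\sum_{g\in\mathbb G_{n+1}}P_{\delta^{-1}x^*_g},\qquad B_x^0=\frac1{|\mathbb G_{n-1}|}\sum_{\alpha\in\widehat{\mathbb G}_{n-1}}Q_{\delta_1x_*^\alpha},$$ where $x^*_g$, $x_*^\alpha$ take the value $g$, resp. $\alpha$, at $x$ and vanish elsewhere. For finite $\Lambda$, $H^\Lambda$ is minus the sum of all $A_x^0$ with $\{x\}\cup\{z:\epsilon_{z,x}\ne0\}\subseteq\Lambda$ and of all $B_x^0$ with $\{x\}\cup\{y:\epsilon_{x,y}\ne0\}\subseteq\Lambda$; for $A\in\mathfrak A_{\rm loc}$ put $\delta(A)=i[H^\Lambda,A]$, with $\Lambda$ finite and sufficiently large (depending on $A$). A state $\omega$ of $\mathfrak A$ is a *frustration-free ground state* if $-i\,\omega(A^*\delta(A))\ge0$ for all $A\in\mathfrak A_{\rm loc}$ and $\omega(A_x^0)=\omega(B_x^0)=1$ for all $x\in\mathcal K$. Let $\mathtt{FG}^\circ_{\rm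 QDM}(\mathfrak A)$ be the set of those frustration-free ground states that are pure (extreme points of the state space of $\mathfrak A$), with the weak-$*$ topology. **Statement.** Suppose that $\mathbb H$ is finite. Then $2^c$ and $2^q$ are natural numbers and, with $X_c=\{1,\dots,2^c\}$ (discrete) and $\mathfrak h_q=\mathbb C^{2^q}$, there are homeomorphisms $$\mathtt{FG}^\circ_{\rm QDM}(\mathfrak A)\;\simeq\;X_c\times\mathtt P(\mathcal B(\mathfrak h_q)),\qquad \mathtt{FG}^\circ_{\rm QDM}(\mathfrak A)\;\simeq\;X_c\times\mathbb P(\mathfrak h_q),$$ where $\mathtt P(\mathcal B(\mathfrak h_q))$ is the space of pure states of $\mathcal B(\mathfrak h_q)$ with the weak-$*$ topology and $\mathbb P(\mathfrak h_q)$ is the complex projective space of lines in $\mathfrak h_q$. -/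

import Mathlib

open scoped ComplexOrder LinearAlgebra.Projectivization Classical

universe u w

noncomputable section

/-! ### States of a unital C*-algebra, and projective space -/

section States

variable (A : Type*) [NormedRing A] [NormedAlgebra ℂ A] [StarRing A]

/-- The state space: positive linear functionals `φ` with `φ 1 = 1`. On a C*-algebra such
functionals are automatically continuous; the ambient `WeakDual` carries the weak-* topology. -/
def stateSpace : Set (WeakDual ℂ A) :=
  {φ | φ 1 = 1 ∧ ∀ a : A, 0 ≤ φ (star a * a)}

/-- The pure states: extreme points of the (convex) state space, with the weak-* topology
as a subspace of `WeakDual ℂ A`. -/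
def pureStates : Set (WeakDual ℂ A) :=
  (stateSpace A).extremePoints ℝ

end States

/-- Projective space carries the quotient topology of the nonzero vectors. -/
instance projectiveSpaceTopology (E : Type*) [NormedAddCommGroup E] [NormedSpace ℂ E] :
    TopologicalSpace (ℙ ℂ E) :=
  inferInstanceAs (TopologicalSpace (Quotient (projectivizationSetoid ℂ E)))

/-! ### Geometric and algebraic data -/

/-- The data of a higher Abelian quantum double model on the vertex set `V`.
The linear order on `V` is an auxiliary reference: the orientation `ori x` says whether the
orientation chosen on the simplex `x` is the one of its increasingly ordered vertices (`1`) or the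
opposite one (`-1`), so that every choice of orientations occurs. -/
structure HAQDM (V : Type u) [LinearOrder V] where
  /-- the simplicial complex -/
  cx : AbstractSimplicialComplex V
  /-- the chosen orientations -/
  ori : {s : Finset V // s ∈ cx.faces} → ℤˣ
  /-- the dimension bound -/
  N : ℕ
  /-- the regularity bound -/
  L : ℕ
  /-- there are no `n`-simplices for `n > N` -/
  card_le : ∀ s ∈ cx.faces, s.card ≤ N + 1
  /-- every `n`-simplex is a face of at most `L` simplices of dimension `n + 1` -/
  regular : ∀ s ∈ cx.faces, {z ∈ cx.faces | s ⊆ z ∧ z.card = s.card + 1}.encard ≤ L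
  /-- the chain complex of abelian groups `G_j`, `j ∈ ℤ` -/
  grp : ChainComplex AddCommGrpCat.{w} ℤ
  /-- the groups are finite -/
  finite_grp : ∀ j, Finite (grp.X j)
  /-- the groups vanish outside the degrees `0, …, N` -/
  trivial_grp : ∀ j : ℤ, (j < 0 ∨ (N : ℤ) < j) → Subsingleton (grp.X j)

namespace HAQDM

variable {V : Type u} [LinearOrder V] (D : HAQDM.{u, w} V)

/-- The simplices. -/
abbrev Simplex : Type u := {s : Finset V // s ∈ D.cx.faces}

/-- The group `G_j`. -/
abbrev G (j : ℤ) : Type w := D.grp.X j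

instance (j : ℤ) : Finite (D.G j) := D.finite_grp j

/-- The dual group of `G_j`, written additively: the characters `G_j → U(1)`. -/
def Gdual (j : ℤ) : Type w := D.G j →+ Additive Circle

instance (j : ℤ) : AddCommGroup (D.Gdual j) :=
  inferInstanceAs (AddCommGroup (D.G j →+ Additive Circle))

variable {D}

/-- The value in `U(1)` of a character at a group element. -/
def Gdual.val {j : ℤ} (χ : D.Gdual j) (g : D.G j) : Circle :=
  Additive.toMul ((show D.G j →+ Additive Circle from χ) g)

@[simp] lemma Gdual.zero_val {j : ℤ} (g : D.G j) : (0 : D.Gdual j).val g = 1 := rfl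

/-- The morphism `χ ↦ χ ∘ f` of dual groups. -/
def Gdual.pull {i j : ℤ} (f : D.G i →+ D.G j) : D.Gdual j →+ D.Gdual i :=
  AddMonoidHom.compHom' f

lemma Gdual.pull_val {i j : ℤ} (f : D.G i →+ D.G j) (χ : D.Gdual j) (g : D.G i) :
    (Gdual.pull f χ).val g = χ.val (f g) := rfl

/-- For `x ∈ K_n`, the integer `n - p`. -/
def deg (p : ℤ) (x : D.Simplex) : ℤ := ((x.1.card : ℤ) - 1) - p

/-- The incidence number `ε_{x,y}`: if `y` arises from `x` by removing the vertex number `i`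
(in increasing order, starting from `0`) it is `(-1)^i` times the two orientation signs,
and it is `0` if `y` is not a face of codimension one. -/
def incidence (x y : D.Simplex) : ℤ :=
  ∑ v ∈ x.1, if x.1.erase v = y.1 then
    (D.ori x : ℤ) * (D.ori y : ℤ) * (-1) ^ (x.1.filter (· < v)).card else 0

lemma finite_faces (x : D.Simplex) : {y : D.Simplex | incidence x y ≠ 0}.Finite := by
  refine Set.Finite.of_finite_image (f := Subtype.val)
    ((x.1.finite_toSet.image (fun v => x.1.erase v)).subset ?_) Subtype.val_injective.injOn
  rintro _ ⟨y, hy, rfl⟩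
  obtain ⟨v, hv, h⟩ := Finset.exists_ne_zero_of_sum_ne_zero hy
  refine ⟨v, hv, ?_⟩
  by_contra h'
  exact h (if_neg h')

lemma finite_cofaces (y : D.Simplex) : {x : D.Simplex | incidence x y ≠ 0}.Finite := by
  have hfin : {z ∈ D.cx.faces | y.1 ⊆ z ∧ z.card = y.1.card + 1}.Finite :=
    Set.finite_of_encard_le_coe (D.regular y.1 y.2)
  refine Set.Finite.of_finite_image (f := Subtype.val) (hfin.subset ?_)
    Subtype.val_injective.injOn
  rintro _ ⟨x, hx, rfl⟩
  obtain ⟨v, hv, h⟩ := Finset.exists_ne_zero_of_sum_ne_zero hx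
  have h' : x.1.erase v = y.1 := by
    by_contra h'
    exact h (if_neg h')
  refine ⟨x.2, h' ▸ Finset.erase_subset _ _, ?_⟩
  rw [← h', Finset.card_erase_add_one hv]

variable (D)

/-- The identification `G_i = G_j` for `i = j`; zero otherwise. -/
def transport (i j : ℤ) : D.G i →+ D.G j :=
  if h : i = j then (D.grp.XIsoOfEq h).hom.hom else 0

/-- The boundary morphism `∂ : G_i → G_j`, which is nonzero only for `j = i - 1`. -/
def bdry (i j : ℤ) : D.G i →+ D.G j := (D.grp.d i j).hom

/-! ### Finitely supported `p`-maps and dual `p`-maps -/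

/-- `Hom₀(C, G)^p`: finitely supported families of morphisms `t_n : C_n → G_{n-p}`. As `C_n` is
free on the `n`-simplices, such a family is a finitely supported map sending `x ∈ K_n` into
`G_{n-p}`. -/
abbrev Hom0 (p : ℤ) : Type (max u w) := Π₀ x : D.Simplex, D.G (deg p x)

/-- `Hom₀(C, G)_p`: finitely supported maps sending `x ∈ K_n` to a character of `G_{n-p}`. -/
abbrev DualHom0 (p : ℤ) : Type (max u w) := Π₀ x : D.Simplex, D.Gdual (deg p x)

variable {D}

/-- A finitely supported function as an element of `Π₀`. -/
def ofFinite {ι : Type*} {M : ι → Type*} [∀ i, AddCommGroup (M i)] (f : ∀ i, M i)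
    (hf : {i | f i ≠ 0}.Finite) : Π₀ i, M i :=
  DFinsupp.mk hf.toFinset fun i => f i

@[simp] lemma ofFinite_apply {ι : Type*} {M : ι → Type*} [∀ i, AddCommGroup (M i)]
    (f : ∀ i, M i) (hf : {i | f i ≠ 0}.Finite) (i : ι) : ofFinite f hf i = f i := by
  by_cases h : f i = 0
  · simp [ofFinite, h]
  · simp [ofFinite, h]

lemma finite_ne_zero {ι : Type*} {M : ι → Type*} [∀ i, AddCommGroup (M i)] (f : Π₀ i, M i) :
    {i | f i ≠ 0}.Finite := by
  refine f.support.finite_toSet.subset fun i hi => ?_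
  simpa using hi

/-- `(δ^p t)_n = t_{n-1} ∘ ∂_n - (-1)^p ∂_{n-p} ∘ t_n`, evaluated on a simplex. -/
def coboundaryFun (p q : ℤ) (t : D.Hom0 p) (x : D.Simplex) : D.G (deg q x) :=
  (∑ᶠ y : D.Simplex, incidence x y • D.transport (deg p y) (deg q x) (t y)) -
    (p.negOnePow : ℤ) • D.bdry (deg p x) (deg q x) (t x)

lemma coboundaryFun_finite (p q : ℤ) (t : D.Hom0 p) :
    {x | coboundaryFun p q t x ≠ 0}.Finite := by
  refine ((finite_ne_zero t).union
    ((finite_ne_zero t).biUnion fun y _ => finite_cofaces y)).subset fun x hx => ?_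
  by_contra h
  simp only [Set.mem_union, Set.mem_iUnion, Set.mem_ofPred_eq, not_or, not_exists, not_not] at h
  refine hx ?_
  have h1 : ∀ y : D.Simplex,
      incidence x y • D.transport (deg p y) (deg q x) (t y) = 0 := by
    intro y
    by_cases hy : t y = 0
    · simp [hy]
    · simp [h.2 y hy]
  simp [coboundaryFun, h1, h.1]

/-- The coboundary `δ^p : Hom₀(C, G)^p → Hom₀(C, G)^q`, to be used with `q = p + 1`. -/
def coboundary (p q : ℤ) : D.Hom0 p →+ D.Hom0 q where
  toFun t := ofFinite (coboundaryFun p q t) (coboundaryFun_finite p q t)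
  map_zero' := by
    ext x
    simp [coboundaryFun]
  map_add' t t' := by
    ext x
    have hf : ∀ s : D.Hom0 p, (Function.support fun y : D.Simplex =>
        incidence x y • D.transport (deg p y) (deg q x) (s y)).Finite := by
      intro s
      refine (finite_faces x).subset fun y hy h => hy ?_
      simp [h]
    simp only [ofFinite_apply, DFinsupp.add_apply, coboundaryFun, map_add, smul_add]
    rw [finsum_add_distrib (hf t) (hf t')]
    abel

/-- `(δ_p γ)_n = γ_{n+1} ∘ ∂̂_{n+1} - (-1)^{p-1} γ_n ∘ ∂_{n+1-p}`, evaluated on a simplex, for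
`q = p - 1`. With this sign `δ_{p+1}` is the transpose of `δ^p`. -/
def boundaryFun (p q : ℤ) (γ : D.DualHom0 p) (x : D.Simplex) : D.Gdual (deg q x) :=
  (∑ᶠ z : D.Simplex,
      incidence z x • Gdual.pull (D.transport (deg q x) (deg p z)) (γ z)) -
    (q.negOnePow : ℤ) • Gdual.pull (D.bdry (deg q x) (deg p x)) (γ x)

lemma boundaryFun_finite (p q : ℤ) (γ : D.DualHom0 p) :
    {x | boundaryFun p q γ x ≠ 0}.Finite := by
  refine ((finite_ne_zero γ).union
    ((finite_ne_zero γ).biUnion fun z _ => finite_faces z)).subset fun x hx => ?_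
  by_contra h
  simp only [Set.mem_union, Set.mem_iUnion, Set.mem_ofPred_eq, not_or, not_exists, not_not] at h
  refine hx ?_
  have h1 : ∀ z : D.Simplex,
      incidence z x • Gdual.pull (D.transport (deg q x) (deg p z)) (γ z) = 0 := by
    intro z
    by_cases hz : γ z = 0
    · simp [hz]
    · simp [h.2 z hz]
  simp [boundaryFun, h1, h.1]

/-- The boundary `δ_p : Hom₀(C, G)_p → Hom₀(C, G)_q`, to be used with `q = p - 1`. -/
def boundary (p q : ℤ) : D.DualHom0 p →+ D.DualHom0 q where
  toFun γ := ofFinite (boundaryFun p q γ) (boundaryFun_finite p q γ)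
  map_zero' := by
    refine DFinsupp.ext fun x => ?_
    simp [boundaryFun]
  map_add' γ γ' := by
    refine DFinsupp.ext fun x => ?_
    have hf : ∀ s : D.DualHom0 p, (Function.support fun z : D.Simplex =>
        incidence z x • Gdual.pull (D.transport (deg q x) (deg p z)) (s z)).Finite := by
      intro s
      refine (finite_cofaces x).subset fun y hy h => hy ?_
      simp [h]
    simp only [ofFinite_apply, DFinsupp.add_apply, boundaryFun, map_add, smul_add]
    rw [finsum_add_distrib (hf γ) (hf γ')]
    abel

/-- The evaluation `γ(t) = ∏_x γ(x)[t(x)]`. -/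
def eval {p : ℤ} (γ : D.DualHom0 p) (t : D.Hom0 p) : Circle :=
  ∏ᶠ x : D.Simplex, (γ x).val (t x)

variable (D)

/-! ### Finite (co)homology and the numbers `c` and `q` -/

/-- The finite cohomology group in degree `0`. -/
abbrev Coh : Type (max u w) :=
  (coboundary (D := D) 0 1).ker ⧸
    (coboundary (D := D) (-1) 0).range.addSubgroupOf (coboundary (D := D) 0 1).ker

/-- The finite homology group in degree `0`. -/
abbrev Homol : Type (max u w) :=
  (boundary (D := D) 0 (-1)).ker ⧸
    (boundary (D := D) 1 0).range.addSubgroupOf (boundary (D := D) 0 (-1)).ker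

/-- The product of finite cohomology and finite homology in degree `0`. -/
abbrev HH : Type (max u w) := D.Coh × D.Homol

/-- The commutator subgroup: the classes `([t], [γ])` with `γ(t') γ'(t) = 1` for all classes
`([t'], [γ'])`. -/
def II : Set D.HH :=
  {h | ∀ (t t' : (coboundary (D := D) 0 1).ker) (γ γ' : (boundary (D := D) 0 (-1)).ker),
    h = (QuotientAddGroup.mk t, QuotientAddGroup.mk γ) →
      eval γ.1 t'.1 * eval γ'.1 t.1 = 1}

/-- The number of classical bits. -/
def c : ℝ := Real.logb 2 (Nat.card D.II)

/-- The number of qubits. -/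
def q : ℝ := (1 / 2) * Real.logb 2 ((Nat.card D.HH : ℝ) / (Nat.card D.II : ℝ))

/-! ### The quasi-local algebra

The local algebras `B(⨂_{x ∈ Λ} L²(G_n))` are realized, compatibly with their inclusions, as
`B(⨂_{x ∈ Λ} L²(G_n)) ⊗ 1` on the infinite tensor product along the unit vectors `|0⟩`, that is on
`ℓ²` of the finitely supported configurations; the quasi-local algebra is the norm closure of
their union. -/

/-- The Hilbert space `ℓ²(Hom₀(C, G)^0)`, with canonical basis the configurations. -/
abbrev Hilb : Type (max u w) := lp (fun _ : D.Hom0 0 => ℂ) 2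

/-- The configurations on a finite set `Λ` of simplices: the canonical basis of
`⨂_{x ∈ Λ} L²(G_n)`. -/
abbrev LocConf (Λ : Finset D.Simplex) : Type (max u w) :=
  ∀ x : (Λ : Set D.Simplex), D.G (deg 0 x.1)

instance (Λ : Finset D.Simplex) : Fintype (D.LocConf Λ) := Fintype.ofFinite _

variable {D}

/-- The restriction of a configuration to `Λ`. -/
def restr (Λ : Finset D.Simplex) (s : D.Hom0 0) : D.LocConf Λ := fun x => s x.1

/-- The configuration that equals `u` on `Λ` and `s` off `Λ`. -/
def glue (Λ : Finset D.Simplex) (u : D.LocConf Λ) (s : D.Hom0 0) : D.Hom0 0 :=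
  DFinsupp.mk Λ u + s.filter (· ∉ Λ)

variable (D)

/-- The local algebra of `Λ`: the operators `a ⊗ 1` with `a` a matrix (an operator on
`⨂_{x ∈ Λ} L²(G_n)`) acting on the restrictions to `Λ` of the configurations. -/
def localAlgebra (Λ : Finset D.Simplex) : Set (D.Hilb →L[ℂ] D.Hilb) :=
  {A | ∃ a : Matrix (D.LocConf Λ) (D.LocConf Λ) ℂ, ∀ (f : D.Hilb) (s : D.Hom0 0),
    (A f : D.Hom0 0 → ℂ) s = ∑ u : D.LocConf Λ, a (restr Λ s) u * f (glue Λ u s)}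

/-- The quasi-local C*-algebra: the norm closure of the algebra of local operators. -/
def quasiLocal : StarSubalgebra ℂ (D.Hilb →L[ℂ] D.Hilb) :=
  (StarAlgebra.adjoin ℂ (⋃ Λ : Finset D.Simplex, D.localAlgebra Λ)).topologicalClosure

variable {D}

lemma mem_quasiLocal {Λ : Finset D.Simplex} {A : D.Hilb →L[ℂ] D.Hilb}
    (hA : A ∈ D.localAlgebra Λ) : A ∈ D.quasiLocal :=
  StarSubalgebra.le_topologicalClosure _
    (StarAlgebra.subset_adjoin ℂ _ (Set.mem_iUnion.2 ⟨Λ, hA⟩))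

/-- The operator `f ↦ (s ↦ u(s) f(e s))` for a permutation `e` and a phase function `u`. -/
def monomialOp (e : Equiv.Perm (D.Hom0 0)) (u : D.Hom0 0 → Circle) : D.Hilb →L[ℂ] D.Hilb :=
  have hmem : ∀ f : D.Hilb, Memℓp (fun s => (u s : ℂ) * f (e s)) 2 := by
    intro f
    have hf := (memℓp_gen_iff (p := 2) (by norm_num)).1 (lp.memℓp f)
    refine (memℓp_gen_iff (p := 2) (by norm_num)).2 ?_
    simpa [Function.comp_def, Circle.norm_coe] using e.summable_iff.2 hf
  LinearMap.mkContinuous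
    { toFun := fun f => ⟨fun s => (u s : ℂ) * f (e s), hmem f⟩
      map_add' := by
        intro f g
        ext s
        exact mul_add _ _ _
      map_smul' := by
        intro k f
        ext s
        simp [mul_left_comm] }
    1 (by
      intro f
      rw [one_mul, lp.norm_eq_tsum_rpow (by norm_num), lp.norm_eq_tsum_rpow (by norm_num)]
      refine le_of_eq ?_
      congr 1
      simpa [Circle.norm_coe] using e.tsum_eq fun s => ‖f s‖ ^ (2 : ENNReal).toReal)

@[simp] lemma monomialOp_apply (e : Equiv.Perm (D.Hom0 0)) (u : D.Hom0 0 → Circle)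
    (f : D.Hilb) (s : D.Hom0 0) :
    (monomialOp e u f : D.Hom0 0 → ℂ) s = (u s : ℂ) * f (e s) := rfl

lemma glue_apply (Λ : Finset D.Simplex) (u : D.LocConf Λ) (s : D.Hom0 0) (x : D.Simplex) :
    glue Λ u s x = if h : x ∈ Λ then u ⟨x, h⟩ else s x := by
  by_cases h : x ∈ Λ <;> simp [glue, h]

lemma shift_mem (t : D.Hom0 0) :
    monomialOp (Equiv.subRight t) (fun _ => 1) ∈ D.localAlgebra t.support := by
  refine ⟨fun v u => if u = v - restr t.support t then 1 else 0, fun f s => ?_⟩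
  have hg : glue t.support (restr t.support s - restr t.support t) s = s - t := by
    ext x
    by_cases h : t x = 0 <;> simp [glue_apply, restr, h]
  simp [hg]

lemma clock_mem (γ : D.DualHom0 0) :
    monomialOp (Equiv.refl _) (fun s => eval γ s) ∈ D.localAlgebra γ.support := by
  refine ⟨fun v u => if u = v then
    ((∏ x ∈ γ.support.attach, (γ x.1).val (v ⟨x.1, x.2⟩) : Circle) : ℂ) else 0, fun f s => ?_⟩
  have hg : glue γ.support (restr γ.support s) s = s := by
    ext x
    by_cases h : γ x = 0 <;> simp [glue_apply, restr, h]
  have he : eval γ s = ∏ x ∈ γ.support.attach, (γ x.1).val (s x.1) := by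
    rw [eval, finprod_eq_prod_of_mulSupport_subset (s := γ.support)]
    · exact (Finset.prod_attach γ.support fun x => (γ x).val (s x)).symm
    · intro x hx
      simp only [Finset.mem_coe, DFinsupp.mem_support_toFun]
      intro h
      simp [h] at hx
  simp [hg, he, restr]

/-- The shift operator `P_t`, with `P_t |s⟩ = |t + s⟩`. -/
def shift (t : D.Hom0 0) : D.quasiLocal :=
  ⟨monomialOp (Equiv.subRight t) fun _ => 1, mem_quasiLocal (shift_mem t)⟩

/-- The clock operator `Q_γ`, with `Q_γ |s⟩ = γ(s) |s⟩`. -/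
def clock (γ : D.DualHom0 0) : D.quasiLocal :=
  ⟨monomialOp (Equiv.refl _) fun s => eval γ s, mem_quasiLocal (clock_mem γ)⟩

/-! ### Star and plaquette operators, Hamiltonian, ground states -/

/-- The star projection `A_x^0`: the average over `g ∈ G_{n+1}` of `P_{δ^{-1} x^*_g}`. -/
def starOp (x : D.Simplex) : D.quasiLocal :=
  ((Nat.card (D.G (deg (-1) x)) : ℂ)⁻¹) •
    ∑ᶠ g : D.G (deg (-1) x), shift (coboundary (-1) 0 (DFinsupp.single x g))

/-- The plaquette projection `B_x^0`: the average over the characters `α` of `G_{n-1}` of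
`Q_{δ_1 x_*^α}`. -/
def plaqOp (x : D.Simplex) : D.quasiLocal :=
  ((Nat.card (D.G (deg 1 x)) : ℂ)⁻¹) •
    ∑ᶠ α : D.Gdual (deg 1 x), clock (boundary 1 0 (DFinsupp.single x α))

/-- The support of `A_x^0`: `x` and its coboundary. -/
def starSupp (x : D.Simplex) : Set D.Simplex := {x} ∪ {z | incidence z x ≠ 0}

/-- The support of `B_x^0`: `x` and its boundary. -/
def plaqSupp (x : D.Simplex) : Set D.Simplex := {x} ∪ {y | incidence x y ≠ 0}

/-- The Hamiltonian of a finite set `Λ`: minus the sum of the `A_x^0` and `B_x^0` supported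
in `Λ`. -/
def hamiltonian (Λ : Finset D.Simplex) : D.quasiLocal :=
  -(∑ x ∈ Λ.filter (fun x => starSupp x ⊆ (Λ : Set D.Simplex)), starOp x +
    ∑ x ∈ Λ.filter (fun x => plaqSupp x ⊆ (Λ : Set D.Simplex)), plaqOp x)

/-- Ground states: `-i ω(A^* δ(A)) ≥ 0` for every local `A`, where `δ(A) = i [H^Λ, A]` for all
sufficiently large finite `Λ` (the commutator does not depend on `Λ` once `Λ` is large). -/
def IsGroundState (ω : WeakDual ℂ D.quasiLocal) : Prop :=
  ω ∈ stateSpace D.quasiLocal ∧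
    ∀ A : D.quasiLocal, (∃ Λ₀, (A : D.Hilb →L[ℂ] D.Hilb) ∈ D.localAlgebra Λ₀) →
      ∀ᶠ Λ : Finset D.Simplex in Filter.atTop,
        0 ≤ -Complex.I *
          ω (star A * (Complex.I • (hamiltonian Λ * A - A * hamiltonian Λ)))

/-- Frustration-free ground states. -/
def IsFrustrationFree (ω : WeakDual ℂ D.quasiLocal) : Prop :=
  IsGroundState ω ∧ ∀ x y : D.Simplex, ω (starOp x) = 1 ∧ ω (plaqOp y) = 1

variable (D)

/-- The space of pure frustration-free ground states, with the weak-* topology. -/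
def pureFG : Set (WeakDual ℂ D.quasiLocal) :=
  {ω | IsFrustrationFree ω ∧ ω ∈ pureStates D.quasiLocal}

end HAQDM

end

/-! The shifts `P_t` and clocks `Q_γ` form a Weyl system: they represent two abelian groups, commute
up to the phase `γ(t)`, and span a norm dense subspace (`localAlgebra_le_weylSpan`, a finite Fourier
transform). Each star or plaquette projection is the average of a finite group of such unitaries, so
a state equals 1 on all of them exactly when it equals 1 on `P_t` for coboundaries `t` and on `Q_γ`
for boundaries `γ`; the ground state inequality is then automatic (`isFrustrationFree_iff`). These
stabilizer states form a face of the state space.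

Because `δ_{p+1}` is the transpose of `δ^p`, cocycles and cycles are the annihilators of boundaries
and coboundaries. A stabilizer state vanishes on `P_t Q_γ` unless `t` is a cocycle and `γ` a cycle,
and then its value depends only on the two classes. It therefore lives on the twisted group algebra
of ℍ, whose radical is 𝕀. With k = |𝕀| and d the order of cohomology modulo the kernel of the
pairing, finite duality gives |ℍ| = k d², and the algebra is a sum of k blocks of size d.

The quotient algebra is never built. Instead `compression` maps 𝔄 onto the blocks. The k characters
of 𝕀 are extended to ℍ; for each one a state is chosen with these values on a maximal isotropic
group (`exists_state_of_characters`: joint eigenvectors for finite supports, then weak-*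
compactness), and one takes its GNS matrix coefficients between the vectors of finitely many shifts.
The map is positive, multiplicative against the centralizer of the stabilizers, and trace
orthogonality makes the images of the |ℍ| logical Weyl operators a basis. Hence the stabilizer
states are exactly the states of the blocks composed with the compression
(`mem_stabilizerStates_iff`). The pure ones are vector states on one block, and compactness of
projective space turns the parametrization into a homeomorphism (`nonempty_homeomorph_of_face`). -/

noncomputable section

/-! ### Positive functionals on star algebras -/

section PositiveFunctional

variable {A F : Type*} [Ring A] [StarRing A] [Algebra ℂ A] [StarModule ℂ A]
  [FunLike F A ℂ] [LinearMapClass F ℂ A ℂ] {φ : F}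

/-- Polarization: the reality of `φ` at `a + b` gives the imaginary parts, and its reality at `a + i
b` the real parts. -/
lemma positive_star_mul_comm (hφ : ∀ a : A, 0 ≤ φ (star a * a)) (a b : A) :
    φ (star b * a) = star (φ (star a * b)) := by
  have h1 := hφ (a + b)
  have h2 := hφ (a + Complex.I • b)
  have ha := hφ a
  have hb := hφ b
  simp only [star_add, add_mul, mul_add, map_add, star_smul, smul_mul_assoc, mul_smul_comm,
    map_smul, smul_eq_mul, Complex.le_def, Complex.add_re, Complex.add_im, Complex.mul_re,
    Complex.mul_im, Complex.star_def, Complex.conj_I, Complex.neg_re, Complex.neg_im,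
    Complex.I_re, Complex.I_im, Complex.zero_re, Complex.zero_im] at h1 h2 ha hb
  apply Complex.ext
  · simp only [Complex.star_def, Complex.conj_re]
    linarith [h2.2, ha.2, hb.2]
  · simp only [Complex.star_def, Complex.conj_im]
    linarith [h1.2, ha.2, hb.2]

lemma positive_map_star (hφ : ∀ a : A, 0 ≤ φ (star a * a)) (a : A) :
    φ (star a) = star (φ a) := by
  simpa using positive_star_mul_comm hφ 1 a

/-- The degenerate case of Cauchy–Schwarz: a null vector of a positive form is orthogonal to
everything. -/
lemma positive_mul_eq_zero (hφ : ∀ a : A, 0 ≤ φ (star a * a)) {b : A}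
    (hb : φ (star b * b) = 0) (a : A) : φ (star a * b) = 0 := by
  have hba := positive_star_mul_comm hφ a b
  set w := φ (star a * b) with hw
  obtain ⟨r, hr, har⟩ : ∃ r : ℝ, 0 ≤ r ∧ φ (star a * a) = r :=
    ⟨(φ (star a * a)).re, (Complex.le_def.1 (hφ a)).1,
      Complex.ext rfl (Complex.le_def.1 (hφ a)).2.symm⟩
  -- Positivity is tested at `b - w a / (r + 1)`; using `r + 1` in place of `r` avoids a separate
  -- case `r = 0`, and the coefficient of `‖w‖ ^ 2` is still negative.
  have key := hφ (((-(r + 1 : ℝ)⁻¹ : ℝ) : ℂ) • w • a + b)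
  have hexp : φ (star (((-(r + 1 : ℝ)⁻¹ : ℝ) : ℂ) • w • a + b) *
      (((-(r + 1 : ℝ)⁻¹ : ℝ) : ℂ) • w • a + b)) =
      (((r + 1)⁻¹ ^ 2 * r - 2 * (r + 1)⁻¹) * ‖w‖ ^ 2 : ℝ) := by
    have hww : star w * w = ((‖w‖ ^ 2 : ℝ) : ℂ) := by
      rw [Complex.star_def, Complex.conj_mul']
      push_cast
      rfl
    simp only [star_add, add_mul, mul_add, map_add, star_smul, smul_mul_assoc, mul_smul_comm,
      map_smul, smul_eq_mul, hb, hba, har, ← hw]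
    have hc : star (((-(r + 1 : ℝ)⁻¹ : ℝ) : ℂ)) = ((-(r + 1 : ℝ)⁻¹ : ℝ) : ℂ) :=
      Complex.conj_ofReal _
    rw [hc]
    push_cast at hww ⊢
    linear_combination (((r : ℂ) + 1)⁻¹ ^ 2 * r - 2 * ((r : ℂ) + 1)⁻¹) * hww
  rw [hexp, Complex.zero_le_real] at key
  have hpos : (0 : ℝ) < (r + 1)⁻¹ := by positivity
  have hlt : (r + 1)⁻¹ ^ 2 * r - 2 * (r + 1)⁻¹ < 0 := by
    have h1 : (r + 1)⁻¹ * r < 1 := by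
      rw [inv_mul_lt_iff₀ (by positivity)]
      linarith
    nlinarith
  have h0 : ‖w‖ ^ 2 ≤ 0 := by
    by_contra h
    push Not at h
    linarith [mul_neg_of_neg_of_pos hlt h]
  simpa using le_antisymm h0 (sq_nonneg _)

lemma positive_mul_left_eq_zero (hφ : ∀ a : A, 0 ≤ φ (star a * a)) {b : A}
    (hb : φ (star b * b) = 0) (a : A) : φ (a * b) = 0 := by
  simpa using positive_mul_eq_zero hφ hb (star a)

/-- The defect `φ((U - z)^* (U - z))` vanishes when `U` is an isometry and `φ U = z` is
a phase. -/
lemma state_defect_eq_zero (hφ : ∀ a : A, 0 ≤ φ (star a * a)) (h1 : φ 1 = 1)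
    {U : A} (hU : star U * U = 1) {z : ℂ} (hz : star z * z = 1)
    (h : φ U = z) : φ (star (U - z • 1) * (U - z • 1)) = 0 := by
  simp only [star_sub, sub_mul, mul_sub, map_sub, hU, h1, star_smul, star_one, smul_mul_assoc,
    mul_smul_comm, map_smul, one_mul, mul_one, smul_eq_mul, positive_map_star hφ, h]
  linear_combination -hz

/-- `U - z` lies in the left ideal on which `φ` vanishes, so the state absorbs `U` on the right at
the cost of the phase. -/
lemma state_mul_isometry (hφ : ∀ a : A, 0 ≤ φ (star a * a)) (h1 : φ 1 = 1)
    {U : A} (hU : star U * U = 1) {z : ℂ} (hz : star z * z = 1)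
    (h : φ U = z) (a : A) : φ (a * U) = z * φ a := by
  have := positive_mul_left_eq_zero hφ (state_defect_eq_zero hφ h1 hU hz h) a
  simpa [mul_sub, sub_eq_zero] using this

lemma state_eq_one_of_defect (hφ : ∀ a : A, 0 ≤ φ (star a * a)) (h1 : φ 1 = 1)
    {U : A} (h : φ (star (U - 1) * (U - 1)) = 0) : φ U = 1 := by
  have := positive_mul_left_eq_zero hφ h 1
  simpa [h1, sub_eq_zero] using this

/-- The adjoint of `state_mul_isometry`, applied to `star U` with the value `star z`. -/
lemma state_unitary_mul (hφ : ∀ a : A, 0 ≤ φ (star a * a)) (h1 : φ 1 = 1)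
    {U : A} (hU' : U * star U = 1) {z : ℂ}
    (hz : star z * z = 1) (h : φ U = z) (a : A) : φ (U * a) = z * φ a := by
  have h' : φ (star a * star U) = star z * φ (star a) :=
    state_mul_isometry hφ h1 (by simpa using hU') (by simpa [mul_comm] using hz)
      (by rw [positive_map_star hφ, h]) _
  rw [← star_mul, positive_map_star hφ, positive_map_star hφ, ← star_mul', star_inj] at h'
  exact h'

lemma state_mul_proj (hφ : ∀ a : A, 0 ≤ φ (star a * a))
    {p : A} (hp : star p = p) (hpp : p * p = p) (h1 : φ 1 = 1) (h : φ p = 1)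
    (a : A) : φ (a * p) = φ a := by
  have h0 : φ (star (1 - p) * (1 - p)) = 0 := by
    simp [hp, sub_mul, mul_sub, hpp, h1, h]
  have := positive_mul_left_eq_zero hφ h0 a
  rw [mul_sub, map_sub, mul_one, sub_eq_zero] at this
  exact this.symm

lemma state_proj_mul (hφ : ∀ a : A, 0 ≤ φ (star a * a)) (h1 : φ 1 = 1)
    {p : A} (hp : star p = p) (hpp : p * p = p) (h : φ p = 1)
    (a : A) : φ (p * a) = φ a := by
  have := congrArg star (state_mul_proj hφ hp hpp h1 h (star a))
  rwa [← positive_map_star hφ, ← positive_map_star hφ, star_mul, star_star, hp] at this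

/-- The state absorbs `p` on the right, which leaves its value at the positive element `a^* (1 - p)
a`. -/
lemma state_star_mul_proj_mul_le (hφ : ∀ a : A, 0 ≤ φ (star a * a)) (h1 : φ 1 = 1)
    {p : A} (hp : star p = p) (hpp : p * p = p) (h : φ p = 1) (a : A) :
    0 ≤ φ (star a * (a * p)) - φ (star a * (p * a)) := by
  have heq : star a * (a - p * a) = star ((1 - p) * a) * ((1 - p) * a) := by
    rw [star_mul, star_sub, star_one, hp, mul_assoc, ← mul_assoc (1 - p)]
    congr 1
    simp [sub_mul, mul_sub, hpp]
  rw [← mul_assoc, state_mul_proj hφ hp hpp h1 h, ← map_sub, ← mul_sub, heq]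
  exact hφ _

/-- A state that equals `1` on all the terms of a sum of projections is a ground state of the
negative of the sum. -/
lemma state_commutator_nonneg (hφ : ∀ a : A, 0 ≤ φ (star a * a)) (h1 : φ 1 = 1)
    {ι : Type*} (s t : Finset ι) {p r : ι → A}
    (hp : ∀ i, star (p i) = p i ∧ p i * p i = p i ∧ φ (p i) = 1)
    (hr : ∀ i, star (r i) = r i ∧ r i * r i = r i ∧ φ (r i) = 1) (a : A) :
    0 ≤ -Complex.I * φ (star a * (Complex.I • (-(∑ i ∈ s, p i + ∑ i ∈ t, r i) * a -
      a * -(∑ i ∈ s, p i + ∑ i ∈ t, r i)))) := by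
  have h : -Complex.I * φ (star a * (Complex.I • (-(∑ i ∈ s, p i + ∑ i ∈ t, r i) * a -
      a * -(∑ i ∈ s, p i + ∑ i ∈ t, r i)))) =
      ∑ i ∈ s, (φ (star a * (a * p i)) - φ (star a * (p i * a))) +
      ∑ i ∈ t, (φ (star a * (a * r i)) - φ (star a * (r i * a))) := by
    rw [mul_smul_comm, map_smul, smul_eq_mul, ← mul_assoc, neg_mul, Complex.I_mul_I, neg_neg,
      one_mul]
    simp only [neg_mul, mul_neg, add_mul, mul_add, mul_sub, Finset.sum_mul, Finset.mul_sum,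
      map_sub, map_neg, map_add, map_sum, Finset.sum_sub_distrib]
    ring
  rw [h]
  exact add_nonneg
    (Finset.sum_nonneg fun i _ =>
      state_star_mul_proj_mul_le hφ h1 (hp i).1 (hp i).2.1 (hp i).2.2 a)
    (Finset.sum_nonneg fun i _ =>
      state_star_mul_proj_mul_le hφ h1 (hr i).1 (hr i).2.1 (hr i).2.2 a)

end PositiveFunctional

/-! ### Averages of unitary representations of finite groups -/

section Average

variable {A G : Type*} [Ring A] [Algebra ℂ A] [AddCommGroup G] [Fintype G] {U : G → A}

/-- The average of a family of elements over a finite group. -/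
def groupAverage (U : G → A) : A := (Fintype.card G : ℂ)⁻¹ • ∑ g, U g

lemma mul_groupAverage (hU : ∀ g h, U (g + h) = U g * U h) (g : G) :
    U g * groupAverage U = groupAverage U := by
  simp only [groupAverage, mul_smul_comm, Finset.mul_sum, ← hU]
  rw [Fintype.sum_equiv (Equiv.addLeft g) (fun x => U (g + x)) U fun _ => rfl]

lemma groupAverage_mul_self (hU : ∀ g h, U (g + h) = U g * U h) :
    groupAverage U * groupAverage U = groupAverage U := by
  nth_rewrite 1 [groupAverage]
  rw [smul_mul_assoc, Finset.sum_mul, Finset.sum_congr rfl fun g _ => mul_groupAverage hU g,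
    Finset.sum_const, Finset.card_univ, ← Nat.cast_smul_eq_nsmul ℂ, smul_smul,
    inv_mul_cancel₀ (by simp [Fintype.card_ne_zero]), one_smul]

variable [StarRing A] [StarModule ℂ A]

lemma star_groupAverage (hs : ∀ g, star (U g) = U (-g)) :
    star (groupAverage U) = groupAverage U := by
  simp only [groupAverage, star_smul, star_sum, hs]
  rw [Fintype.sum_equiv (Equiv.neg G) (fun x => U (-x)) U fun _ => rfl]
  simp

variable {F : Type*} [FunLike F A ℂ] [LinearMapClass F ℂ A ℂ] {φ : F}

/-- A state equals `1` on the average precisely when it equals `1` on the whole group. -/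
lemma state_groupAverage_eq_one_iff (hφ : ∀ a : A, 0 ≤ φ (star a * a)) (h1 : φ 1 = 1)
    (hU : ∀ g h, U (g + h) = U g * U h) (hs : ∀ g, star (U g) = U (-g)) :
    φ (groupAverage U) = 1 ↔ ∀ g, φ (U g) = 1 := by
  constructor
  · intro h g
    rw [← state_mul_proj hφ (star_groupAverage hs) (groupAverage_mul_self hU) h1 h,
      mul_groupAverage hU, h]
  · intro h
    simp [groupAverage, h]

end Average

/-! ### Ray states of a sum of full matrix blocks -/

section Blocks

open Matrix

variable {k d : ℕ}

/-- The normalized expectation `c ↦ ⟨v, c_j v⟩ / ⟨v, v⟩` on a sum of matrix blocks. -/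
def rayFunctional (j : Fin k) (v : Fin d → ℂ) :
    (Fin k → Matrix (Fin d) (Fin d) ℂ) →ₗ[ℂ] ℂ where
  toFun c := (star v ⬝ᵥ v)⁻¹ * (star v ⬝ᵥ c j *ᵥ v)
  map_add' a b := by simp [add_mulVec, dotProduct_add, mul_add]
  map_smul' a b := by simp [smul_mulVec, dotProduct_smul, mul_left_comm]

lemma rayFunctional_apply (j : Fin k) (v : Fin d → ℂ) (c : Fin k → Matrix (Fin d) (Fin d) ℂ) :
    rayFunctional j v c = (star v ⬝ᵥ v)⁻¹ * (star v ⬝ᵥ c j *ᵥ v) := rfl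

lemma star_dotProduct_self_ne_zero {v : Fin d → ℂ} (hv : v ≠ 0) : star v ⬝ᵥ v ≠ 0 := by
  rwa [Ne, dotProduct_star_self_eq_zero]

lemma rayFunctional_one (j : Fin k) {v : Fin d → ℂ} (hv : v ≠ 0) :
    rayFunctional j v 1 = 1 := by
  simp [rayFunctional_apply, inv_mul_cancel₀ (star_dotProduct_self_ne_zero hv)]

lemma rayFunctional_nonneg (j : Fin k) (v : Fin d → ℂ)
    (c : Fin k → Matrix (Fin d) (Fin d) ℂ) : 0 ≤ rayFunctional j v (star c * c) :=
  mul_nonneg (inv_nonneg.2 (dotProduct_star_self_nonneg v))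
    ((posSemidef_conjTranspose_mul_self (c j)).dotProduct_mulVec_nonneg v)

lemma rayFunctional_smul (j : Fin k) (v : Fin d → ℂ) {a : ℂ} (ha : a ≠ 0) :
    rayFunctional j (a • v) = rayFunctional j v := by
  refine LinearMap.ext fun c => ?_
  have ha' : star a ≠ 0 := by simpa using ha
  simp only [rayFunctional_apply, star_smul, smul_dotProduct, dotProduct_smul, mulVec_smul,
    smul_eq_mul]
  by_cases hv : star v ⬝ᵥ v = 0
  · simp [hv]
  · field_simp

/-- The rank one projection onto `v` in the block `j`. -/
def rayProj (j : Fin k) (v : Fin d → ℂ) : Fin k → Matrix (Fin d) (Fin d) ℂ :=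
  Pi.single j ((star v ⬝ᵥ v)⁻¹ • vecMulVec v (star v))

lemma rayFunctional_rayProj (i j : Fin k) (v w : Fin d → ℂ) :
    rayFunctional i w (rayProj j v) = if i = j then
      (star w ⬝ᵥ w)⁻¹ * (star v ⬝ᵥ v)⁻¹ * ((star w ⬝ᵥ v) * (star v ⬝ᵥ w)) else 0 := by
  by_cases h : i = j
  · subst h
    simp [rayFunctional_apply, rayProj, smul_mulVec, vecMulVec_mulVec]
    ring
  · simp [rayFunctional_apply, rayProj, h]

lemma star_rayProj (j : Fin k) (v : Fin d → ℂ) : star (rayProj j v) = rayProj j v := by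
  have h : star (star v ⬝ᵥ v) = star v ⬝ᵥ v :=
    (IsSelfAdjoint.of_nonneg (dotProduct_star_self_nonneg v)).star_eq
  rw [rayProj, ← Pi.single_star, star_smul, star_inv₀, h, star_eq_conjTranspose,
    conjTranspose_vecMulVec, star_star]

/-- The corner cut out by a rank one projection is one-dimensional. This is why a state with value 1
on the projection is determined. -/
lemma rayProj_mul_mul_rayProj (j : Fin k) (v : Fin d → ℂ)
    (c : Fin k → Matrix (Fin d) (Fin d) ℂ) :
    rayProj j v * c * rayProj j v = rayFunctional j v c • rayProj j v := by
  ext1 i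
  by_cases h : i = j
  · subst h
    simp only [rayProj, Pi.mul_apply, Pi.single_eq_same, Pi.smul_apply, rayFunctional_apply,
      smul_mul_assoc, mul_smul_comm, mul_assoc, mul_vecMulVec, smul_smul, vecMulVec_mulVec,
      op_smul_eq_smul, smul_vecMulVec]
    congr 1
    ring
  · simp [rayProj, h]

lemma rayProj_mul_self (j : Fin k) {v : Fin d → ℂ} (hv : v ≠ 0) :
    rayProj j v * rayProj j v = rayProj j v := by
  have := rayProj_mul_mul_rayProj j v 1
  rwa [mul_one, rayFunctional_one j hv, one_smul] at this

/-- A positive functional on a full matrix algebra is a sum of vector functionals. -/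
lemma exists_eq_sum_of_positive (φ : Matrix (Fin d) (Fin d) ℂ →ₗ[ℂ] ℂ)
    (hφ : ∀ a, 0 ≤ φ (star a * a)) :
    ∃ (n : ℕ) (b : Fin n → Fin d → ℂ), ∀ T, φ T = ∑ i, star (b i) ⬝ᵥ T *ᵥ b i := by
  -- `R` is the density matrix: `φ T = tr (T R)`. Its decomposition into rank one terms yields the
  -- vectors `b i`.
  let R : Matrix (Fin d) (Fin d) ℂ := fun n m => φ (Matrix.single m n 1)
  have hT : ∀ T, φ T = (T * R).trace := by
    intro T
    conv_lhs => rw [matrix_eq_sum_single T]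
    simp only [map_sum, trace, diag_apply, mul_apply]
    refine Finset.sum_congr rfl fun m _ => Finset.sum_congr rfl fun n _ => ?_
    rw [← mul_one (T m n), ← smul_eq_mul, ← smul_single, map_smul, smul_eq_mul, smul_eq_mul,
      mul_one]
  have hvv : ∀ x : Fin d → ℂ, 0 ≤ φ (vecMulVec x (star x)) := by
    intro x
    by_cases hx : x = 0
    · simp [hx]
    have h := hφ (vecMulVec x (star x))
    -- The square of `x x^*` is `(x^* x) x x^*`, so positivity on squares passes to `x x^*` after
    -- division by a positive number.
    rw [star_eq_conjTranspose, conjTranspose_vecMulVec, star_star, vecMulVec_mul_vecMulVec,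
      vecMulVec_smul, map_smul, smul_eq_mul] at h
    have hpos : 0 < star x ⬝ᵥ x :=
      lt_of_le_of_ne (dotProduct_star_self_nonneg x) (star_dotProduct_self_ne_zero hx).symm
    exact le_of_mul_le_mul_left (by simpa using h) hpos
  have htr : ∀ (T : Matrix (Fin d) (Fin d) ℂ) (x : Fin d → ℂ),
      (T * vecMulVec x (star x)).trace = star x ⬝ᵥ T *ᵥ x := by
    intro T x
    rw [mul_vecMulVec, trace_vecMulVec, dotProduct_comm]
  have hR : R.PosSemidef := by
    refine PosSemidef.of_dotProduct_mulVec_nonneg ?_ fun x => ?_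
    · ext m n
      have := positive_map_star hφ (Matrix.single m n (1 : ℂ))
      simp only [star_eq_conjTranspose, conjTranspose_single, star_one] at this
      exact (conjTranspose_apply R n m).trans this.symm
    · rw [← htr, trace_mul_comm, ← hT]
      exact hvv x
  obtain ⟨n, b, hb⟩ := posSemidef_iff_eq_sum_vecMulVec.1 hR
  refine ⟨n, b, fun T => ?_⟩
  rw [hT, hb, Finset.mul_sum, trace_sum]
  exact Finset.sum_congr rfl fun i _ => htr T (b i)

/-- A positive functional on a sum of full matrix algebras is a sum of vector functionals. -/
lemma exists_eq_sum_of_positive_blocks (φ : (Fin k → Matrix (Fin d) (Fin d) ℂ) →ₗ[ℂ] ℂ)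
    (hφ : ∀ a, 0 ≤ φ (star a * a)) :
    ∃ (n : Fin k → ℕ) (b : (p : Σ j, Fin (n j)) → Fin d → ℂ), ∀ c,
      φ c = ∑ p, star (b p) ⬝ᵥ c p.1 *ᵥ b p := by
  have h := fun j => exists_eq_sum_of_positive
    (φ ∘ₗ LinearMap.single ℂ (fun _ : Fin k => Matrix (Fin d) (Fin d) ℂ) j) (fun a => by
      have := hφ (Pi.single j a)
      rwa [← Pi.single_star, ← Pi.single_mul] at this)
  choose n b hb using h
  refine ⟨n, fun p => b p.1 p.2, fun c => ?_⟩
  conv_lhs => rw [← Finset.univ_sum_single c]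
  rw [map_sum, Fintype.sum_sigma]
  exact Finset.sum_congr rfl fun j _ => hb j (c j)

/-- Needed because the compression of `star x * x` is only shown to be positive semidefinite,
without an explicit square root. -/
lemma positive_blocks_nonneg (φ : (Fin k → Matrix (Fin d) (Fin d) ℂ) →ₗ[ℂ] ℂ)
    (hφ : ∀ a, 0 ≤ φ (star a * a)) {c : Fin k → Matrix (Fin d) (Fin d) ℂ}
    (hc : ∀ j, (c j).PosSemidef) : 0 ≤ φ c := by
  obtain ⟨n, b, hb⟩ := exists_eq_sum_of_positive_blocks φ hφ
  rw [hb]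
  exact Finset.sum_nonneg fun p _ => (hc p.1).dotProduct_mulVec_nonneg _

end Blocks

/-! ### Projective space -/

section ProjectiveSpace

variable {E : Type*} [NormedAddCommGroup E] [NormedSpace ℂ E]

lemma continuous_projectivization_mk :
    Continuous fun v : {v : E // v ≠ 0} => Projectivization.mk ℂ v.1 v.2 :=
  continuous_quot_mk

lemma continuous_of_continuous_comp_mk {Y : Type*} [TopologicalSpace Y] {f : ℙ ℂ E → Y}
    (hf : Continuous fun v : {v : E // v ≠ 0} => f (Projectivization.mk ℂ v.1 v.2)) :
    Continuous f :=
  continuous_quot_lift (r := (projectivizationSetoid ℂ E).r) (f := fun v => f (Quotient.mk'' v))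
    (fun a b h => congrArg f (Quotient.sound h)) hf |>.congr fun x => by
      induction x using Quotient.inductionOn with | h v => rfl

/-- The unit sphere is compact in finite dimension and maps onto the projective space. -/
instance compactSpace_projectivization [FiniteDimensional ℂ E] : CompactSpace (ℙ ℂ E) := by
  have : ProperSpace E := FiniteDimensional.proper ℂ E
  let f : Metric.sphere (0 : E) 1 → ℙ ℂ E := fun u =>
    Projectivization.mk ℂ u.1 (ne_zero_of_mem_unit_sphere u)
  have hf : Continuous f := continuous_projectivization_mk.comp
    (continuous_subtype_val.subtype_mk fun u => ne_zero_of_mem_unit_sphere u)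
  have hs : Function.Surjective f := by
    intro p
    induction p using Projectivization.ind with
    | h v hv =>
      have hn : ((‖v‖⁻¹ : ℝ) : ℂ) ≠ 0 := by simpa using hv
      refine ⟨⟨((‖v‖⁻¹ : ℝ) : ℂ) • v, ?_⟩, ?_⟩
      · simp [norm_smul, hv]
      · exact (Projectivization.mk_eq_mk_iff' ℂ _ _ _ _).2 ⟨_, rfl⟩
  exact ⟨by simpa [hs.range_eq] using isCompact_range hf⟩

end ProjectiveSpace

/-! ### Faces of the state space that are state spaces of finite-dimensional algebras -/

section Faces

open Matrix

variable {X : Type*} [NormedRing X] [NormedAlgebra ℂ X] {k d : ℕ}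

/-- The pull-back of a ray functional along a linear map into a sum of matrix blocks. -/
def rayState (E : X →ₗ[ℂ] Fin k → Matrix (Fin d) (Fin d) ℂ)
    (hE : ∀ j m n, Continuous fun x => E x j m n) (j : Fin k) (v : Fin d → ℂ) : WeakDual ℂ X :=
  StrongDual.toWeakDual
    { toLinearMap := rayFunctional j v ∘ₗ E
      cont := by
        change Continuous fun x => (star v ⬝ᵥ v)⁻¹ * (star v ⬝ᵥ E x j *ᵥ v)
        simp only [dotProduct, mulVec]
        fun_prop }

variable {E : X →ₗ[ℂ] Fin k → Matrix (Fin d) (Fin d) ℂ}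
  {hE : ∀ j m n, Continuous fun x => E x j m n}

lemma rayState_apply (j : Fin k) (v : Fin d → ℂ) (x : X) :
    rayState E hE j v x = rayFunctional j v (E x) := rfl

lemma weakDual_real_smul_apply (a : ℝ) (ω : WeakDual ℂ X) (x : X) : (a • ω) x = a * ω x := by
  change a • ω x = _
  rw [Complex.real_smul]

lemma rayState_smul (j : Fin k) (v : Fin d → ℂ) {a : ℂ} (ha : a ≠ 0) :
    rayState E hE j (a • v) = rayState E hE j v := by
  refine DFunLike.ext _ _ fun x => ?_
  rw [rayState_apply, rayState_apply, rayFunctional_smul j v ha]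

/-- Surjectivity of `E` reduces the claim to functionals on the blocks. The projection onto `w` in
block `j` has value 1 in the state of `w`; in the state of `v` it would have value 0 in another
block, and value 1 in the same block is the equality case of Cauchy–Schwarz. -/
lemma rayState_injective (hsurj : Function.Surjective E) {i j : Fin k} {v w : Fin d → ℂ}
    (hv : v ≠ 0) (hw : w ≠ 0) (h : rayState E hE i v = rayState E hE j w) :
    i = j ∧ ∃ a : ℂ, a • w = v := by
  have hC : ∀ c, rayFunctional i v c = rayFunctional j w c := by
    intro c
    obtain ⟨x, rfl⟩ := hsurj c
    rw [← rayState_apply (hE := hE), h, rayState_apply]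
  have h1 := hC (rayProj j w)
  have h2 := rayFunctional_rayProj j j w w
  rw [if_pos rfl] at h2
  have hv' := star_dotProduct_self_ne_zero hv
  have hw' := star_dotProduct_self_ne_zero hw
  have h3 : (star w ⬝ᵥ w)⁻¹ * (star w ⬝ᵥ w)⁻¹ * ((star w ⬝ᵥ w) * (star w ⬝ᵥ w)) = 1 := by
    field_simp
  rw [h2, h3, rayFunctional_rayProj] at h1
  split_ifs at h1 with hij
  · refine ⟨hij, (star w ⬝ᵥ w)⁻¹ * (star w ⬝ᵥ v), ?_⟩
    set a := (star w ⬝ᵥ w)⁻¹ * (star w ⬝ᵥ v) with ha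
    have hwsa : star (star w ⬝ᵥ w) = star w ⬝ᵥ w :=
      (IsSelfAdjoint.of_nonneg (dotProduct_star_self_nonneg w)).star_eq
    have hvw : star (star w ⬝ᵥ v) = star v ⬝ᵥ w := by
      rw [star_dotProduct, star_star]
    have hsa : star a = (star w ⬝ᵥ w)⁻¹ * (star v ⬝ᵥ w) := by
      rw [ha, star_mul', star_inv₀, hwsa, hvw]
    -- `a • w` is the orthogonal projection of `v` onto the line of `w`; equality in Cauchy–Schwarz
    -- says that the remainder has norm zero.
    have h0 : star (a • w - v) ⬝ᵥ (a • w - v) = 0 := by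
      simp only [star_sub, star_smul, sub_dotProduct, dotProduct_sub, smul_dotProduct,
        dotProduct_smul, smul_eq_mul, hsa]
      rw [ha]
      field_simp at h1 ⊢
      linear_combination -h1
    exact sub_eq_zero.1 (dotProduct_star_self_eq_zero.1 h0)
  · exact absurd h1 zero_ne_one

lemma continuous_rayState (j : Fin k) :
    Continuous fun v : {v : EuclideanSpace ℂ (Fin d) // v ≠ 0} =>
      rayState E hE j (v.1 : Fin d → ℂ) := by
  refine WeakDual.continuous_of_continuous_eval fun x => ?_
  simp only [rayState_apply, rayFunctional_apply]
  have hc : ∀ i, Continuous fun v : {v : EuclideanSpace ℂ (Fin d) // v ≠ 0} => v.1.ofLp i :=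
    fun i => by fun_prop
  refine Continuous.mul (Continuous.inv₀ ?_ fun v => ?_) ?_
  · simp only [dotProduct, Pi.star_apply]
    fun_prop
  · exact star_dotProduct_self_ne_zero fun h => v.2 (by ext i; exact congrFun h i)
  · simp only [dotProduct, Pi.star_apply, mulVec]
    fun_prop

variable {S : Set (WeakDual ℂ X)}

/-- Each element of `S` is a convex combination of ray states. -/
lemma mem_convexHull_rayState
    (hS : ∀ ω ∈ S, ∃ φ : (Fin k → Matrix (Fin d) (Fin d) ℂ) →ₗ[ℂ] ℂ,
      φ 1 = 1 ∧ (∀ a, 0 ≤ φ (star a * a)) ∧ ∀ x, ω x = φ (E x))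
    {ω : WeakDual ℂ X} (hω : ω ∈ S) :
    ω ∈ convexHull ℝ {ω | ∃ (j : Fin k) (v : Fin d → ℂ), v ≠ 0 ∧ ω = rayState E hE j v} := by
  obtain ⟨φ, h1, hφ, hωφ⟩ := hS ω hω
  obtain ⟨n, b, hb⟩ := exists_eq_sum_of_positive_blocks φ hφ
  have hre : ∀ p, star (b p) ⬝ᵥ b p = ((star (b p) ⬝ᵥ b p).re : ℂ) := fun p =>
    Complex.ext rfl (Complex.le_def.1 (dotProduct_star_self_nonneg (b p))).2.symm
  have hz : ∀ p, p ∉ Finset.univ.filter (fun p => b p ≠ 0) → b p = 0 := by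
    intro p hp
    simpa using hp
  -- The weights are the squared norms, which sum to 1 because `φ 1 = 1`. Zero vectors are discarded
  -- since they define no state.
  have key : ω = ∑ p ∈ Finset.univ.filter (fun p => b p ≠ 0),
      (star (b p) ⬝ᵥ b p).re • rayState E hE p.1 (b p) := by
    refine DFunLike.ext _ _ fun x => ?_
    rw [hωφ, hb, ← Finset.sum_subset (Finset.subset_univ _) fun p _ hp => by simp [hz p hp]]
    have hev : ∀ (s : Finset (Σ j, Fin (n j))) (f : (Σ j, Fin (n j)) → WeakDual ℂ X),
        (∑ p ∈ s, f p) x = ∑ p ∈ s, f p x := fun s f =>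
      map_sum (AddMonoidHom.mk' (fun ω : WeakDual ℂ X => ω x) fun _ _ => rfl) f s
    rw [hev]
    refine Finset.sum_congr rfl fun p hp => ?_
    have hp' := star_dotProduct_self_ne_zero (Finset.mem_filter.1 hp).2
    rw [weakDual_real_smul_apply, ← hre, rayState_apply, rayFunctional_apply,
      mul_inv_cancel_left₀ hp']
  rw [key]
  refine (convex_convexHull ℝ _).sum_mem
    (fun p _ => (Complex.le_def.1 (dotProduct_star_self_nonneg (b p))).1) ?_
    fun p hp => subset_convexHull ℝ _ ⟨p.1, b p, (Finset.mem_filter.1 hp).2, rfl⟩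
  have := hb 1
  rw [h1, ← Finset.sum_subset (Finset.subset_univ _) fun p _ hp => by simp [hz p hp]] at this
  simp only [Pi.one_apply, one_mulVec] at this
  have h := congrArg Complex.re this
  simpa using h.symm

variable [StarRing X]

/-- Ray states are pure relative to the face `S`. -/
lemma rayState_mem_pureStates [StarModule ℂ X] (hsurj : Function.Surjective E)
    (hext : IsExtreme ℝ (stateSpace X) S)
    (hS : ∀ ω, ω ∈ S ↔ ∃ φ : (Fin k → Matrix (Fin d) (Fin d) ℂ) →ₗ[ℂ] ℂ,
      φ 1 = 1 ∧ (∀ a, 0 ≤ φ (star a * a)) ∧ ∀ x, ω x = φ (E x))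
    (j : Fin k) {v : Fin d → ℂ} (hv : v ≠ 0) :
    rayState E hE j v ∈ S ∩ pureStates X := by
  have hmem : rayState E hE j v ∈ S := (hS _).2
    ⟨rayFunctional j v, rayFunctional_one j hv, rayFunctional_nonneg j v, fun x => rfl⟩
  refine ⟨hmem, mem_extremePoints_iff_left.2 ⟨hext.1 hmem, ?_⟩⟩
  intro ω₁ h₁ ω₂ h₂ hseg
  obtain ⟨φ₁, h11, hφ₁, hω₁⟩ := (hS _).1 (hext.2 h₁ h₂ hmem hseg)
  obtain ⟨φ₂, h21, hφ₂, hω₂⟩ := (hS _).1 (hext.2 h₂ h₁ hmem (openSegment_symm ℝ ω₁ ω₂ ▸ hseg))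
  obtain ⟨a, b, ha, hb, hab, habω⟩ := hseg
  have hC : ∀ c, a * φ₁ c + b * φ₂ c = rayFunctional j v c := by
    intro c
    obtain ⟨x, rfl⟩ := hsurj c
    rw [← rayState_apply (hE := hE), ← habω, ← hω₁, ← hω₂, ← weakDual_real_smul_apply,
      ← weakDual_real_smul_apply]
    rfl
  have hp := star_rayProj j v
  have hpp := rayProj_mul_self j hv
  have hray : rayFunctional j v (rayProj j v) = 1 := by
    have := star_dotProduct_self_ne_zero hv
    rw [rayFunctional_rayProj, if_pos rfl]
    field_simp
  have hq : star (1 - rayProj j v) * (1 - rayProj j v) = 1 - rayProj j v := by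
    simp [hp, sub_mul, mul_sub, hpp]
  have hpos₁ := hφ₁ (1 - rayProj j v)
  have hpos₂ := hφ₂ (1 - rayProj j v)
  rw [hq, map_sub] at hpos₁ hpos₂
  -- Both functionals are nonnegative at `1 - rayProj j v`, while their convex combination vanishes
  -- there.
  have hone : φ₁ (rayProj j v) = 1 := by
    have h0 := hC (rayProj j v)
    rw [hray] at h0
    have ha' : (0 : ℂ) < a := by exact_mod_cast ha
    have hb' : (0 : ℂ) < b := by exact_mod_cast hb
    have hab' : (a : ℂ) + b = 1 := by exact_mod_cast hab
    rw [h11] at hpos₁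
    rw [h21] at hpos₂
    have hsum : (a : ℂ) * (1 - φ₁ (rayProj j v)) + b * (1 - φ₂ (rayProj j v)) = 0 := by
      linear_combination hab' - h0
    have hz := (add_eq_zero_iff_of_nonneg (mul_nonneg ha'.le hpos₁)
      (mul_nonneg hb'.le hpos₂)).1 hsum
    have := (mul_eq_zero.1 hz.1).resolve_left ha'.ne'
    exact (sub_eq_zero.1 this).symm
  -- With `p` the ray projection, `φ₁ c = φ₁ (p c p)`, and `p c p` is the ray functional of `c`
  -- times `p`.
  refine DFunLike.ext _ _ fun x => ?_
  rw [hω₁, rayState_apply, ← state_mul_proj hφ₁ hp hpp h11 hone,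
    ← state_proj_mul hφ₁ h11 hp hpp hone, ← mul_assoc, rayProj_mul_mul_rayProj, map_smul, hone,
    smul_eq_mul, mul_one]

/-- The pure states in a face of the state space that is the state space of `k` matrix blocks
of size `d` form `k` copies of the projective space of `ℂ^d`. -/
theorem nonempty_homeomorph_of_face [StarModule ℂ X] (hsurj : Function.Surjective E)
    (hE : ∀ j m n, Continuous fun x => E x j m n)
    (hext : IsExtreme ℝ (stateSpace X) S)
    (hS : ∀ ω, ω ∈ S ↔ ∃ φ : (Fin k → Matrix (Fin d) (Fin d) ℂ) →ₗ[ℂ] ℂ,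
      φ 1 = 1 ∧ (∀ a, 0 ≤ φ (star a * a)) ∧ ∀ x, ω x = φ (E x)) :
    Nonempty ((S ∩ pureStates X : Set (WeakDual ℂ X)) ≃ₜ
      Fin k × ℙ ℂ (EuclideanSpace ℂ (Fin d))) := by
  have hne : ∀ v : {v : EuclideanSpace ℂ (Fin d) // v ≠ 0}, (v.1 : Fin d → ℂ) ≠ 0 :=
    fun v h => v.2 (by ext i; exact congrFun h i)
  let f : Fin k → ℙ ℂ (EuclideanSpace ℂ (Fin d)) → WeakDual ℂ X := fun j =>
    Projectivization.lift (fun v => rayState E hE j (v.1 : Fin d → ℂ)) (by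
      intro a b t hab
      have ht : t ≠ 0 := by
        rintro rfl
        exact a.2 (by simpa using hab)
      simp only [hab, WithLp.ofLp_smul]
      exact rayState_smul j _ ht)
  have hfmk : ∀ j v hv, f j (Projectivization.mk ℂ v hv) = rayState E hE j (v : Fin d → ℂ) :=
    fun j v hv => rfl
  have hfmem : ∀ j p, f j p ∈ S ∩ pureStates X := by
    intro j p
    induction p using Projectivization.ind with
    | h v hv =>
      rw [hfmk]
      exact rayState_mem_pureStates hsurj hext hS j (hne ⟨v, hv⟩)
  have hfc : Continuous fun p : Fin k × ℙ ℂ (EuclideanSpace ℂ (Fin d)) => f p.1 p.2 :=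
    continuous_prod_of_discrete_left.2 fun j =>
      continuous_of_continuous_comp_mk (continuous_rayState (hE := hE) j)
  let g : Fin k × ℙ ℂ (EuclideanSpace ℂ (Fin d)) → (S ∩ pureStates X : Set (WeakDual ℂ X)) :=
    fun p => ⟨f p.1 p.2, hfmem p.1 p.2⟩
  have hg : Continuous g := hfc.subtype_mk _
  have hbij : Function.Bijective g := by
    constructor
    · rintro ⟨i, p⟩ ⟨j, q⟩ h
      have h := congrArg Subtype.val h
      induction p using Projectivization.ind with
      | h v hv =>
      induction q using Projectivization.ind with
      | h w hw =>
      obtain ⟨rfl, a, ha⟩ := rayState_injective (hE := hE) hsurj (hne ⟨v, hv⟩) (hne ⟨w, hw⟩) h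
      refine Prod.ext rfl ((Projectivization.mk_eq_mk_iff' ℂ _ _ _ _).2 ⟨a, ?_⟩)
      ext i
      exact congrFun ha i
    · rintro ⟨ω, hω, hpure⟩
      have hconv := mem_convexHull_rayState (hE := hE) (fun ω h => (hS ω).1 h) hω
      -- An extreme point of the state space that lies in this smaller convex hull is extreme there
      -- too, hence one of the generating ray states.
      have hsub : convexHull ℝ {ω | ∃ (j : Fin k) (v : Fin d → ℂ), v ≠ 0 ∧
          ω = rayState E hE j v} ⊆ stateSpace X := by
        refine convexHull_min ?_ ?_
        · rintro _ ⟨j, v, hv, rfl⟩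
          exact hext.1 (rayState_mem_pureStates hsurj hext hS j hv).1
        · rintro φ ⟨h1, hφ⟩ ψ ⟨h1', hψ⟩ a b ha hb hab
          have happ : ∀ x, (a • φ + b • ψ) x = a * φ x + b * ψ x := fun x => by
            rw [← weakDual_real_smul_apply, ← weakDual_real_smul_apply]
            rfl
          refine ⟨?_, fun x => ?_⟩
          · rw [happ, h1, h1', mul_one, mul_one]
            exact_mod_cast hab
          · rw [happ]
            exact add_nonneg (mul_nonneg (by exact_mod_cast ha) (hφ x))
              (mul_nonneg (by exact_mod_cast hb) (hψ x))
      obtain ⟨j, v, hv, rfl⟩ := extremePoints_convexHull_subset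
        (inter_extremePoints_subset_extremePoints_of_subset hsub ⟨hconv, hpure⟩)
      have hv' : WithLp.toLp 2 v ≠ 0 := fun h => hv (congrArg WithLp.ofLp h)
      exact ⟨(j, Projectivization.mk ℂ (WithLp.toLp 2 v) hv'), Subtype.ext rfl⟩
  -- A continuous bijection from a compact space onto a Hausdorff space; continuity of the inverse
  -- needs no argument of its own.
  exact ⟨(Continuous.homeoOfEquivCompactToT2 (f := Equiv.ofBijective g hbij) hg).symm⟩

/-- The pure states of a full matrix algebra form the projective space. -/
theorem nonempty_pureStates_homeomorph (d : ℕ) :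
    Nonempty (pureStates (EuclideanSpace ℂ (Fin d) →L[ℂ] EuclideanSpace ℂ (Fin d)) ≃ₜ
      ℙ ℂ (EuclideanSpace ℂ (Fin d))) := by
  let e := (toEuclideanCLM (n := Fin d) (𝕜 := ℂ)).symm
  let E : (EuclideanSpace ℂ (Fin d) →L[ℂ] EuclideanSpace ℂ (Fin d)) →ₗ[ℂ]
      Fin 1 → Matrix (Fin d) (Fin d) ℂ := LinearMap.pi fun _ => e.toAlgEquiv.toLinearMap
  have hEe : ∀ T j, E T j = e T := fun T j => rfl
  have hsurj : Function.Surjective E := fun c =>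
    ⟨e.symm (c 0), by ext1 j; rw [Subsingleton.elim j 0, hEe, e.apply_symm_apply]⟩
  have hstar : ∀ T, E (star T * T) = star (E T) * E T := fun T => by
    ext1 j
    simp only [hEe, map_mul, Pi.mul_apply, Pi.star_apply]
    exact congrArg (· * e T) (e.map_star' T)
  have hstar' : ∀ M, e.symm (star M) = star (e.symm M) := e.symm.map_star'
  have hE : ∀ j m n, Continuous fun T => E T j m n := fun j m n =>
    ((Matrix.entryLinearMap ℂ ℂ m n ∘ₗ LinearMap.proj j) ∘ₗ E).continuous_of_finiteDimensional
  have hone : E 1 = 1 := by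
    ext1 j
    simp [hEe]
  let i : (Fin 1 → Matrix (Fin d) (Fin d) ℂ) →ₗ[ℂ]
      (EuclideanSpace ℂ (Fin d) →L[ℂ] EuclideanSpace ℂ (Fin d)) :=
    e.symm.toAlgEquiv.toLinearMap ∘ₗ LinearMap.proj 0
  have hi : ∀ c, i c = e.symm (c 0) := fun c => rfl
  -- The full state space serves as the face, with a single block.
  obtain ⟨h⟩ := nonempty_homeomorph_of_face
    (S := stateSpace (EuclideanSpace ℂ (Fin d) →L[ℂ] EuclideanSpace ℂ (Fin d))) hsurj hE
    (IsExtreme.refl ℝ _) (fun ω => by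
      constructor
      · rintro ⟨h1, hω⟩
        refine ⟨(ω : _ →L[ℂ] ℂ).toLinearMap ∘ₗ i, ?_, fun a => ?_, fun x => ?_⟩
        · change ω (i 1) = 1
          rw [hi, Pi.one_apply, map_one, h1]
        · change 0 ≤ ω (i (star a * a))
          rw [hi, Pi.mul_apply, Pi.star_apply, map_mul, hstar']
          exact hω _
        · change ω x = ω (i (E x))
          rw [hi, hEe, e.symm_apply_apply]
      · rintro ⟨φ, h1, hφ, hx⟩
        refine ⟨by rw [hx, hone, h1], fun a => ?_⟩
        rw [hx, hstar]
        exact hφ _)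
  exact ⟨(Homeomorph.setCongr (Set.inter_eq_right.2 extremePoints_subset)).symm.trans
    (h.trans (Homeomorph.uniqueProd (Fin 1) _))⟩

end Faces

/-! ### Weyl systems and their stabilizer states -/

/-- Unitaries `P t`, `Q s` in a star algebra that represent two abelian groups and commute up to
the phases of a pairing. -/
structure WeylSystem (X T S : Type*) [NormedRing X] [NormedAlgebra ℂ X] [StarRing X]
    [AddCommGroup T] [AddCommGroup S] where
  pair : S → T → Circle
  pair_add_left : ∀ s s' t, pair (s + s') t = pair s t * pair s' t
  pair_add_right : ∀ s t t', pair s (t + t') = pair s t * pair s t'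
  P : T → X
  Q : S → X
  P_zero : P 0 = 1
  Q_zero : Q 0 = 1
  P_add : ∀ t t', P (t + t') = P t * P t'
  Q_add : ∀ s s', Q (s + s') = Q s * Q s'
  star_P : ∀ t, star (P t) = P (-t)
  star_Q : ∀ s, star (Q s) = Q (-s)
  Q_mul_P : ∀ s t, Q s * P t = (pair s t : ℂ) • (P t * Q s)
  -- The density of the span of the Weyl operators is used only in this form.
  ext_state : ∀ ω ω' : WeakDual ℂ X, (∀ t s, ω (P t * Q s) = ω' (P t * Q s)) → ω = ω'

/-- An isometry on which a state takes a phase as value forces the state to vanish on the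
elements with which it commutes up to a nontrivial factor. -/
lemma state_eq_zero_of_commute {A F : Type*} [Ring A] [StarRing A] [Algebra ℂ A]
    [StarModule ℂ A] [FunLike F A ℂ] [LinearMapClass F ℂ A ℂ] {φ : F}
    (hφ : ∀ a : A, 0 ≤ φ (star a * a)) (h1 : φ 1 = 1) {U y : A} (hU : star U * U = 1)
    (hU' : U * star U = 1) {z l : ℂ} (hz : star z * z = 1) (h : φ U = z)
    (hUy : U * y = l • (y * U)) (hl : l ≠ 1) : φ y = 0 := by
  have h2 := congrArg φ hUy
  rw [map_smul, state_unitary_mul hφ h1 hU' hz h, state_mul_isometry hφ h1 hU hz h,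
    smul_eq_mul] at h2
  have hz0 : z ≠ 0 := right_ne_zero_of_mul_eq_one hz
  have h3 : (1 - l) * z * φ y = 0 := by linear_combination h2
  simpa [hz0, sub_eq_zero, hl.symm] using h3

lemma Circle.star_coe_mul_coe (z : Circle) : star (z : ℂ) * (z : ℂ) = 1 := by
  rw [Complex.star_def, Complex.conj_mul']
  simp [Circle.norm_coe]

namespace WeylSystem

variable {X T S : Type*} [NormedRing X] [NormedAlgebra ℂ X] [StarRing X]
  [AddCommGroup T] [AddCommGroup S] (W : WeylSystem X T S)

lemma star_P_mul (t : T) : star (W.P t) * W.P t = 1 := by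
  rw [W.star_P, ← W.P_add, neg_add_cancel, W.P_zero]

lemma P_mul_star (t : T) : W.P t * star (W.P t) = 1 := by
  rw [W.star_P, ← W.P_add, add_neg_cancel, W.P_zero]

lemma star_Q_mul (s : S) : star (W.Q s) * W.Q s = 1 := by
  rw [W.star_Q, ← W.Q_add, neg_add_cancel, W.Q_zero]

lemma Q_mul_star (s : S) : W.Q s * star (W.Q s) = 1 := by
  rw [W.star_Q, ← W.Q_add, add_neg_cancel, W.Q_zero]

lemma pair_zero_left (t : T) : W.pair 0 t = 1 := by
  simpa using W.pair_add_left 0 0 t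

lemma pair_zero_right (s : S) : W.pair s 0 = 1 := by
  simpa using W.pair_add_right s 0 0

lemma pair_neg_right (s : S) (t : T) : W.pair s (-t) = (W.pair s t)⁻¹ := by
  rw [eq_inv_iff_mul_eq_one, ← W.pair_add_right, neg_add_cancel, W.pair_zero_right]

/-- The states that equal `1` on the stabilizers `P t`, `t ∈ BT`, and `Q s`, `s ∈ BS`. -/
def stabilizerStates (BT : AddSubgroup T) (BS : AddSubgroup S) : Set (WeakDual ℂ X) :=
  {ω | ω ∈ stateSpace X ∧ (∀ t ∈ BT, ω (W.P t) = 1) ∧ ∀ s ∈ BS, ω (W.Q s) = 1}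

variable [StarModule ℂ X]

/-- The stabilizer states form a face of the state space. -/
lemma isExtreme_stabilizerStates (BT : AddSubgroup T) (BS : AddSubgroup S) :
    IsExtreme ℝ (stateSpace X) (W.stabilizerStates BT BS) := by
  refine ⟨fun ω h => h.1, fun ω₁ h₁ ω₂ h₂ ω h hseg => ?_⟩
  obtain ⟨a, b, ha, hb, -, rfl⟩ := hseg
  -- The defect `(U - 1)^* (U - 1)` has nonnegative values at `ω₁` and `ω₂` and value zero at an
  -- interior point of the segment, hence value zero at `ω₁`.
  have key : ∀ U : X, star U * U = 1 → (a • ω₁ + b • ω₂) U = 1 → ω₁ U = 1 := by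
    intro U hU h1
    have hd := state_defect_eq_zero h.1.2 h.1.1 hU (z := 1) (by simp) h1
    rw [one_smul] at hd
    have happ : ∀ x, (a • ω₁ + b • ω₂) x = a * ω₁ x + b * ω₂ x := fun x => by
      rw [← weakDual_real_smul_apply, ← weakDual_real_smul_apply]
      rfl
    rw [happ] at hd
    have ha' : (0 : ℂ) < a := by exact_mod_cast ha
    have hb' : (0 : ℂ) < b := by exact_mod_cast hb
    have hz := ((add_eq_zero_iff_of_nonneg (mul_nonneg ha'.le (h₁.2 _))
      (mul_nonneg hb'.le (h₂.2 _))).1 hd).1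
    exact state_eq_one_of_defect h₁.2 h₁.1 ((mul_eq_zero.1 hz).resolve_left ha'.ne')
  exact ⟨h₁, fun t ht => key _ (W.star_P_mul t) (h.2.1 t ht),
    fun s hs => key _ (W.star_Q_mul s) (h.2.2 s hs)⟩

end WeylSystem

/-- A Weyl system together with stabilizer groups `BT`, `BS`, their annihilators `ZT`, `ZS`, and
representatives and characters for the finite quotients `ZT / BT`, `ZS / BS`. -/
structure StabilizerCode (X T S : Type*) [NormedRing X] [NormedAlgebra ℂ X] [StarRing X]
    [AddCommGroup T] [AddCommGroup S] (k d : ℕ) extends WeylSystem X T S where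
  BT : AddSubgroup T
  ZT : AddSubgroup T
  KT : AddSubgroup T
  BS : AddSubgroup S
  ZS : AddSubgroup S
  KS : AddSubgroup S
  mem_ZT : ∀ t, t ∈ ZT ↔ ∀ s ∈ BS, pair s t = 1
  mem_ZS : ∀ s, s ∈ ZS ↔ ∀ t ∈ BT, pair s t = 1
  BT_le : BT ≤ ZT
  mem_KT : ∀ t, t ∈ KT ↔ t ∈ ZT ∧ ∀ s ∈ ZS, pair s t = 1
  mem_KS : ∀ s, s ∈ KS ↔ s ∈ ZS ∧ ∀ t ∈ ZT, pair s t = 1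
  /-- representatives of `ZT / KT` -/
  rep : Fin d → T
  rep_mem : ∀ m, rep m ∈ ZT
  exists_rep : ∀ t ∈ ZT, ∃ m, t - rep m ∈ KT
  rep_inj : ∀ m n, rep m - rep n ∈ KT → m = n
  /-- the index set of the classes of `(ZT × ZS) / (BT × BS)` -/
  H : Type*
  [fintypeH : Fintype H]
  -- The right side is the dimension of `k` blocks of size `d`, so that linear independence will
  -- suffice for a basis.
  card_H : Fintype.card H = k * (d * d)
  /-- representatives of the classes -/
  repT : H → T
  repS : H → S
  repT_mem : ∀ h, repT h ∈ ZT
  repS_mem : ∀ h, repS h ∈ ZS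
  exists_repH : ∀ t ∈ ZT, ∀ s ∈ ZS, ∃ h, t - repT h ∈ BT ∧ s - repS h ∈ BS
  repH_inj : ∀ h h', repT h - repT h' ∈ BT → repS h - repS h' ∈ BS → h = h'
  /-- characters of `ZT / BT` and of `ZS / BS` -/
  charT : Fin k → T → Circle
  charS : Fin k → S → Circle
  charT_BT : ∀ j, ∀ t ∈ BT, charT j t = 1
  charS_BS : ∀ j, ∀ s ∈ BS, charS j s = 1
  -- Orthogonality on the radical: the `k` characters restrict to all characters of `(KT × KS) / (BT
  -- × BS)`, so their sum vanishes off the identity.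
  sum_char : ∀ t ∈ KT, ∀ s ∈ KS, ¬ (t ∈ BT ∧ s ∈ BS) →
    ∑ j, (charT j t : ℂ) * (charS j s : ℂ) = 0
  exists_state : ∀ j, ∃ ω ∈ stateSpace X,
    (∀ t ∈ KT, ω (P t) = charT j t) ∧ ∀ s ∈ ZS, ω (Q s) = charS j s

/-! ### The compression onto the logical matrix algebra -/

namespace StabilizerCode

open Matrix

attribute [instance] fintypeH

variable {X T S : Type*} [NormedRing X] [NormedAlgebra ℂ X] [StarRing X]
  [AddCommGroup T] [AddCommGroup S] {k d : ℕ} (W : StabilizerCode X T S k d)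

lemma BT_le_KT : W.BT ≤ W.KT := fun t ht =>
  (W.mem_KT t).2 ⟨W.BT_le ht, fun s hs => (W.mem_ZS s).1 hs t ht⟩

lemma BS_le_ZS : W.BS ≤ W.ZS := fun s hs =>
  (W.mem_ZS s).2 fun t ht => (W.mem_ZT t).1 (W.BT_le ht) s hs

lemma KT_le_ZT : W.KT ≤ W.ZT := fun _ ht => ((W.mem_KT _).1 ht).1

lemma pair_of_ZS_KT {s : S} {t : T} (hs : s ∈ W.ZS) (ht : t ∈ W.KT) : W.pair s t = 1 :=
  ((W.mem_KT t).1 ht).2 s hs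

/-- A state with prescribed values on the maximal isotropic group `KT × ZS`. -/
def charState (j : Fin k) : WeakDual ℂ X := (W.exists_state j).choose

lemma charState_mem (j : Fin k) : W.charState j ∈ stateSpace X :=
  (W.exists_state j).choose_spec.1

lemma charState_P (j : Fin k) {t : T} (ht : t ∈ W.KT) : W.charState j (W.P t) = W.charT j t :=
  (W.exists_state j).choose_spec.2.1 t ht

lemma charState_Q (j : Fin k) {s : S} (hs : s ∈ W.ZS) : W.charState j (W.Q s) = W.charS j s :=
  (W.exists_state j).choose_spec.2.2 s hs

lemma P_mul_P_mul_Q (t t' : T) (s : S) :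
    W.P t' * (W.P t * W.Q s) = (W.pair s (-t') : ℂ) • (W.P t * W.Q s * W.P t') := by
  rw [mul_assoc (W.P t), W.Q_mul_P, mul_smul_comm, smul_smul, ← mul_assoc, ← mul_assoc,
    ← W.P_add, ← W.P_add, add_comm, ← Circle.coe_mul, ← W.pair_add_right, neg_add_cancel,
    W.pair_zero_right, Circle.coe_one, one_smul]

lemma Q_mul_P_mul_Q (t : T) (s s' : S) :
    W.Q s' * (W.P t * W.Q s) = (W.pair s' t : ℂ) • (W.P t * W.Q s * W.Q s') := by
  rw [← mul_assoc, W.Q_mul_P, smul_mul_assoc, mul_assoc, mul_assoc, ← W.Q_add, ← W.Q_add,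
    add_comm]

/-- The compression of the algebra onto the logical algebra. -/
def compression : X →ₗ[ℂ] Fin k → Matrix (Fin d) (Fin d) ℂ where
  -- In the GNS space of `charState j` with cyclic vector `Ω`, these are the matrix coefficients of
  -- `x` between the vectors `P (rep m) Ω`, one for each class of `ZT / KT`.
  toFun x j := Matrix.of fun m n => W.charState j (star (W.P (W.rep m)) * x * W.P (W.rep n))
  map_add' x y := by
    ext j m n
    simp [mul_add, add_mul]
  map_smul' a x := by
    ext j m n
    simp

lemma compression_apply (x : X) (j : Fin k) (m n : Fin d) :
    W.compression x j m n = W.charState j (star (W.P (W.rep m)) * x * W.P (W.rep n)) := rfl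

lemma continuous_compression (j : Fin k) (m n : Fin d) :
    Continuous fun x => W.compression x j m n := by
  have h : Continuous (W.charState j) := (W.charState j).cont
  exact h.comp (by fun_prop)

lemma star_P_mul_P_mul_Q_mul_P (t : T) (s : S) (u v : T) :
    star (W.P u) * (W.P t * W.Q s) * W.P v =
      (W.pair s v : ℂ) • (W.P (t + v - u) * W.Q s) := by
  rw [W.star_P, mul_assoc, mul_assoc, W.Q_mul_P, mul_smul_comm, mul_smul_comm, ← mul_assoc,
    ← mul_assoc, ← W.P_add, ← W.P_add]
  congr 4
  abel

/-- Pairing with `s` is a character of `ZT / KT`, nontrivial because `s` is outside `KS`;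
translation by a `u` with value different from 1 permutes the classes and multiplies the sum by that
value. -/
lemma sum_pair_rep {s : S} (hs : s ∈ W.ZS) (hs' : s ∉ W.KS) :
    ∑ m, (W.pair s (W.rep m) : ℂ) = 0 := by
  have h : ∃ u ∈ W.ZT, W.pair s u ≠ 1 := by
    by_contra! hcon
    exact hs' ((W.mem_KS s).2 ⟨hs, hcon⟩)
  obtain ⟨u, hu, hsu⟩ := h
  choose f hf using fun m => W.exists_rep (u + W.rep m) (W.ZT.add_mem hu (W.rep_mem m))
  have hinj : Function.Injective f := by
    intro m n hmn
    refine W.rep_inj m n ?_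
    have := W.KT.sub_mem (hf m) (hf n)
    rwa [hmn, show u + W.rep m - W.rep (f n) - (u + W.rep n - W.rep (f n)) =
      W.rep m - W.rep n by abel] at this
  have hpair : ∀ m, W.pair s (W.rep (f m)) = W.pair s u * W.pair s (W.rep m) := by
    intro m
    have h1 := W.pair_add_right s (u + W.rep m - W.rep (f m)) (W.rep (f m))
    rw [sub_add_cancel, W.pair_of_ZS_KT hs (hf m), one_mul, W.pair_add_right] at h1
    exact h1.symm
  have h1 : ∑ m, (W.pair s (W.rep m) : ℂ) = W.pair s u * ∑ m, (W.pair s (W.rep m) : ℂ) := by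
    rw [Finset.mul_sum, ← (Equiv.ofBijective f (Finite.injective_iff_bijective.1 hinj)).sum_comp]
    exact Finset.sum_congr rfl fun m _ => by
      rw [Equiv.ofBijective_apply, hpair, Circle.coe_mul]
  have h2 : (1 - (W.pair s u : ℂ)) * ∑ m, (W.pair s (W.rep m) : ℂ) = 0 := by
    linear_combination h1
  refine (mul_eq_zero.1 h2).resolve_left fun h => hsu ?_
  rw [← Circle.coe_eq_one]
  linear_combination -h

variable [StarModule ℂ X]

/-- `KT × ZS` is maximal isotropic: outside it, the Weyl operator fails to commute with a unitary on
which the state is a phase, namely a clock from `ZS` or a shift from `BT`, and so has value zero. -/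
lemma charState_P_mul_Q (j : Fin k) (t : T) (s : S) :
    W.charState j (W.P t * W.Q s) =
      if t ∈ W.KT ∧ s ∈ W.ZS then (W.charT j t : ℂ) * W.charS j s else 0 := by
  have hω := W.charState_mem j
  split_ifs with h
  · rw [state_mul_isometry hω.2 hω.1 (W.star_Q_mul s) (Circle.star_coe_mul_coe _)
      (W.charState_Q j h.2), W.charState_P j h.1, mul_comm]
  · by_cases hs : s ∈ W.ZS
    · have ht : ∃ b ∈ W.ZS, W.pair b t ≠ 1 := by
        by_contra! hcon
        exact h ⟨(W.mem_KT t).2 ⟨(W.mem_ZT t).2 fun b hb => hcon b (W.BS_le_ZS hb), hcon⟩, hs⟩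
      obtain ⟨b, hb, hbt⟩ := ht
      exact state_eq_zero_of_commute hω.2 hω.1 (W.star_Q_mul b) (W.Q_mul_star b)
        (Circle.star_coe_mul_coe _) (W.charState_Q j hb) (W.Q_mul_P_mul_Q t s b)
        (by rwa [Ne, Circle.coe_eq_one])
    · rw [W.mem_ZS] at hs
      push Not at hs
      obtain ⟨b, hb, hbs⟩ := hs
      refine state_eq_zero_of_commute hω.2 hω.1 (W.star_P_mul b) (W.P_mul_star b)
        (Circle.star_coe_mul_coe _) (W.charState_P j (W.BT_le_KT hb)) (W.P_mul_P_mul_Q t b s) ?_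
      rw [Ne, Circle.coe_eq_one, W.pair_neg_right, inv_eq_one]
      exact hbs

lemma compression_star (x : X) : W.compression (star x) = star (W.compression x) := by
  ext j m n
  rw [Pi.star_apply, star_apply, compression_apply, compression_apply,
    ← positive_map_star (W.charState_mem j).2]
  simp [mul_assoc]

lemma compression_P_mul_Q (t : T) (s : S) (j : Fin k) (m n : Fin d) :
    W.compression (W.P t * W.Q s) j m n = (W.pair s (W.rep n) : ℂ) *
      if t + W.rep n - W.rep m ∈ W.KT ∧ s ∈ W.ZS then
        (W.charT j (t + W.rep n - W.rep m) : ℂ) * W.charS j s else 0 := by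
  rw [compression_apply, star_P_mul_P_mul_Q_mul_P, map_smul, charState_P_mul_Q, smul_eq_mul]

lemma compression_eq_zero {t : T} {s : S} (h : ¬ (t ∈ W.ZT ∧ s ∈ W.ZS)) :
    W.compression (W.P t * W.Q s) = 0 := by
  ext j m n
  rw [compression_P_mul_Q, if_neg, mul_zero]
  · rfl
  · rintro ⟨h1, h2⟩
    refine h ⟨?_, h2⟩
    have := W.ZT.add_mem (W.ZT.sub_mem (W.KT_le_ZT h1) (W.rep_mem n)) (W.rep_mem m)
    rwa [show t + W.rep n - W.rep m - W.rep n + W.rep m = t by abel] at this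

lemma compression_of_stabilizer {t : T} {s : S} (ht : t ∈ W.BT) (hs : s ∈ W.BS) :
    W.compression (W.P t * W.Q s) = 1 := by
  ext j m n
  rw [compression_P_mul_Q, (W.mem_ZT _).1 (W.rep_mem n) s hs, Pi.one_apply]
  by_cases hmn : m = n
  · subst hmn
    rw [add_sub_cancel_right, if_pos ⟨W.BT_le_KT ht, W.BS_le_ZS hs⟩, W.charT_BT j t ht,
      W.charS_BS j s hs]
    simp
  · rw [if_neg, mul_zero, one_apply_ne hmn]
    rintro ⟨h, -⟩
    refine hmn (W.rep_inj n m ?_).symm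
    have := W.KT.sub_mem h (W.BT_le_KT ht)
    rwa [show t + W.rep n - W.rep m - t = W.rep n - W.rep m by abel] at this

lemma compression_one : W.compression 1 = 1 := by
  have := W.compression_of_stabilizer W.BT.zero_mem W.BS.zero_mem
  rwa [W.P_zero, W.Q_zero, one_mul] at this

/-- The compression is multiplicative with respect to the Weyl operators of the centralizer. -/
lemma compression_mul (x : X) {t : T} {s : S} (ht : t ∈ W.ZT) (hs : s ∈ W.ZS) :
    W.compression (x * (W.P t * W.Q s)) =
      W.compression x * W.compression (W.P t * W.Q s) := by
  ext j m n
  have hω := W.charState_mem j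
  -- `P t * Q s` sends the vector of `rep n` to a multiple of the vector of `rep p`, so `p` is the
  -- only index contributing to the matrix product.
  obtain ⟨p, hp⟩ := W.exists_rep (t + W.rep n) (W.ZT.add_mem ht (W.rep_mem n))
  rw [Pi.mul_apply, mul_apply, Finset.sum_eq_single p]
  · have hz : star ((W.charT j (t + W.rep n - W.rep p) * W.charS j s : Circle) : ℂ) *
        ((W.charT j (t + W.rep n - W.rep p) * W.charS j s : Circle) : ℂ) = 1 :=
      Circle.star_coe_mul_coe _
    have hW : star (W.P (t + W.rep n - W.rep p) * W.Q s) *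
        (W.P (t + W.rep n - W.rep p) * W.Q s) = 1 := by
      rw [star_mul, mul_assoc, ← mul_assoc (star (W.P _)), W.star_P_mul, one_mul, W.star_Q_mul]
    have hval : W.charState j (W.P (t + W.rep n - W.rep p) * W.Q s) =
        ((W.charT j (t + W.rep n - W.rep p) * W.charS j s : Circle) : ℂ) := by
      rw [charState_P_mul_Q, if_pos ⟨hp, hs⟩, Circle.coe_mul]
    -- Once `P (rep p)` is split off, the remaining Weyl operator lies over `KT × ZS` and is
    -- absorbed by the state on the right.
    have hmove : star (W.P (W.rep m)) * (x * (W.P t * W.Q s)) * W.P (W.rep n) =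
        (W.pair s (W.rep n) : ℂ) • (star (W.P (W.rep m)) * x * W.P (W.rep p) *
          (W.P (t + W.rep n - W.rep p) * W.Q s)) := by
      have h := W.star_P_mul_P_mul_Q_mul_P t s (W.rep p) (W.rep n)
      have h' := congrArg (fun y => star (W.P (W.rep m)) * x * W.P (W.rep p) * y) h
      simp only [mul_smul_comm] at h'
      rw [← h']
      have hu := W.P_mul_star (W.rep p)
      calc _ = star (W.P (W.rep m)) * x * 1 * ((W.P t * W.Q s) * W.P (W.rep n)) := by
            simp only [mul_assoc, one_mul]
        _ = _ := by
            rw [← hu]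
            simp only [mul_assoc]
    rw [compression_apply, hmove, map_smul, state_mul_isometry hω.2 hω.1 hW hz hval,
      compression_apply, compression_P_mul_Q, if_pos ⟨hp, hs⟩, Circle.coe_mul, smul_eq_mul]
    ring
  · intro q _ hq
    rw [compression_P_mul_Q, if_neg, mul_zero, mul_zero]
    rintro ⟨h, -⟩
    refine hq (W.rep_inj q p ?_)
    have := W.KT.sub_mem hp h
    rwa [show t + W.rep n - W.rep p - (t + W.rep n - W.rep q) = W.rep q - W.rep p by abel]
      at this
  · simp

/-- The total trace of a compressed Weyl operator vanishes unless it is a stabilizer. -/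
lemma sum_trace_compression {t : T} {s : S} (hs : s ∈ W.ZS)
    (h : ¬ (t ∈ W.BT ∧ s ∈ W.BS)) :
    ∑ j, (W.compression (W.P t * W.Q s) j).trace = 0 := by
  simp only [trace, diag_apply, compression_P_mul_Q, add_sub_cancel_right]
  -- Three cases: for `t` outside `KT` all diagonal entries vanish; for `s` outside `KS` the sum
  -- over representatives vanishes; over the radical the sum over the blocks vanishes.
  by_cases ht : t ∈ W.KT
  · simp only [ht, hs, and_self, if_true, ← Finset.sum_mul]
    rw [← Finset.mul_sum]
    by_cases hs' : s ∈ W.KS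
    · rw [W.sum_char t ht s hs' h, mul_zero]
    · rw [W.sum_pair_rep hs hs', zero_mul]
  · simp [ht]

/-- Trace orthogonality: multiplication by the compression of `y`, the inverse up to a phase of the
operator of `h₀`, leaves only the coefficient of `h₀` in the total trace, multiplied by a phase and
by `k d`. -/
lemma linearIndependent_compression :
    LinearIndependent ℂ fun h : W.H => W.compression (W.P (W.repT h) * W.Q (W.repS h)) := by
  rw [Fintype.linearIndependent_iff]
  intro c hc h₀
  let y := W.P (-W.repT h₀) * W.Q (-W.repS h₀)
  have hprod : ∀ h, W.compression y * W.compression (W.P (W.repT h) * W.Q (W.repS h)) =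
      (W.pair (-W.repS h₀) (W.repT h) : ℂ) •
        W.compression (W.P (W.repT h - W.repT h₀) * W.Q (W.repS h - W.repS h₀)) := by
    intro h
    rw [← W.compression_mul _ (W.repT_mem h) (W.repS_mem h), ← map_smul]
    congr 1
    calc W.P (-W.repT h₀) * W.Q (-W.repS h₀) * (W.P (W.repT h) * W.Q (W.repS h))
        = W.P (-W.repT h₀) * (W.Q (-W.repS h₀) * W.P (W.repT h)) * W.Q (W.repS h) := by
          simp only [mul_assoc]
      _ = _ := by
          rw [W.Q_mul_P, mul_smul_comm, smul_mul_assoc, ← mul_assoc, ← W.P_add, mul_assoc,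
            ← W.Q_add]
          congr 4 <;> abel
  have htr := congrArg (fun M => ∑ j, ((W.compression y * M) j).trace) hc
  simp only [Finset.mul_sum, mul_smul_comm, hprod, Finset.sum_apply, Pi.smul_apply, trace_sum,
    trace_smul, mul_zero, Pi.zero_apply, trace_zero, Finset.sum_const_zero] at htr
  rw [Finset.sum_comm] at htr
  simp only [← Finset.smul_sum] at htr
  rw [Finset.sum_eq_single h₀] at htr
  · have hcard : 0 < k * (d * d) := W.card_H ▸ Fintype.card_pos_iff.2 ⟨h₀⟩
    have hk : (k : ℂ) ≠ 0 := by
      rintro h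
      simp [Nat.cast_eq_zero.1 h] at hcard
    have hd : (d : ℂ) ≠ 0 := by
      rintro h
      simp [Nat.cast_eq_zero.1 h] at hcard
    simpa [sub_self, W.P_zero, W.Q_zero, compression_one, hk, hd] using htr
  · intro h _ hne
    rw [W.sum_trace_compression (W.ZS.sub_mem (W.repS_mem h) (W.repS_mem h₀)), smul_zero,
      smul_zero]
    exact fun hB => hne (W.repH_inj h h₀ hB.1 hB.2)
  · simp

/-- The compressed Weyl operators form a basis of the logical algebra. -/
def logicalBasis : Module.Basis W.H ℂ (Fin k → Matrix (Fin d) (Fin d) ℂ) :=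
  basisOfLinearIndependentOfCardEqFinrank' _ W.linearIndependent_compression (by
    rw [W.card_H]
    simp [Module.finrank_pi_fintype, Module.finrank_matrix])

lemma logicalBasis_apply (h : W.H) :
    W.logicalBasis h = W.compression (W.P (W.repT h) * W.Q (W.repS h)) := by
  simp [logicalBasis]

/-- A preimage under the compression. -/
def lift (c : Fin k → Matrix (Fin d) (Fin d) ℂ) : X :=
  ∑ h, W.logicalBasis.repr c h • (W.P (W.repT h) * W.Q (W.repS h))

lemma compression_lift (c : Fin k → Matrix (Fin d) (Fin d) ℂ) :
    W.compression (W.lift c) = c := by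
  simp only [lift, map_sum, map_smul, ← logicalBasis_apply]
  exact W.logicalBasis.sum_repr c

/-- A lift is a combination of Weyl operators of the centralizer, against which the compression is
multiplicative. For `x` the adjoint of a lift this transfers squares from the blocks to the algebra.
-/
lemma compression_mul_lift (x : X) (c : Fin k → Matrix (Fin d) (Fin d) ℂ) :
    W.compression (x * W.lift c) = W.compression x * c := by
  conv_rhs => rw [← W.compression_lift c]
  simp only [lift, Finset.mul_sum, map_sum, mul_smul_comm, map_smul]
  exact Finset.sum_congr rfl fun h _ => by
    rw [W.compression_mul _ (W.repT_mem h) (W.repS_mem h)]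

/-- The quadratic form at `y` is the value of `charState j` at `z^* z` with `z = ∑ y n • x P (rep
n)`, so no multiplicativity for general `x` is needed. -/
lemma compression_star_mul_self_posSemidef (x : X) (j : Fin k) :
    (W.compression (star x * x) j).PosSemidef := by
  refine PosSemidef.of_dotProduct_mulVec_nonneg ?_ fun y => ?_
  · have h := W.compression_star (star x * x)
    rw [star_mul, star_star] at h
    exact (congrFun h j).symm
  · have h := (W.charState_mem j).2 (∑ n, y n • (x * W.P (W.rep n)))
    have heq : star y ⬝ᵥ W.compression (star x * x) j *ᵥ y =
        W.charState j (star (∑ n, y n • (x * W.P (W.rep n))) *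
          ∑ n, y n • (x * W.P (W.rep n))) := by
      simp only [star_sum, Finset.sum_mul, Finset.mul_sum, map_sum, dotProduct, mulVec,
        star_smul, smul_mul_assoc, mul_smul_comm, map_smul, smul_eq_mul, star_mul,
        compression_apply, Pi.star_apply, mul_assoc]
      rw [Finset.sum_comm]
      exact Finset.sum_congr rfl fun n _ => Finset.sum_congr rfl fun m _ => by ring
    rw [heq]
    exact h

lemma stabilizer_state_mul {ω : WeakDual ℂ X} (hω : ω ∈ W.stabilizerStates W.BT W.BS)
    {b : T} {b' : S} (hb : b ∈ W.BT) (hb' : b' ∈ W.BS) (t : T) (s : S) :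
    ω (W.P (b + t) * W.Q (s + b')) = ω (W.P t * W.Q s) := by
  rw [W.P_add, W.Q_add, mul_assoc,
    state_unitary_mul hω.1.2 hω.1.1 (W.P_mul_star b) (by simp) (hω.2.1 b hb), one_mul,
    ← mul_assoc, state_mul_isometry hω.1.2 hω.1.1 (W.star_Q_mul b') (by simp) (hω.2.2 b' hb'),
    one_mul]

/-- `ZT` and `ZS` are annihilators, so outside them the operator commutes with some stabilizer only
up to a nontrivial phase. -/
lemma stabilizer_state_eq_zero {ω : WeakDual ℂ X} (hω : ω ∈ W.stabilizerStates W.BT W.BS)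
    {t : T} {s : S} (h : ¬ (t ∈ W.ZT ∧ s ∈ W.ZS)) : ω (W.P t * W.Q s) = 0 := by
  rw [not_and_or, W.mem_ZT, W.mem_ZS] at h
  push Not at h
  obtain ⟨b, hb, hne⟩ | ⟨b, hb, hne⟩ := h
  · exact state_eq_zero_of_commute hω.1.2 hω.1.1 (W.star_Q_mul b) (W.Q_mul_star b)
      (by simp) (hω.2.2 b hb) (W.Q_mul_P_mul_Q t s b) (by rwa [Ne, Circle.coe_eq_one])
  · refine state_eq_zero_of_commute hω.1.2 hω.1.1 (W.star_P_mul b) (W.P_mul_star b)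
      (by simp) (hω.2.1 b hb) (W.P_mul_P_mul_Q t b s) ?_
    rw [Ne, Circle.coe_eq_one, W.pair_neg_right, inv_eq_one]
    exact hne

/-- The stabilizer states are the states of the logical algebra. -/
lemma mem_stabilizerStates_iff (ω : WeakDual ℂ X) :
    ω ∈ W.stabilizerStates W.BT W.BS ↔
      ∃ φ : (Fin k → Matrix (Fin d) (Fin d) ℂ) →ₗ[ℂ] ℂ,
        φ 1 = 1 ∧ (∀ a, 0 ≤ φ (star a * a)) ∧ ∀ x, ω x = φ (W.compression x) := by
  constructor
  · intro hω
    -- The values of `ω` on the representatives are the only possible choice; the work is to check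
    -- the identity on all Weyl operators and then to extend it by `ext_state`.
    let φ := W.logicalBasis.constr ℂ fun h => ω (W.P (W.repT h) * W.Q (W.repS h))
    have hφ : ∀ t s, φ (W.compression (W.P t * W.Q s)) = ω (W.P t * W.Q s) := by
      intro t s
      by_cases h : t ∈ W.ZT ∧ s ∈ W.ZS
      · obtain ⟨i, hT, hS⟩ := W.exists_repH t h.1 s h.2
        have ht : t = (t - W.repT i) + W.repT i := (sub_add_cancel _ _).symm
        have hs : s = W.repS i + (s - W.repS i) := (add_sub_cancel _ _).symm
        -- A shift stabilizer on the left and a clock stabilizer on the right reduce the operator to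
        -- a representative without producing a phase.
        have hW : W.P t * W.Q s = W.P (t - W.repT i) * W.Q 0 *
            (W.P (W.repT i) * W.Q (W.repS i)) * (W.P 0 * W.Q (s - W.repS i)) := by
          conv_lhs => rw [ht, hs, W.P_add, W.Q_add]
          simp only [W.P_zero, W.Q_zero, one_mul, mul_one, mul_assoc]
        conv_rhs => rw [ht, hs, W.stabilizer_state_mul hω hT hS]
        rw [hW, W.compression_mul _ W.ZT.zero_mem (W.BS_le_ZS hS),
          W.compression_mul _ (W.repT_mem i) (W.repS_mem i),
          W.compression_of_stabilizer hT W.BS.zero_mem,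
          W.compression_of_stabilizer W.BT.zero_mem hS, one_mul, mul_one, ← logicalBasis_apply]
        exact W.logicalBasis.constr_basis ℂ _ i
      · rw [W.compression_eq_zero h, map_zero, W.stabilizer_state_eq_zero hω h]
    let ω' : WeakDual ℂ X := StrongDual.toWeakDual
      { toLinearMap := φ ∘ₗ W.compression
        cont := φ.continuous_of_finiteDimensional.comp
          (continuous_pi fun j => continuous_pi fun m => continuous_pi fun n =>
            W.continuous_compression j m n) }
    have hω' : ∀ x, ω' x = φ (W.compression x) := fun x => rfl
    have heq : ∀ x, ω x = φ (W.compression x) := by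
      have : ω = ω' := W.ext_state _ _ fun t s => by rw [hω', hφ]
      intro x
      rw [← hω', this]
    refine ⟨φ, ?_, fun a => ?_, heq⟩
    · rw [← W.compression_one, ← heq, hω.1.1]
    -- Positivity of `φ` at `a^* a` is positivity of `ω` at the square of the lift.
    · have h := hω.1.2 (W.lift a)
      rwa [heq, W.compression_mul_lift, W.compression_star, W.compression_lift] at h
  · rintro ⟨φ, h1, hφ, hx⟩
    refine ⟨⟨by rw [hx, W.compression_one, h1], fun x => ?_⟩, fun t ht => ?_, fun s hs => ?_⟩
    · rw [hx]
      exact positive_blocks_nonneg φ hφ (W.compression_star_mul_self_posSemidef x)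
    · have := W.compression_of_stabilizer ht W.BS.zero_mem
      rw [W.Q_zero, mul_one] at this
      rw [hx, this, h1]
    · have := W.compression_of_stabilizer W.BT.zero_mem hs
      rw [W.P_zero, one_mul] at this
      rw [hx, this, h1]

/-- The pure stabilizer states form `k` copies of the projective space of `ℂ^d`. -/
theorem nonempty_homeomorph :
    Nonempty ((W.stabilizerStates W.BT W.BS ∩ pureStates X : Set (WeakDual ℂ X)) ≃ₜ
      Fin k × ℙ ℂ (EuclideanSpace ℂ (Fin d))) :=
  nonempty_homeomorph_of_face (fun c => ⟨W.lift c, W.compression_lift c⟩)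
    W.continuous_compression (W.isExtreme_stabilizerStates W.BT W.BS) W.mem_stabilizerStates_iff

end StabilizerCode

/-! ### Characters of finite abelian groups -/

section FiniteDuality

variable {A B : Type*} [AddCommGroup A] [AddCommGroup B]

/-- Circle-valued characters in additive and in multiplicative notation. -/
def circleCharEquiv (A : Type*) [AddCommGroup A] :
    (Multiplicative A →* Circleˣ) ≃ (A →+ Additive Circle) where
  toFun φ := AddMonoidHom.mk' (fun a => Additive.ofMul (φ (Multiplicative.ofAdd a) : Circle))
    fun a b => by simp
  invFun ψ := MonoidHom.mk' (fun a => toUnits (ψ a.toAdd).toMul) fun a b => by simp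
  left_inv φ := by
    ext a
    simp
  right_inv ψ := by
    ext a
    simp

lemma circleCharEquiv_apply (φ : Multiplicative A →* Circleˣ) (a : A) :
    circleCharEquiv A φ a = Additive.ofMul (φ (Multiplicative.ofAdd a) : Circle) := rfl

instance neZero_exponent_multiplicative [Finite A] :
    NeZero (Monoid.exponent (Multiplicative A)) :=
  ⟨Monoid.exponent_ne_zero_of_finite⟩

lemma card_circleChar (A : Type*) [AddCommGroup A] [Finite A] :
    Nat.card (A →+ Additive Circle) = Nat.card A := by
  rw [← Nat.card_congr (circleCharEquiv A),
    CommGroup.card_monoidHom_of_hasEnoughRootsOfUnity (Multiplicative A) Circle]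
  exact Nat.card_congr Multiplicative.toAdd

instance finite_circleChar [Finite A] : Finite (A →+ Additive Circle) :=
  Nat.finite_of_card_ne_zero (by rw [card_circleChar]; exact Nat.card_pos.ne')

lemma exists_circleChar_ne_zero [Finite A] {a : A} (ha : a ≠ 0) :
    ∃ ψ : A →+ Additive Circle, ψ a ≠ 0 := by
  obtain ⟨φ, hφ⟩ := CommGroup.exists_apply_ne_one_of_hasEnoughRootsOfUnity
    (Multiplicative A) Circle (a := Multiplicative.ofAdd a) (by simpa using ha)
  refine ⟨circleCharEquiv A φ, fun h => hφ ?_⟩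
  rw [circleCharEquiv_apply, ofMul_eq_zero] at h
  exact Units.ext h

lemma exists_circleChar_extension [Finite A] (I : AddSubgroup A) (ψ : I →+ Additive Circle) :
    ∃ χ : A →+ Additive Circle, ∀ i : I, χ i = ψ i := by
  let I' : Subgroup (Multiplicative A) := AddSubgroup.toSubgroup I
  let ψ' : I' →* Circleˣ :=
    MonoidHom.mk' (fun a => toUnits (ψ ⟨(a : Multiplicative A).toAdd, a.2⟩).toMul) fun a b => by
      rw [← map_mul, ← toMul_add, ← map_add]
      rfl
  obtain ⟨φ, hφ⟩ := MonoidHom.domRestrict_surjective Circle I' ψ'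
  refine ⟨circleCharEquiv A φ, fun i => ?_⟩
  have h := DFunLike.congr_fun hφ ⟨Multiplicative.ofAdd (i : A), i.2⟩
  have h' := congrArg Units.val h
  exact congrArg Additive.ofMul h'

/-- Translation of the sum by a character `χ` with nontrivial value at `a` multiplies it by that
value. -/
lemma sum_circleChar_eq_zero [Fintype (A →+ Additive Circle)] [Finite A] {a : A} (ha : a ≠ 0) :
    ∑ ψ : A →+ Additive Circle, ((ψ a).toMul : ℂ) = 0 := by
  obtain ⟨χ, hχ⟩ := exists_circleChar_ne_zero ha
  have h : ∑ ψ : A →+ Additive Circle, ((ψ a).toMul : ℂ) =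
      ((χ a).toMul : ℂ) * ∑ ψ : A →+ Additive Circle, ((ψ a).toMul : ℂ) := by
    rw [Finset.mul_sum, ← Equiv.sum_comp (Equiv.addLeft χ)]
    simp
  have h2 : (1 - ((χ a).toMul : ℂ)) * ∑ ψ : A →+ Additive Circle, ((ψ a).toMul : ℂ) = 0 := by
    linear_combination h
  refine (mul_eq_zero.1 h2).resolve_left fun h => hχ ?_
  rw [← toMul_eq_one, ← Circle.coe_eq_one]
  linear_combination -h

/-- Characters of `A` that restrict to all the characters of the subgroup `I`. -/
lemma exists_circleChars_sum_eq_zero [Finite A] (I : AddSubgroup A) :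
    ∃ χ : Fin (Nat.card I) → A →+ Additive Circle,
      ∀ i ∈ I, i ≠ 0 → ∑ j, ((χ j i).toMul : ℂ) = 0 := by
  have : Fintype (I →+ Additive Circle) := Fintype.ofFinite _
  choose r hr using exists_circleChar_extension I
  let e : Fin (Nat.card I) ≃ (I →+ Additive Circle) :=
    (finCongr (card_circleChar I).symm).trans (Finite.equivFin _).symm
  refine ⟨fun j => r (e j), fun i hi hne => ?_⟩
  rw [e.sum_comp fun ψ => ((r ψ i).toMul : ℂ)]
  have : (⟨i, hi⟩ : I) ≠ 0 := fun h => hne (congrArg Subtype.val h)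
  rw [← sum_circleChar_eq_zero this]
  exact Finset.sum_congr rfl fun ψ _ => by rw [← hr ψ ⟨i, hi⟩]

/-- `A / ker β` is the range of `β`, which embeds into the dual of `B / ker β.flip`, a group with as
many elements as `B / ker β.flip`. Applied to `β.flip` as well, this gives equality. -/
lemma card_quotient_ker_le [Finite A] [Finite B] (β : A →+ B →+ Additive Circle) :
    Nat.card (A ⧸ β.ker) ≤ Nat.card (B ⧸ β.flip.ker) := by
  rw [← card_circleChar (B ⧸ β.flip.ker)]
  let f : β.range → (B ⧸ β.flip.ker →+ Additive Circle) := fun ψ =>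
    QuotientAddGroup.lift _ ψ.1 fun b hb => by
      obtain ⟨a, ha⟩ := ψ.2
      rw [← ha]
      exact DFunLike.congr_fun (AddMonoidHom.mem_ker.1 hb) a
  have hf : Function.Injective f := by
    intro ψ ψ' h
    exact Subtype.ext (AddMonoidHom.ext fun b => DFunLike.congr_fun h (QuotientAddGroup.mk b))
  rw [Nat.card_congr (QuotientAddGroup.quotientKerEquivRange β).toEquiv]
  exact Nat.card_le_card_of_injective f hf

lemma card_quotient_ker_eq [Finite A] [Finite B] (β : A →+ B →+ Additive Circle) :
    Nat.card (A ⧸ β.ker) = Nat.card (B ⧸ β.flip.ker) :=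
  le_antisymm (card_quotient_ker_le β) (card_quotient_ker_le β.flip)

end FiniteDuality

/-! ### The pure stabilizer states of a Weyl system with finite quotients -/

namespace WeylSystem

variable {X T S : Type*} [NormedRing X] [NormedAlgebra ℂ X] [StarRing X] [StarModule ℂ X]
  [AddCommGroup T] [AddCommGroup S] (W : WeylSystem X T S)

/-- The pairing in additive notation, restricted to subgroups. -/
def pairHom (ZT : AddSubgroup T) (ZS : AddSubgroup S) : ZT →+ ZS →+ Additive Circle :=
  AddMonoidHom.mk' (fun t => AddMonoidHom.mk' (fun s => Additive.ofMul (W.pair s.1 t.1))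
    fun s s' => congrArg Additive.ofMul (W.pair_add_left s s' t))
    fun t t' => AddMonoidHom.ext fun s => congrArg Additive.ofMul (W.pair_add_right s.1 t.1 t'.1)

/-- The radical of the pairing of the quotients `ZT / BT` and `ZS / BS`. -/
def radical (BT ZT : AddSubgroup T) (BS ZS : AddSubgroup S) :
    Set ((ZT ⧸ BT.addSubgroupOf ZT) × (ZS ⧸ BS.addSubgroupOf ZS)) :=
  {h | ∀ (t t' : ZT) (s s' : ZS), h = (QuotientAddGroup.mk t, QuotientAddGroup.mk s) →
    W.pair s t' * W.pair s' t = 1}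

variable {BT ZT : AddSubgroup T} {BS ZS : AddSubgroup S}

/-- `k` is the order of the radical and `d` the order of `ZT / BT` modulo the kernel of the pairing.
All data of a `StabilizerCode` come from finite duality, except the states: these are `hst` for the
isotropic pair `KT`, `ZS`. -/
theorem exists_homeomorph
    (mem_ZT : ∀ t, t ∈ ZT ↔ ∀ s ∈ BS, W.pair s t = 1)
    (mem_ZS : ∀ s, s ∈ ZS ↔ ∀ t ∈ BT, W.pair s t = 1) (hBT : BT ≤ ZT)
    (hfin : Finite ((ZT ⧸ BT.addSubgroupOf ZT) × (ZS ⧸ BS.addSubgroupOf ZS)))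
    (hst : ∀ (KT : AddSubgroup T) (KS : AddSubgroup S),
      (∀ s ∈ KS, ∀ t ∈ KT, W.pair s t = 1) → ∀ (f : T → Circle) (g : S → Circle),
      (∀ t ∈ KT, ∀ t' ∈ KT, f (t + t') = f t * f t') →
      (∀ s ∈ KS, ∀ s' ∈ KS, g (s + s') = g s * g s') →
      ∃ ω ∈ stateSpace X, (∀ t ∈ KT, ω (W.P t) = f t) ∧ ∀ s ∈ KS, ω (W.Q s) = g s) :
    ∃ k d : ℕ, k = Nat.card (W.radical BT ZT BS ZS) ∧
      Nat.card ((ZT ⧸ BT.addSubgroupOf ZT) × (ZS ⧸ BS.addSubgroupOf ZS)) = k * (d * d) ∧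
      Nonempty ((W.stabilizerStates BT BS ∩ pureStates X : Set (WeakDual ℂ X)) ≃ₜ
        Fin k × ℙ ℂ (EuclideanSpace ℂ (Fin d))) := by
  have hfT : Finite (ZT ⧸ BT.addSubgroupOf ZT) :=
    Finite.of_surjective (Prod.fst : _ × (ZS ⧸ BS.addSubgroupOf ZS) → _) Prod.fst_surjective
  have hfS : Finite (ZS ⧸ BS.addSubgroupOf ZS) :=
    Finite.of_surjective (Prod.snd : (ZT ⧸ BT.addSubgroupOf ZT) × _ → _) Prod.snd_surjective
  let β₁ : (ZT ⧸ BT.addSubgroupOf ZT) →+ ZS →+ Additive Circle :=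
    QuotientAddGroup.lift _ (W.pairHom ZT ZS) fun t ht =>
      AddMonoidHom.ext fun s => congrArg Additive.ofMul
        ((mem_ZS s).1 s.2 t (AddSubgroup.mem_addSubgroupOf.1 ht))
  -- The pairing descends in each variable because `BT` annihilates `ZS` and `BS` annihilates `ZT`.
  let β : (ZT ⧸ BT.addSubgroupOf ZT) →+ (ZS ⧸ BS.addSubgroupOf ZS) →+ Additive Circle :=
    (QuotientAddGroup.lift _ β₁.flip fun s hs => by
      refine AddMonoidHom.ext fun t => ?_
      induction t using QuotientAddGroup.induction_on with | H t =>
      exact congrArg Additive.ofMul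
        ((mem_ZT t).1 t.2 s (AddSubgroup.mem_addSubgroupOf.1 hs))).flip
  have hker : ∀ t : ZT, QuotientAddGroup.mk t ∈ β.ker ↔ ∀ s ∈ ZS, W.pair s t = 1 := by
    intro t
    rw [AddMonoidHom.mem_ker]
    constructor
    · intro h s hs
      exact DFunLike.congr_fun h (QuotientAddGroup.mk (⟨s, hs⟩ : ZS))
    · intro h
      refine AddMonoidHom.ext fun s => ?_
      induction s using QuotientAddGroup.induction_on with | H s =>
      exact congrArg Additive.ofMul (h s s.2)
  have hkerf : ∀ s : ZS, QuotientAddGroup.mk s ∈ β.flip.ker ↔ ∀ t ∈ ZT, W.pair s t = 1 := by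
    intro s
    rw [AddMonoidHom.mem_ker]
    constructor
    · intro h t ht
      exact DFunLike.congr_fun h (QuotientAddGroup.mk (⟨t, ht⟩ : ZT))
    · intro h
      refine AddMonoidHom.ext fun t => ?_
      induction t using QuotientAddGroup.induction_on with | H t =>
      exact congrArg Additive.ofMul (h t t.2)
  let I : AddSubgroup ((ZT ⧸ BT.addSubgroupOf ZT) × (ZS ⧸ BS.addSubgroupOf ZS)) :=
    β.ker.prod β.flip.ker
  -- The radical splits as a product of the two kernels: putting one test element equal to zero
  -- separates the conditions.
  have hI : W.radical BT ZT BS ZS = I := by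
    ext ⟨a, b⟩
    induction a using QuotientAddGroup.induction_on with | H t =>
    induction b using QuotientAddGroup.induction_on with | H s =>
    change _ ↔ QuotientAddGroup.mk t ∈ β.ker ∧ QuotientAddGroup.mk s ∈ β.flip.ker
    rw [hker, hkerf]
    constructor
    · intro h
      refine ⟨fun s' hs' => ?_, fun t' ht' => ?_⟩
      · have := h t 0 s ⟨s', hs'⟩ rfl
        simpa [W.pair_zero_right] using this
      · have := h t ⟨t', ht'⟩ s 0 rfl
        simpa [W.pair_zero_left] using this
    · rintro ⟨h1, h2⟩ t₁ t' s₁ s' heq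
      have heq1 : (QuotientAddGroup.mk t : ZT ⧸ BT.addSubgroupOf ZT) = QuotientAddGroup.mk t₁ :=
        congrArg Prod.fst heq
      have heq2 : (QuotientAddGroup.mk s : ZS ⧸ BS.addSubgroupOf ZS) = QuotientAddGroup.mk s₁ :=
        congrArg Prod.snd heq
      have h3 := (hker t₁).1 (heq1 ▸ (hker t).2 h1) s' s'.2
      have h4 := (hkerf s₁).1 (heq2 ▸ (hkerf s).2 h2) t' t'.2
      rw [h3, h4, one_mul]
  set d := Nat.card ((ZT ⧸ BT.addSubgroupOf ZT) ⧸ β.ker) with hd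
  set k := Nat.card I with hk
  obtain ⟨χ, hχ⟩ : ∃ χ : Fin k → _ →+ Additive Circle,
      ∀ i ∈ I, i ≠ 0 → ∑ j, ((χ j i).toMul : ℂ) = 0 := exists_circleChars_sum_eq_zero I
  -- Both kernels have index `d`, which is where the square comes from.
  have hcard : Nat.card ((ZT ⧸ BT.addSubgroupOf ZT) × (ZS ⧸ BS.addSubgroupOf ZS)) =
      k * (d * d) := by
    have hkk : k = Nat.card β.ker * Nat.card β.flip.ker := by
      rw [hk, Nat.card_congr (β.ker.prodEquiv β.flip.ker).toEquiv, Nat.card_prod]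
    rw [Nat.card_prod, AddSubgroup.card_eq_card_quotient_mul_card_addSubgroup β.ker,
      AddSubgroup.card_eq_card_quotient_mul_card_addSubgroup β.flip.ker,
      ← card_quotient_ker_eq β, hkk]
    ring
  have : Fintype ((ZT ⧸ BT.addSubgroupOf ZT) × (ZS ⧸ BS.addSubgroupOf ZS)) := Fintype.ofFinite _
  let e : Fin d ≃ ((ZT ⧸ BT.addSubgroupOf ZT) ⧸ β.ker) := (Finite.equivFin _).symm
  let rep : Fin d → ZT := fun m => (e m).out.out
  have hrep : ∀ m, QuotientAddGroup.mk (QuotientAddGroup.mk (rep m)) = e m := fun m => by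
    simp [rep]
  let cT : Fin k → ZT →+ Additive Circle := fun j =>
    ((χ j).comp (AddMonoidHom.inl _ _)).comp (QuotientAddGroup.mk' (BT.addSubgroupOf ZT))
  let cS : Fin k → ZS →+ Additive Circle := fun j =>
    ((χ j).comp (AddMonoidHom.inr _ _)).comp (QuotientAddGroup.mk' (BS.addSubgroupOf ZS))
  have hcTS : ∀ j t s, cT j t + cS j s = χ j (QuotientAddGroup.mk t, QuotientAddGroup.mk s) := by
    intro j t s
    change χ j (QuotientAddGroup.mk t, 0) + χ j (0, QuotientAddGroup.mk s) = _
    rw [← map_add, Prod.mk_add_mk, add_zero, zero_add]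
  have hBS : BS ≤ ZS := fun s hs => (mem_ZS s).2 fun t ht => (mem_ZT t).1 (hBT ht) s hs
  let KT : AddSubgroup T := β.ker.comap (QuotientAddGroup.mk' (BT.addSubgroupOf ZT)) |>.map
    ZT.subtype
  let KS : AddSubgroup S := β.flip.ker.comap (QuotientAddGroup.mk' (BS.addSubgroupOf ZS)) |>.map
    ZS.subtype
  have hKT : ∀ t : ZT, (t : T) ∈ KT ↔ (QuotientAddGroup.mk t) ∈ β.ker := by
    intro t
    refine ⟨?_, fun h => ⟨t, h, rfl⟩⟩
    rintro ⟨t', h', heq⟩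
    rwa [← Subtype.ext (show (t' : T) = t from heq)]
  have hKS : ∀ s : ZS, (s : S) ∈ KS ↔ (QuotientAddGroup.mk s) ∈ β.flip.ker := by
    intro s
    refine ⟨?_, fun h => ⟨s, h, rfl⟩⟩
    rintro ⟨s', h', heq⟩
    rwa [← Subtype.ext (show (s' : S) = s from heq)]
  have memKT : ∀ t, t ∈ KT ↔ t ∈ ZT ∧ ∀ s ∈ ZS, W.pair s t = 1 := by
    intro t
    constructor
    · rintro ⟨t', h', rfl⟩
      exact ⟨t'.2, (hker t').1 h'⟩
    · rintro ⟨ht, h⟩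
      exact (hKT ⟨t, ht⟩).2 ((hker ⟨t, ht⟩).2 h)
  have memKS : ∀ s, s ∈ KS ↔ s ∈ ZS ∧ ∀ t ∈ ZT, W.pair s t = 1 := by
    intro s
    constructor
    · rintro ⟨s', h', rfl⟩
      exact ⟨s'.2, (hkerf s').1 h'⟩
    · rintro ⟨hs, h⟩
      exact (hKS ⟨s, hs⟩).2 ((hkerf ⟨s, hs⟩).2 h)
  let charT : Fin k → T → Circle := fun j t => if h : t ∈ ZT then (cT j ⟨t, h⟩).toMul else 1
  let charS : Fin k → S → Circle := fun j s => if h : s ∈ ZS then (cS j ⟨s, h⟩).toMul else 1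
  have hcharT : ∀ j (t : ZT), charT j t = (cT j t).toMul := fun j t => dif_pos t.2
  have hcharS : ∀ j (s : ZS), charS j s = (cS j s).toMul := fun j s => dif_pos s.2
  have charT_add : ∀ j, ∀ t ∈ ZT, ∀ t' ∈ ZT, charT j (t + t') = charT j t * charT j t' := by
    intro j t ht t' ht'
    have := hcharT j (⟨t, ht⟩ + ⟨t', ht'⟩)
    rw [map_add, toMul_add, ← hcharT, ← hcharT] at this
    exact this
  have charS_add : ∀ j, ∀ s ∈ ZS, ∀ s' ∈ ZS, charS j (s + s') = charS j s * charS j s' := by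
    intro j s hs s' hs'
    have := hcharS j (⟨s, hs⟩ + ⟨s', hs'⟩)
    rw [map_add, toMul_add, ← hcharS, ← hcharS] at this
    exact this
  have hmkT : ∀ t t' : ZT, (QuotientAddGroup.mk t : ZT ⧸ BT.addSubgroupOf ZT) =
      QuotientAddGroup.mk t' ↔ (t : T) - t' ∈ BT := by
    intro t t'
    rw [eq_comm, QuotientAddGroup.eq, AddSubgroup.mem_addSubgroupOf, AddSubgroup.coe_add,
      AddSubgroup.coe_neg, neg_add_eq_sub]
  have hmkS : ∀ s s' : ZS, (QuotientAddGroup.mk s : ZS ⧸ BS.addSubgroupOf ZS) =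
      QuotientAddGroup.mk s' ↔ (s : S) - s' ∈ BS := by
    intro s s'
    rw [eq_comm, QuotientAddGroup.eq, AddSubgroup.mem_addSubgroupOf, AddSubgroup.coe_add,
      AddSubgroup.coe_neg, neg_add_eq_sub]
  have hrepKT : ∀ (t t' : ZT), (t : T) - t' ∈ KT ↔
      (QuotientAddGroup.mk (QuotientAddGroup.mk t) : (ZT ⧸ BT.addSubgroupOf ZT) ⧸ β.ker) =
        QuotientAddGroup.mk (QuotientAddGroup.mk t') := by
    intro t t'
    rw [eq_comm, QuotientAddGroup.eq, ← AddSubgroup.coe_sub, hKT, neg_add_eq_sub]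
    rfl
  let C : StabilizerCode X T S k d :=
    { W with
      BT := BT
      ZT := ZT
      KT := KT
      BS := BS
      ZS := ZS
      KS := KS
      mem_ZT := mem_ZT
      mem_ZS := mem_ZS
      BT_le := hBT
      mem_KT := memKT
      mem_KS := memKS
      rep := fun m => rep m
      rep_mem := fun m => (rep m).2
      exists_rep := fun t ht => by
        refine ⟨e.symm (QuotientAddGroup.mk (QuotientAddGroup.mk ⟨t, ht⟩)), ?_⟩
        refine (hrepKT ⟨t, ht⟩ _).2 ?_
        rw [hrep, e.apply_symm_apply]
      rep_inj := fun m n h => by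
        have := (hrepKT _ _).1 h
        rwa [hrep, hrep, e.apply_eq_iff_eq] at this
      H := (ZT ⧸ BT.addSubgroupOf ZT) × (ZS ⧸ BS.addSubgroupOf ZS)
      card_H := by rw [← Nat.card_eq_fintype_card, hcard]
      repT := fun h => (h.1.out : ZT)
      repS := fun h => (h.2.out : ZS)
      repT_mem := fun h => h.1.out.2
      repS_mem := fun h => h.2.out.2
      exists_repH := fun t ht s hs => by
        refine ⟨(QuotientAddGroup.mk ⟨t, ht⟩, QuotientAddGroup.mk ⟨s, hs⟩), ?_, ?_⟩
        · exact (hmkT ⟨t, ht⟩ _).1 (by rw [QuotientAddGroup.out_eq'])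
        · exact (hmkS ⟨s, hs⟩ _).1 (by rw [QuotientAddGroup.out_eq'])
      repH_inj := fun h h' hT hS => by
        have h1 := (hmkT _ _).2 hT
        have h2 := (hmkS _ _).2 hS
        rw [QuotientAddGroup.out_eq', QuotientAddGroup.out_eq'] at h1 h2
        exact Prod.ext h1 h2
      charT := charT
      charS := charS
      charT_BT := fun j t ht => by
        rw [hcharT j ⟨t, hBT ht⟩, toMul_eq_one]
        have h0 : (QuotientAddGroup.mk (⟨t, hBT ht⟩ : ZT) : ZT ⧸ BT.addSubgroupOf ZT) = 0 :=
          (QuotientAddGroup.eq_zero_iff _).2 ht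
        change χ j (QuotientAddGroup.mk (⟨t, hBT ht⟩ : ZT), 0) = 0
        rw [h0]
        exact map_zero (χ j)
      charS_BS := fun j s hs => by
        rw [hcharS j ⟨s, hBS hs⟩, toMul_eq_one]
        have h0 : (QuotientAddGroup.mk (⟨s, hBS hs⟩ : ZS) : ZS ⧸ BS.addSubgroupOf ZS) = 0 :=
          (QuotientAddGroup.eq_zero_iff _).2 hs
        change χ j (0, QuotientAddGroup.mk (⟨s, hBS hs⟩ : ZS)) = 0
        rw [h0]
        exact map_zero (χ j)
      sum_char := fun t ht s hs hB => by
        have ht' := ((memKT t).1 ht).1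
        have hs' := ((memKS s).1 hs).1
        rw [← hχ (QuotientAddGroup.mk ⟨t, ht'⟩, QuotientAddGroup.mk ⟨s, hs'⟩)
          ⟨(hKT ⟨t, ht'⟩).1 ht, (hKS ⟨s, hs'⟩).1 hs⟩]
        · refine Finset.sum_congr rfl fun j _ => ?_
          rw [hcharT j ⟨t, ht'⟩, hcharS j ⟨s, hs'⟩, ← hcTS, toMul_add, Circle.coe_mul]
        · intro h
          have h1 : (QuotientAddGroup.mk (⟨t, ht'⟩ : ZT) : ZT ⧸ BT.addSubgroupOf ZT) = 0 :=
            congrArg Prod.fst h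
          have h2 : (QuotientAddGroup.mk (⟨s, hs'⟩ : ZS) : ZS ⧸ BS.addSubgroupOf ZS) = 0 :=
            congrArg Prod.snd h
          exact hB ⟨AddSubgroup.mem_addSubgroupOf.1 ((QuotientAddGroup.eq_zero_iff _).1 h1),
            AddSubgroup.mem_addSubgroupOf.1 ((QuotientAddGroup.eq_zero_iff _).1 h2)⟩
      exists_state := fun j => hst KT ZS (fun s hs t ht => ((memKT t).1 ht).2 s hs)
        (charT j) (charS j)
        (fun t ht t' ht' => charT_add j t ((memKT t).1 ht).1 t' ((memKT t').1 ht').1)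
        (charS_add j) }
  refine ⟨k, d, ?_, hcard, C.nonempty_homeomorph⟩
  rw [hI]
  rfl

end WeylSystem

namespace HAQDM

variable {V : Type u} [LinearOrder V] {D : HAQDM.{u, w} V}

/-! ### The evaluation pairing -/

namespace Gdual

variable {i j : ℤ}

lemma val_add (χ : D.Gdual j) (g g' : D.G j) : χ.val (g + g') = χ.val g * χ.val g' :=
  congrArg Additive.toMul (map_add (show D.G j →+ Additive Circle from χ) g g')

@[simp] lemma val_zero (χ : D.Gdual j) : χ.val 0 = 1 :=
  congrArg Additive.toMul (map_zero (show D.G j →+ Additive Circle from χ))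

lemma val_sub (χ : D.Gdual j) (g g' : D.G j) : χ.val (g - g') = χ.val g / χ.val g' :=
  congrArg Additive.toMul (map_sub (show D.G j →+ Additive Circle from χ) g g')

lemma val_zsmul (χ : D.Gdual j) (n : ℤ) (g : D.G j) : χ.val (n • g) = χ.val g ^ n :=
  congrArg Additive.toMul (map_zsmul (show D.G j →+ Additive Circle from χ) n g)

lemma sub_val (χ χ' : D.Gdual j) (g : D.G j) : (χ - χ').val g = χ.val g / χ'.val g := rfl

lemma zsmul_val (n : ℤ) (χ : D.Gdual j) (g : D.G j) : (n • χ).val g = χ.val g ^ n := rfl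

lemma ext_val {χ χ' : D.Gdual j} (h : ∀ g, χ.val g = χ'.val g) : χ = χ' :=
  AddMonoidHom.ext fun g => congrArg Additive.ofMul (h g)

lemma exists_val_ne_one {g : D.G j} (hg : g ≠ 0) : ∃ χ : D.Gdual j, χ.val g ≠ 1 :=
  exists_circleChar_ne_zero hg

instance : Finite (D.Gdual j) := inferInstanceAs (Finite (D.G j →+ Additive Circle))

end Gdual

lemma eval_eq_prod {p : ℤ} (γ : D.DualHom0 p) (t : D.Hom0 p) {s : Finset D.Simplex}
    (hs : ∀ x, x ∉ s → γ x = 0 ∨ t x = 0) : eval γ t = ∏ x ∈ s, (γ x).val (t x) := by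
  refine finprod_eq_prod_of_mulSupport_subset _ fun x hx => ?_
  by_contra h
  rcases hs x h with h | h <;> simp [h] at hx

lemma eval_add_left {p : ℤ} (γ γ' : D.DualHom0 p) (t : D.Hom0 p) :
    eval (γ + γ') t = eval γ t * eval γ' t := by
  have h : ∀ x, x ∉ t.support → t x = 0 := fun x hx => by simpa using hx
  rw [eval_eq_prod _ t fun x hx => Or.inr (h x hx), eval_eq_prod _ t fun x hx => Or.inr (h x hx),
    eval_eq_prod _ t fun x hx => Or.inr (h x hx), ← Finset.prod_mul_distrib]
  rfl

lemma eval_add_right {p : ℤ} (γ : D.DualHom0 p) (t t' : D.Hom0 p) :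
    eval γ (t + t') = eval γ t * eval γ t' := by
  have h : ∀ x, x ∉ γ.support → γ x = 0 := fun x hx => by simpa using hx
  rw [eval_eq_prod γ _ fun x hx => Or.inl (h x hx), eval_eq_prod γ _ fun x hx => Or.inl (h x hx),
    eval_eq_prod γ _ fun x hx => Or.inl (h x hx), ← Finset.prod_mul_distrib]
  exact Finset.prod_congr rfl fun x _ => Gdual.val_add _ _ _

lemma eval_single_left {p : ℤ} (x : D.Simplex) (α : D.Gdual (deg p x)) (t : D.Hom0 p) :
    eval (DFinsupp.single x α) t = α.val (t x) := by
  rw [eval_eq_prod (s := {x})]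
  · simp
  · intro y hy
    left
    exact DFinsupp.single_eq_of_ne (by simpa using hy)

lemma eval_single_right {p : ℤ} (γ : D.DualHom0 p) (x : D.Simplex) (g : D.G (deg p x)) :
    eval γ (DFinsupp.single x g) = (γ x).val g := by
  rw [eval_eq_prod (s := {x})]
  · simp
  · intro y hy
    right
    exact DFinsupp.single_eq_of_ne (by simpa using hy)

/-- The evaluation pairing in additive notation. -/
def evalHom (p : ℤ) : D.DualHom0 p →+ D.Hom0 p →+ Additive Circle :=
  AddMonoidHom.mk' (fun γ => AddMonoidHom.mk' (fun t => Additive.ofMul (eval γ t))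
    fun t t' => congrArg Additive.ofMul (eval_add_right γ t t'))
    fun γ γ' => AddMonoidHom.ext fun t => congrArg Additive.ofMul (eval_add_left γ γ' t)

lemma coboundary_single (p q : ℤ) (y : D.Simplex) (g : D.G (deg p y)) (x : D.Simplex) :
    coboundary p q (DFinsupp.single y g) x =
      incidence x y • D.transport (deg p y) (deg q x) g -
        (p.negOnePow : ℤ) • D.bdry (deg p x) (deg q x)
          ((DFinsupp.single y g : D.Hom0 p) x) := by
  change ofFinite _ _ x = _
  rw [ofFinite_apply, coboundaryFun, finsum_eq_single _ y, DFinsupp.single_eq_same]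
  intro z hz
  rw [DFinsupp.single_eq_of_ne hz, map_zero, smul_zero]

lemma boundary_single (p q : ℤ) (x : D.Simplex) (α : D.Gdual (deg p x)) (y : D.Simplex) :
    boundary p q (DFinsupp.single x α) y =
      incidence x y • Gdual.pull (D.transport (deg q y) (deg p x)) α -
        (q.negOnePow : ℤ) • Gdual.pull (D.bdry (deg q y) (deg p y))
          ((DFinsupp.single x α : D.DualHom0 p) y) := by
  change ofFinite _ _ y = _
  rw [ofFinite_apply, boundaryFun, finsum_eq_single _ x, DFinsupp.single_eq_same]
  intro z hz
  rw [DFinsupp.single_eq_of_ne hz, map_zero, smul_zero]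

/-- The boundary is the transpose of the coboundary. -/
lemma eval_coboundary (p q : ℤ) (γ : D.DualHom0 q) (t : D.Hom0 p) :
    eval γ (coboundary p q t) = eval (boundary q p γ) t := by
  have key : (AddMonoidHom.compHom' (coboundary p q)).comp (evalHom (D := D) q) =
      (evalHom p).comp (boundary q p) := by
    -- Both sides are biadditive, so single-site elements suffice; there the incidence terms agree,
    -- and the terms with `∂` occur only for `x = y`.
    refine DFinsupp.addHom_ext fun x α => DFinsupp.addHom_ext fun y g => ?_
    change Additive.ofMul (eval (DFinsupp.single x α) (coboundary p q (DFinsupp.single y g))) =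
      Additive.ofMul (eval (boundary q p (DFinsupp.single x α)) (DFinsupp.single y g))
    rw [eval_single_left, eval_single_right, coboundary_single, boundary_single,
      Gdual.val_sub, Gdual.val_zsmul, Gdual.val_zsmul, Gdual.sub_val, Gdual.zsmul_val,
      Gdual.zsmul_val, Gdual.pull_val, Gdual.pull_val]
    by_cases h : x = y
    · subst h
      rw [DFinsupp.single_eq_same, DFinsupp.single_eq_same]
    · rw [DFinsupp.single_eq_of_ne h, DFinsupp.single_eq_of_ne (Ne.symm h)]
      simp
  exact congrArg Additive.toMul (DFunLike.congr_fun (DFunLike.congr_fun key γ) t)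

/-! ### The coboundary is a differential -/

lemma card_of_incidence_ne_zero {x y : D.Simplex} (h : incidence x y ≠ 0) :
    x.1.card = y.1.card + 1 := by
  obtain ⟨v, hv, h⟩ := Finset.exists_ne_zero_of_sum_ne_zero h
  have h' : x.1.erase v = y.1 := by
    by_contra h'
    exact h (if_neg h')
  rw [← h', Finset.card_erase_add_one hv]

lemma card_filter_lt_erase {s : Finset V} {v w : V} (hv : v ∈ s) (hvw : v < w) :
    (s.filter (· < w)).card = ((s.erase v).filter (· < w)).card + 1 := by
  rw [Finset.filter_erase, Finset.card_erase_add_one]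
  simp [hv, hvw]

lemma filter_lt_erase {s : Finset V} {v w : V} (hvw : v < w) :
    (s.erase w).filter (· < v) = s.filter (· < v) := by
  rw [Finset.filter_erase, Finset.erase_eq_of_notMem]
  simp [hvw.le]

/-- The position sign of the vertex `v` in `s`. -/
def posSign (s : Finset V) (v : V) : ℤ := (-1) ^ (s.filter (· < v)).card

/-- Removing the smaller vertex `v` lowers the position of `w` by one, while removing `w` does not
move `v`. -/
lemma posSign_erase_aux {s : Finset V} {v w : V} (hv : v ∈ s) (h : v < w) :
    posSign s v * posSign (s.erase v) w = -(posSign s w * posSign (s.erase w) v) := by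
  rw [posSign, posSign, posSign, posSign, card_filter_lt_erase hv h, filter_lt_erase h, pow_succ]
  ring

lemma posSign_erase {s : Finset V} {v w : V} (hv : v ∈ s) (hw : w ∈ s) (h : v ≠ w) :
    posSign s v * posSign (s.erase v) w = -(posSign s w * posSign (s.erase w) v) := by
  rcases h.lt_or_gt with h | h
  · exact posSign_erase_aux hv h
  · rw [posSign_erase_aux hw h, neg_neg]

lemma incidence_eq (x y : D.Simplex) : incidence x y =
    ∑ v ∈ x.1, if x.1.erase v = y.1 then (D.ori x : ℤ) * (D.ori y : ℤ) * posSign x.1 v else 0 :=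
  rfl

/-- The sum runs over ordered pairs of distinct vertices to be removed from `x` and is antisymmetric
in the pair; the orientation sign of the intermediate simplex occurs squared. -/
lemma sum_incidence_mul_incidence (x y : D.Simplex) :
    ∑ᶠ z : D.Simplex, incidence x z * incidence z y = 0 := by
  have hstep : ∀ z : D.Simplex, incidence x z * incidence z y =
      ∑ v ∈ x.1, ∑ w ∈ x.1.erase v, if x.1.erase v = z.1 ∧ (x.1.erase v).erase w = y.1 then
        (D.ori x : ℤ) * (D.ori y : ℤ) * (posSign x.1 v * posSign (x.1.erase v) w) else 0 := by
    intro z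
    rw [incidence_eq, Finset.sum_mul]
    refine Finset.sum_congr rfl fun v _ => ?_
    by_cases hz : x.1.erase v = z.1
    · rw [if_pos hz, incidence_eq, Finset.mul_sum, hz]
      refine Finset.sum_congr rfl fun w _ => ?_
      by_cases hw : z.1.erase w = y.1
      · have ho : (D.ori z : ℤ) * (D.ori z : ℤ) = 1 := by
          rw [← Units.val_mul, Int.units_mul_self, Units.val_one]
        rw [if_pos hw, if_pos ⟨rfl, hw⟩]
        linear_combination (D.ori x : ℤ) * (D.ori y : ℤ) * posSign x.1 v * posSign z.1 w * ho
      · rw [if_neg hw, if_neg (fun h => hw h.2), mul_zero]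
    · simp [hz]
  let c : V → V → ℤ := fun v w => if (x.1.erase v).erase w = y.1 then
    (D.ori x : ℤ) * (D.ori y : ℤ) * (posSign x.1 v * posSign (x.1.erase v) w) else 0
  have hsum : ∑ᶠ z : D.Simplex, incidence x z * incidence z y =
      ∑ v ∈ x.1, ∑ w ∈ x.1.erase v, c v w := by
    rw [finsum_eq_sum_of_support_subset (s := (finite_faces x).toFinset) _ (by
      intro z hz
      simp only [Set.Finite.coe_toFinset, Set.mem_ofPred_eq]
      exact left_ne_zero_of_mul hz)]
    simp only [hstep]
    rw [Finset.sum_comm]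
    refine Finset.sum_congr rfl fun v hv => ?_
    rw [Finset.sum_comm]
    refine Finset.sum_congr rfl fun w hw => ?_
    -- The intermediate set is a simplex because it still contains `w` and so is nonempty.
    have hf : x.1.erase v ∈ D.cx.faces :=
      (D.cx.isRelLowerSet_faces x.2).2 (Finset.erase_subset _ _) ⟨w, hw⟩
    rw [Finset.sum_eq_single (⟨x.1.erase v, hf⟩ : D.Simplex)]
    · simp [c]
    · intro z _ hz
      rw [if_neg]
      rintro ⟨h, -⟩
      exact hz (Subtype.ext h.symm)
    · intro hz
      rw [Set.Finite.mem_toFinset, Set.mem_ofPred_eq, not_not] at hz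
      exfalso
      rw [incidence_eq, Finset.sum_eq_single v] at hz
      · simp [posSign] at hz
      · intro v' hv' hne
        rw [if_neg]
        intro h
        have : v ∈ x.1.erase v' := Finset.mem_erase.2 ⟨hne.symm, hv⟩
        rw [h] at this
        simp at this
      · exact fun h => absurd hv h
  have hc : ∀ v ∈ x.1, ∀ w ∈ x.1, v ≠ w → c v w = -c w v := by
    intro v hv w hw hne
    simp only [c, Finset.erase_right_comm (a := w)]
    split_ifs
    · rw [posSign_erase hv hw hne, mul_neg]
    · simp
  have hswap : ∑ v ∈ x.1, ∑ w ∈ x.1.erase v, c v w = ∑ v ∈ x.1, ∑ w ∈ x.1.erase v, c w v := by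
    refine Finset.sum_comm' fun v w => ?_
    simp only [Finset.mem_erase]
    tauto
  have hneg : ∑ v ∈ x.1, ∑ w ∈ x.1.erase v, c w v = -∑ v ∈ x.1, ∑ w ∈ x.1.erase v, c v w := by
    rw [← Finset.sum_neg_distrib]
    refine Finset.sum_congr rfl fun v hv => ?_
    rw [← Finset.sum_neg_distrib]
    refine Finset.sum_congr rfl fun w hw => ?_
    exact hc w (Finset.mem_of_mem_erase hw) v hv (Finset.ne_of_mem_erase hw)
  rw [hsum]
  linarith [hswap.trans hneg]

lemma transport_self (i : ℤ) (g : D.G i) : D.transport i i g = g := by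
  simp [transport, HomologicalComplex.XIsoOfEq]

lemma transport_transport {i j k : ℤ} (hij : i = j) (hjk : j = k) (g : D.G i) :
    D.transport j k (D.transport i j g) = D.transport i k g := by
  subst hij hjk
  rw [transport_self]

lemma transport_bdry {i i' j j' : ℤ} (h : i = j) (h' : i' = j') (g : D.G i) :
    D.transport i' j' (D.bdry i i' g) = D.bdry j j' (D.transport i j g) := by
  subst h h'
  rw [transport_self, transport_self]

lemma bdry_bdry (i j k : ℤ) (g : D.G i) : D.bdry j k (D.bdry i j g) = 0 := by
  have h := D.grp.d_comp_d i j k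
  exact congrArg (fun f => f.hom g) h

/-- On a single-site element, the double incidence sum and `∂∂` vanish separately, and the two mixed
terms cancel because the sign `(-1)^p` changes with the degree. -/
lemma coboundary_coboundary {p q r : ℤ} (hq : q = p + 1) (hr : r = q + 1) (t : D.Hom0 p) :
    coboundary q r (coboundary p q t) = 0 := by
  have key : (coboundary q r).comp (coboundary (D := D) p q) = 0 := by
    refine DFinsupp.addHom_ext fun y g => DFinsupp.ext fun x => ?_
    change ofFinite _ _ x = 0
    rw [ofFinite_apply, coboundaryFun, coboundary_single]
    have hdeg : ∀ x y : D.Simplex, incidence x y ≠ 0 → ∀ p q : ℤ, q = p + 1 →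
        deg p y = deg q x := by
      intro x y h p q hpq
      have := card_of_incidence_ne_zero h
      simp only [deg, hpq, this]
      push_cast
      ring
    -- Transports compose only between equal degrees; a nonzero incidence number guarantees the
    -- equality, and otherwise both terms are zero.
    have hterm : ∀ z : D.Simplex, incidence x z • D.transport (deg q z) (deg r x)
        (coboundary p q (DFinsupp.single y g) z) =
        (incidence x z * incidence z y) • D.transport (deg p y) (deg r x) g -
          (p.negOnePow : ℤ) • incidence x z • D.transport (deg q z) (deg r x)
            (D.bdry (deg p z) (deg q z) ((DFinsupp.single y g : D.Hom0 p) z)) := by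
      intro z
      rw [coboundary_single, map_sub, map_zsmul, map_zsmul, smul_sub, smul_smul,
        smul_comm (incidence x z) (p.negOnePow : ℤ)]
      congr 1
      by_cases h1 : incidence x z = 0
      · simp [h1]
      by_cases h2 : incidence z y = 0
      · simp [h2]
      rw [transport_transport (hdeg z y h2 p q hq) (hdeg x z h1 q r hr)]
    have hfin₁ : (Function.support fun z : D.Simplex =>
        (incidence x z * incidence z y) • D.transport (deg p y) (deg r x) g).Finite :=
      (finite_faces x).subset fun z hz h => hz (by simp [h])
    have hfin₂ : (Function.support fun z : D.Simplex =>
        (p.negOnePow : ℤ) • incidence x z • D.transport (deg q z) (deg r x)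
            (D.bdry (deg p z) (deg q z) ((DFinsupp.single y g : D.Hom0 p) z))).Finite :=
      (finite_faces x).subset fun z hz h => hz (by simp [h])
    have hfin₃ : (Function.support fun z : D.Simplex => incidence x z * incidence z y).Finite :=
      (finite_faces x).subset fun z hz h => hz (by simp [h])
    rw [finsum_congr hterm, finsum_sub_distrib hfin₁ hfin₂, ← finsum_smul' hfin₃,
      sum_incidence_mul_incidence, zero_smul, finsum_eq_single _ y, DFinsupp.single_eq_same,
      map_sub, map_zsmul, map_zsmul, bdry_bdry, smul_zero, sub_zero, hq, Int.negOnePow_succ]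
    · by_cases h : incidence x y = 0
      · simp [h]
      · rw [transport_bdry (hdeg x y h p (p + 1) rfl) (hdeg x y h (p + 1) r (by rw [hr, hq]))]
        simp
    · intro z hz
      rw [DFinsupp.single_eq_of_ne hz]
      simp
  exact DFunLike.congr_fun key t

end HAQDM

namespace HAQDM

variable {V : Type u} [LinearOrder V] {D : HAQDM.{u, w} V}

/-! ### The Weyl operators -/

lemma hilb_clm_ext {A B : D.Hilb →L[ℂ] D.Hilb}
    (h : ∀ (f : D.Hilb) (s : D.Hom0 0), (A f : D.Hom0 0 → ℂ) s = (B f : D.Hom0 0 → ℂ) s) :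
    A = B :=
  ContinuousLinearMap.ext fun f => lp.ext (funext fun s => h f s)

lemma star_monomialOp (e : Equiv.Perm (D.Hom0 0)) (u : D.Hom0 0 → Circle) :
    star (monomialOp e u) = monomialOp e.symm fun s => (u (e.symm s))⁻¹ := by
  rw [ContinuousLinearMap.star_eq_adjoint]
  symm
  rw [ContinuousLinearMap.eq_adjoint_iff]
  intro f g
  rw [lp.inner_eq_tsum, lp.inner_eq_tsum, ← e.tsum_eq]
  refine tsum_congr fun s => ?_
  simp only [monomialOp_apply, Equiv.symm_apply_apply, RCLike.inner_apply, map_mul,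
    Circle.coe_inv_eq_conj, Complex.conj_conj]
  ring

lemma eval_zero_left {p : ℤ} (t : D.Hom0 p) : eval (0 : D.DualHom0 p) t = 1 := by
  simpa using eval_add_left (0 : D.DualHom0 p) 0 t

lemma eval_zero_right {p : ℤ} (γ : D.DualHom0 p) : eval γ (0 : D.Hom0 p) = 1 := by
  simpa using eval_add_right γ (0 : D.Hom0 p) 0

lemma eval_neg_left {p : ℤ} (γ : D.DualHom0 p) (t : D.Hom0 p) :
    eval (-γ) t = (eval γ t)⁻¹ := by
  rw [eq_inv_iff_mul_eq_one, ← eval_add_left, neg_add_cancel, eval_zero_left]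

lemma shift_coe (t : D.Hom0 0) :
    (shift t : D.Hilb →L[ℂ] D.Hilb) = monomialOp (Equiv.subRight t) fun _ => 1 := rfl

lemma shift_apply (t : D.Hom0 0) (f : D.Hilb) (s : D.Hom0 0) :
    ((shift t : D.Hilb →L[ℂ] D.Hilb) f : D.Hom0 0 → ℂ) s = f (s - t) := by
  rw [shift_coe, monomialOp_apply]
  simp

lemma clock_apply (γ : D.DualHom0 0) (f : D.Hilb) (s : D.Hom0 0) :
    ((clock γ : D.Hilb →L[ℂ] D.Hilb) f : D.Hom0 0 → ℂ) s = eval γ s * f s := rfl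

lemma shift_zero : shift (0 : D.Hom0 0) = 1 :=
  Subtype.ext <| hilb_clm_ext fun f s => by rw [shift_apply, sub_zero]; rfl

lemma clock_zero : clock (0 : D.DualHom0 0) = 1 :=
  Subtype.ext <| hilb_clm_ext fun f s => by
    rw [clock_apply, eval_zero_left, Circle.coe_one, one_mul]; rfl

lemma shift_add (t t' : D.Hom0 0) : shift (t + t') = shift t * shift t' :=
  Subtype.ext <| hilb_clm_ext fun f s => by
    change _ = ((shift t : D.Hilb →L[ℂ] D.Hilb) ((shift t' : D.Hilb →L[ℂ] D.Hilb) f) :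
      D.Hom0 0 → ℂ) s
    rw [shift_apply, shift_apply, shift_apply, sub_sub]

lemma clock_add (γ γ' : D.DualHom0 0) : clock (γ + γ') = clock γ * clock γ' :=
  Subtype.ext <| hilb_clm_ext fun f s => by
    change _ = ((clock γ : D.Hilb →L[ℂ] D.Hilb) ((clock γ' : D.Hilb →L[ℂ] D.Hilb) f) :
      D.Hom0 0 → ℂ) s
    rw [clock_apply, clock_apply, clock_apply, eval_add_left, Circle.coe_mul, mul_assoc]

lemma star_shift (t : D.Hom0 0) : star (shift t) = shift (-t) :=
  Subtype.ext <| (star_monomialOp _ _).trans <| hilb_clm_ext fun f s => by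
    rw [shift_apply, monomialOp_apply]
    simp [sub_neg_eq_add]

lemma star_clock (γ : D.DualHom0 0) : star (clock γ) = clock (-γ) :=
  Subtype.ext <| (star_monomialOp _ _).trans <| hilb_clm_ext fun f s => by
    rw [clock_apply, monomialOp_apply, eval_neg_left]
    rfl

lemma clock_mul_shift (γ : D.DualHom0 0) (t : D.Hom0 0) :
    clock γ * shift t = (eval γ t : ℂ) • (shift t * clock γ) :=
  Subtype.ext <| hilb_clm_ext fun f s => by
    change ((clock γ : D.Hilb →L[ℂ] D.Hilb) ((shift t : D.Hilb →L[ℂ] D.Hilb) f) :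
      D.Hom0 0 → ℂ) s = (eval γ t : ℂ) * ((shift t : D.Hilb →L[ℂ] D.Hilb)
        ((clock γ : D.Hilb →L[ℂ] D.Hilb) f) : D.Hom0 0 → ℂ) s
    rw [clock_apply, shift_apply, shift_apply, clock_apply, ← mul_assoc, ← Circle.coe_mul,
      ← eval_add_right, add_sub_cancel]

/-! ### The Weyl operators span a dense subspace -/

variable (D) in
/-- The span of the Weyl operators. -/
def weylSpan : Submodule ℂ (D.Hilb →L[ℂ] D.Hilb) :=
  Submodule.span ℂ (Set.range fun a : D.Hom0 0 × D.DualHom0 0 =>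
    ((shift a.1 * clock a.2 : D.quasiLocal) : D.Hilb →L[ℂ] D.Hilb))

lemma mem_weylSpan (t : D.Hom0 0) (γ : D.DualHom0 0) :
    ((shift t * clock γ : D.quasiLocal) : D.Hilb →L[ℂ] D.Hilb) ∈ D.weylSpan :=
  Submodule.subset_span ⟨(t, γ), rfl⟩

lemma clock_mul_shift_mem_weylSpan (t : D.Hom0 0) (γ : D.DualHom0 0) :
    ((clock γ * shift t : D.quasiLocal) : D.Hilb →L[ℂ] D.Hilb) ∈ D.weylSpan := by
  rw [clock_mul_shift]
  exact D.weylSpan.smul_mem _ (mem_weylSpan t γ)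

lemma one_mem_weylSpan : (1 : D.Hilb →L[ℂ] D.Hilb) ∈ D.weylSpan := by
  have := mem_weylSpan (D := D) 0 0
  rwa [shift_zero, clock_zero, one_mul] at this

lemma mul_mem_weylSpan {A B : D.Hilb →L[ℂ] D.Hilb} (hA : A ∈ D.weylSpan)
    (hB : B ∈ D.weylSpan) : A * B ∈ D.weylSpan := by
  have h := Submodule.mul_mem_mul hA hB
  rw [weylSpan, Submodule.span_mul_span] at h
  refine Submodule.span_le.2 ?_ h
  rintro _ ⟨_, ⟨⟨t, γ⟩, rfl⟩, _, ⟨⟨t', γ'⟩, rfl⟩, rfl⟩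
  change ((shift t * clock γ * (shift t' * clock γ') : D.quasiLocal) :
    D.Hilb →L[ℂ] D.Hilb) ∈ D.weylSpan
  rw [mul_assoc, ← mul_assoc (clock γ), clock_mul_shift, smul_mul_assoc, mul_smul_comm,
    mul_assoc (shift t'), ← clock_add, ← mul_assoc, ← shift_add]
  exact D.weylSpan.smul_mem _ (mem_weylSpan _ _)

lemma star_mem_weylSpan {A : D.Hilb →L[ℂ] D.Hilb} (hA : A ∈ D.weylSpan) :
    star A ∈ D.weylSpan := by
  induction hA using Submodule.span_induction with
  | mem A h =>
    obtain ⟨⟨t, γ⟩, rfl⟩ := h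
    change ((star (shift t * clock γ) : D.quasiLocal) : D.Hilb →L[ℂ] D.Hilb) ∈ D.weylSpan
    rw [star_mul, star_shift, star_clock]
    exact clock_mul_shift_mem_weylSpan _ _
  | zero => simp
  | add A B _ _ hA hB => simpa using D.weylSpan.add_mem hA hB
  | smul c A _ hA => simpa using D.weylSpan.smul_mem _ hA

variable (D) in
/-- The span of the Weyl operators as a star subalgebra. -/
def weylAlgebra : StarSubalgebra ℂ (D.Hilb →L[ℂ] D.Hilb) :=
  { D.weylSpan.toSubalgebra one_mem_weylSpan fun _ _ => mul_mem_weylSpan with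
    star_mem' := star_mem_weylSpan }

/-- A matrix coefficient of operators. -/
def coeffAt (f : D.Hilb) (s : D.Hom0 0) : (D.Hilb →L[ℂ] D.Hilb) →ₗ[ℂ] ℂ where
  toFun A := (A f : D.Hom0 0 → ℂ) s
  map_add' _ _ := rfl
  map_smul' _ _ := rfl

lemma coeffAt_apply (f : D.Hilb) (s : D.Hom0 0) (A : D.Hilb →L[ℂ] D.Hilb) :
    coeffAt f s A = (A f : D.Hom0 0 → ℂ) s := rfl

lemma sum_gdual_val {j : ℤ} [Fintype (D.Gdual j)] (g : D.G j) :
    ∑ χ : D.Gdual j, (χ.val g : ℂ) = if g = 0 then (Fintype.card (D.Gdual j) : ℂ) else 0 := by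
  split_ifs with h
  · simp [h]
  · exact @sum_circleChar_eq_zero _ _ ‹Fintype (D.Gdual j)› _ g h

/-- The matrix unit from `u` to `v` is the shift by `v - u` followed by the projection onto
configurations with restriction `v`, and this projection is a combination of clocks by Fourier
inversion on the finite group of configurations on `Λ`. -/
lemma localAlgebra_le_weylSpan (Λ : Finset D.Simplex) :
    D.localAlgebra Λ ⊆ (D.weylSpan : Set (D.Hilb →L[ℂ] D.Hilb)) := by
  rintro A ⟨a, ha⟩
  have : ∀ j : ℤ, Fintype (D.Gdual j) := fun j => Fintype.ofFinite _
  let Γ := ∀ x : (Λ : Set D.Simplex), D.Gdual (deg 0 x.1)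
  let ext : Γ → D.DualHom0 0 := fun γ => DFinsupp.mk Λ γ
  let n : ℂ := (Fintype.card Γ : ℂ)
  have hn : n ≠ 0 := Nat.cast_ne_zero.2 Fintype.card_ne_zero
  have heval : ∀ (γ : Γ) (s : D.Hom0 0),
      eval (ext γ) s = ∏ x : (Λ : Set D.Simplex), (γ x).val (s x.1) := by
    intro γ s
    rw [eval_eq_prod (s := Λ)]
    · rw [← Finset.prod_coe_sort]
      refine Finset.prod_congr rfl fun x _ => ?_
      simp only [ext]
      rw [DFinsupp.mk_of_mem x.2]
      rfl
    · intro x hx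
      left
      exact DFinsupp.mk_of_notMem hx
  -- Character orthogonality, factorized over the sites of `Λ`.
  have horth : ∀ (s : D.Hom0 0) (v : D.LocConf Λ), ∑ γ : Γ,
      ((∏ x, (γ x).val (v x) : Circle) : ℂ)⁻¹ * (eval (ext γ) s : ℂ) =
        if restr Λ s = v then n else 0 := by
    intro s v
    have h1 : ∀ γ : Γ, ((∏ x, (γ x).val (v x) : Circle) : ℂ)⁻¹ * (eval (ext γ) s : ℂ) =
        ∏ x, ((γ x).val (s x.1 - v x) : ℂ) := by
      intro γ
      rw [heval, ← Circle.coe_inv, ← Circle.coe_mul, ← Finset.prod_inv_distrib,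
        ← Finset.prod_mul_distrib]
      refine (map_prod Circle.coeHom _ _).trans (Finset.prod_congr rfl fun x _ => ?_)
      rw [Gdual.val_sub, div_eq_inv_mul]
      rfl
    rw [Finset.sum_congr rfl fun γ _ => h1 γ, ← Fintype.prod_sum
      fun (x : (Λ : Set D.Simplex)) (χ : D.Gdual (deg 0 x.1)) => (χ.val (s x.1 - v x) : ℂ)]
    simp only [sum_gdual_val, sub_eq_zero]
    split_ifs with h
    · subst h
      simp [restr, n, Γ]
    · obtain ⟨x, hx⟩ := Function.ne_iff.1 h
      exact Finset.prod_eq_zero (Finset.mem_univ x) (if_neg hx)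
  have key : A = ∑ u : D.LocConf Λ, ∑ v : D.LocConf Λ, ∑ γ : Γ,
      (a v u * n⁻¹ * ((∏ x, (γ x).val (v x) : Circle) : ℂ)⁻¹) •
        ((clock (ext γ) * shift (DFinsupp.mk Λ (v - u)) : D.quasiLocal) :
          D.Hilb →L[ℂ] D.Hilb) := by
    refine hilb_clm_ext fun f s => ?_
    rw [ha, ← coeffAt_apply]
    simp only [map_sum, map_smul, smul_eq_mul]
    refine Finset.sum_congr rfl fun u _ => ?_
    have h2 : ∀ (v : D.LocConf Λ) (γ : Γ), coeffAt f s
        ((clock (ext γ) * shift (DFinsupp.mk Λ (v - u)) : D.quasiLocal) :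
          D.Hilb →L[ℂ] D.Hilb) = eval (ext γ) s * f (s - DFinsupp.mk Λ (v - u)) := by
      intro v γ
      rw [← shift_apply, ← clock_apply]
      rfl
    have h3 : ∀ v : D.LocConf Λ, ∑ γ : Γ,
        a v u * n⁻¹ * ((∏ x, (γ x).val (v x) : Circle) : ℂ)⁻¹ * coeffAt f s
          ((clock (ext γ) * shift (DFinsupp.mk Λ (v - u)) : D.quasiLocal) :
            D.Hilb →L[ℂ] D.Hilb) =
        if restr Λ s = v then a v u * f (s - DFinsupp.mk Λ (v - u)) else 0 := by
      intro v
      have h4 : ∀ γ : Γ, a v u * n⁻¹ * ((∏ x, (γ x).val (v x) : Circle) : ℂ)⁻¹ * coeffAt f s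
          ((clock (ext γ) * shift (DFinsupp.mk Λ (v - u)) : D.quasiLocal) :
            D.Hilb →L[ℂ] D.Hilb) =
          a v u * n⁻¹ * f (s - DFinsupp.mk Λ (v - u)) *
            (((∏ x, (γ x).val (v x) : Circle) : ℂ)⁻¹ * (eval (ext γ) s : ℂ)) := by
        intro γ
        rw [h2]
        ring
      rw [Finset.sum_congr rfl fun γ _ => h4 γ, ← Finset.mul_sum, horth]
      split_ifs
      · field_simp
      · simp
    rw [Finset.sum_congr rfl fun v _ => h3 v, Finset.sum_ite_eq, if_pos (Finset.mem_univ _)]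
    -- The only surviving `v` is the restriction of `s`; shifting back then replaces that
    -- restriction by `u`.
    have hg : s - DFinsupp.mk Λ (restr Λ s - u) = glue Λ u s := by
      ext x
      by_cases hx : x ∈ Λ
      · simp [glue_apply, hx, restr]
      · simp [glue_apply, hx]
    rw [hg]
  rw [key]
  exact Submodule.sum_mem _ fun u _ => Submodule.sum_mem _ fun v _ => Submodule.sum_mem _
    fun γ _ => Submodule.smul_mem _ _ (clock_mul_shift_mem_weylSpan _ _)

lemma quasiLocal_le_closure :
    (D.quasiLocal : Set (D.Hilb →L[ℂ] D.Hilb)) ⊆ closure D.weylSpan := by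
  have h : StarAlgebra.adjoin ℂ (⋃ Λ : Finset D.Simplex, D.localAlgebra Λ) ≤ D.weylAlgebra :=
    StarAlgebra.adjoin_le (Set.iUnion_subset fun Λ => localAlgebra_le_weylSpan Λ)
  exact closure_mono h

lemma weakDual_ext (ω ω' : WeakDual ℂ D.quasiLocal)
    (h : ∀ t γ, ω (shift t * clock γ) = ω' (shift t * clock γ)) : ω = ω' := by
  let E : Submodule ℂ D.quasiLocal := LinearMap.ker ((ω - ω' : WeakDual ℂ D.quasiLocal) :
    D.quasiLocal →L[ℂ] ℂ).toLinearMap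
  have hE : ∀ x, x ∈ E ↔ ω x = ω' x := fun x => by
    rw [← sub_eq_zero]
    rfl
  have hclosed : IsClosed (E : Set D.quasiLocal) := by
    have : (E : Set D.quasiLocal) = {x | ω x = ω' x} := Set.ext hE
    rw [this]
    exact isClosed_eq ω.cont ω'.cont
  let val : D.quasiLocal →ₗ[ℂ] (D.Hilb →L[ℂ] D.Hilb) :=
    { toFun := Subtype.val
      map_add' := fun _ _ => rfl
      map_smul' := fun _ _ => rfl }
  have hle : D.weylSpan ≤ E.map val := by
    refine Submodule.span_le.2 ?_
    rintro _ ⟨⟨t, γ⟩, rfl⟩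
    exact ⟨shift t * clock γ, (hE _).2 (h t γ), rfl⟩
  refine DFunLike.ext _ _ fun x => (hE x).1 ?_
  have hx : (x : D.Hilb →L[ℂ] D.Hilb) ∈ closure (Subtype.val '' (E : Set D.quasiLocal)) :=
    closure_mono (fun A hA => hle hA) (quasiLocal_le_closure x.2)
  have hx' : x ∈ closure (E : Set D.quasiLocal) := by
    rw [Topology.IsInducing.subtypeVal.closure_eq_preimage_closure_image]
    exact hx
  rwa [hclosed.closure_eq] at hx'

variable (D) in
/-- The Weyl system of shift and clock operators. -/
def weylSystem : WeylSystem D.quasiLocal (D.Hom0 0) (D.DualHom0 0) where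
  pair := eval
  pair_add_left := eval_add_left
  pair_add_right := eval_add_right
  P := shift
  Q := clock
  P_zero := shift_zero
  Q_zero := clock_zero
  P_add := shift_add
  Q_add := clock_add
  star_P := star_shift
  star_Q := star_clock
  Q_mul_P := clock_mul_shift
  ext_state := weakDual_ext

end HAQDM

namespace HAQDM

variable {V : Type u} [LinearOrder V] {D : HAQDM.{u, w} V}

/-! ### Existence of states with prescribed values on isotropic groups -/

lemma norm_inner_apply_le (ψ : D.Hilb) (hψ : ‖ψ‖ = 1) (A : D.Hilb →L[ℂ] D.Hilb) :
    ‖inner ℂ ψ (A ψ)‖ ≤ 1 * ‖A‖ := by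
  have h1 := norm_inner_le_norm (𝕜 := ℂ) ψ (A ψ)
  have h2 := A.le_opNorm ψ
  rw [hψ] at h1 h2
  linarith

/-- The vector state of a unit vector. -/
def vectorState (ψ : D.Hilb) (hψ : ‖ψ‖ = 1) : WeakDual ℂ D.quasiLocal :=
  StrongDual.toWeakDual <| LinearMap.mkContinuous
    { toFun := fun A : D.quasiLocal => inner ℂ ψ ((A : D.Hilb →L[ℂ] D.Hilb) ψ)
      map_add' := fun A B => by
        change inner ℂ ψ ((A : D.Hilb →L[ℂ] D.Hilb) ψ + (B : D.Hilb →L[ℂ] D.Hilb) ψ) = _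
        rw [inner_add_right]
      map_smul' := fun c A => by
        change inner ℂ ψ (c • (A : D.Hilb →L[ℂ] D.Hilb) ψ) = _
        rw [inner_smul_right]
        rfl } 1 fun A => norm_inner_apply_le ψ hψ A

lemma vectorState_apply (ψ : D.Hilb) (hψ : ‖ψ‖ = 1) (A : D.quasiLocal) :
    vectorState ψ hψ A = inner ℂ ψ ((A : D.Hilb →L[ℂ] D.Hilb) ψ) := rfl

lemma vectorState_of_eigenvector (ψ : D.Hilb) (hψ : ‖ψ‖ = 1) {A : D.quasiLocal} {z : ℂ}
    (h : (A : D.Hilb →L[ℂ] D.Hilb) ψ = z • ψ) : vectorState ψ hψ A = z := by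
  rw [vectorState_apply, h, inner_smul_right, inner_self_eq_norm_sq_to_K, hψ]
  simp

lemma vectorState_mem_stateSpace (ψ : D.Hilb) (hψ : ‖ψ‖ = 1) :
    vectorState ψ hψ ∈ stateSpace D.quasiLocal := by
  refine ⟨vectorState_of_eigenvector ψ hψ (by rw [one_smul]; rfl), fun A => ?_⟩
  rw [vectorState_apply]
  change 0 ≤ inner ℂ ψ (ContinuousLinearMap.adjoint (A : D.Hilb →L[ℂ] D.Hilb)
    ((A : D.Hilb →L[ℂ] D.Hilb) ψ))
  rw [ContinuousLinearMap.adjoint_inner_right, inner_self_eq_norm_sq_to_K]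
  exact pow_nonneg (Complex.zero_le_real.2
    (norm_nonneg ((A : D.Hilb →L[ℂ] D.Hilb) ψ))) 2

lemma norm_vectorState_le (ψ : D.Hilb) (hψ : ‖ψ‖ = 1) :
    ‖WeakDual.toStrongDual (vectorState ψ hψ)‖ ≤ 1 :=
  ContinuousLinearMap.opNorm_le_bound (WeakDual.toStrongDual (vectorState ψ hψ)) zero_le_one
    fun A => norm_inner_apply_le ψ hψ A.1

lemma isClosed_stateSpace (A : Type*) [NormedRing A] [NormedAlgebra ℂ A] [StarRing A] :
    IsClosed (stateSpace A) := by
  have h : stateSpace A = {φ | φ 1 = 1} ∩ ⋂ a : A, {φ | 0 ≤ φ (star a * a)} := by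
    ext φ
    simp [stateSpace]
  rw [h]
  refine (isClosed_eq (WeakDual.eval_continuous 1) continuous_const).inter
    (isClosed_iInter fun a => ?_)
  exact isClosed_le continuous_const (WeakDual.eval_continuous _)

/-- The elements of a subgroup that are supported in a finite set. -/
def supportedIn {ι : Type*} {M : ι → Type*} [∀ i, AddCommGroup (M i)]
    (K : AddSubgroup (Π₀ i, M i)) (Λ : Finset ι) : AddSubgroup (Π₀ i, M i) where
  carrier := {t | t ∈ K ∧ ∀ i, i ∉ Λ → t i = 0}
  zero_mem' := ⟨K.zero_mem, fun _ _ => rfl⟩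
  add_mem' := fun ha hb => ⟨K.add_mem ha.1 hb.1, fun i hi => by
    rw [DFinsupp.add_apply, ha.2 i hi, hb.2 i hi, add_zero]⟩
  neg_mem' := fun ha => ⟨K.neg_mem ha.1, fun i hi => by
    rw [DFinsupp.neg_apply, ha.2 i hi, neg_zero]⟩

instance {ι : Type*} {M : ι → Type*} [∀ i, AddCommGroup (M i)] [∀ i, Finite (M i)]
    (K : AddSubgroup (Π₀ i, M i)) (Λ : Finset ι) : Finite (supportedIn K Λ) := by
  refine Finite.of_injective (fun (t : supportedIn K Λ) (i : Λ) => t.1 i) fun t t' h => ?_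
  refine Subtype.ext (DFinsupp.ext fun i => ?_)
  by_cases hi : i ∈ Λ
  · exact congrFun h ⟨i, hi⟩
  · rw [t.2.2 i hi, t'.2.2 i hi]

lemma eval_injective {p : ℤ} {γ γ' : D.DualHom0 p} (h : ∀ t, eval γ t = eval γ' t) : γ = γ' :=
  DFinsupp.ext fun x => Gdual.ext_val fun g => by
    rw [← eval_single_right, h, eval_single_right]

/-- A nontrivial combination of characters of configurations does not vanish identically. -/
lemma exists_sum_eval_ne_zero {p : ℤ} {K : AddSubgroup (D.DualHom0 p)} [Fintype K]
    {c : K → ℂ} (hc : c 0 ≠ 0) : ∃ r : D.Hom0 p, ∑ γ : K, c γ * (eval γ.1 r : ℂ) ≠ 0 := by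
  by_contra! hcon
  let F : K → (Multiplicative (D.Hom0 p) →* ℂ) := fun γ =>
    { toFun := fun r => (eval γ.1 r.toAdd : ℂ)
      map_one' := by rw [toAdd_one, eval_zero_right, Circle.coe_one]
      map_mul' := fun r r' => by rw [toAdd_mul, eval_add_right, Circle.coe_mul] }
  have hF : Function.Injective F := fun γ γ' h => Subtype.ext <| eval_injective fun t =>
    Circle.ext (DFunLike.congr_fun h (Multiplicative.ofAdd t))
  -- Dedekind's independence of characters; distinct dual configurations give distinct characters.
  have hli := (linearIndependent_monoidHom (Multiplicative (D.Hom0 p)) ℂ).comp F hF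
  refine hc (Fintype.linearIndependent_iff.1 hli c (funext fun r => ?_) 0)
  rw [Finset.sum_apply]
  exact hcon r.toAdd

/-- A weighted sum of unitaries over a finite group is a joint eigenvector. -/
lemma mul_sum_star_smul {A G : Type*} [Ring A] [Algebra ℂ A] [AddCommGroup G] [Fintype G]
    {U : G → A} (hU : ∀ g h, U (g + h) = U g * U h) {f : G → Circle}
    (hf : ∀ g h, f (g + h) = f g * f h) (g : G) :
    U g * ∑ h, ((f h)⁻¹ : Circle).1 • U h = (f g : ℂ) • ∑ h, ((f h)⁻¹ : Circle).1 • U h := by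
  rw [Finset.mul_sum, Finset.smul_sum, ← Equiv.sum_comp (Equiv.addLeft g) fun h =>
    (f g : ℂ) • ((f h)⁻¹ : Circle).1 • U h]
  refine Finset.sum_congr rfl fun h _ => ?_
  rw [Equiv.coe_addLeft, mul_smul_comm, smul_smul, ← hU, hf, ← Circle.coe_mul, mul_inv,
    mul_inv_cancel_left]

/-- `pT` and `pS` are unnormalized projections onto the eigenspaces of `f` and `g`. Trivial pairing
lets the clocks pass through `pT`, so `pT (pS φ)` is a joint eigenvector; the remaining point is
that it is nonzero for a suitable basis vector `φ`. -/
lemma exists_joint_eigenvector (KT : AddSubgroup (D.Hom0 0)) (KS : AddSubgroup (D.DualHom0 0))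
    (hK : ∀ s ∈ KS, ∀ t ∈ KT, eval s t = 1) (f : D.Hom0 0 → Circle) (g : D.DualHom0 0 → Circle)
    (hf : ∀ t ∈ KT, ∀ t' ∈ KT, f (t + t') = f t * f t')
    (hg : ∀ s ∈ KS, ∀ s' ∈ KS, g (s + s') = g s * g s') [Fintype KT] [Fintype KS] :
    ∃ ψ : D.Hilb, ‖ψ‖ = 1 ∧
      (∀ t ∈ KT, (shift t : D.Hilb →L[ℂ] D.Hilb) ψ = (f t : ℂ) • ψ) ∧
      ∀ s ∈ KS, (clock s : D.Hilb →L[ℂ] D.Hilb) ψ = (g s : ℂ) • ψ := by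
  let pT : D.Hilb →L[ℂ] D.Hilb :=
    ∑ t : KT, ((f t)⁻¹ : Circle).1 • (shift t.1 : D.Hilb →L[ℂ] D.Hilb)
  let pS : D.Hilb →L[ℂ] D.Hilb :=
    ∑ s : KS, ((g s)⁻¹ : Circle).1 • (clock s.1 : D.Hilb →L[ℂ] D.Hilb)
  have hpT : ∀ t ∈ KT, (shift t : D.Hilb →L[ℂ] D.Hilb) * pT = (f t : ℂ) • pT := fun t ht =>
    mul_sum_star_smul (U := fun t : KT => (shift t.1 : D.Hilb →L[ℂ] D.Hilb))
      (f := fun t => f t) (fun a b => congrArg Subtype.val (shift_add a.1 b.1))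
      (fun a b => hf a a.2 b b.2) ⟨t, ht⟩
  have hpS : ∀ s ∈ KS, (clock s : D.Hilb →L[ℂ] D.Hilb) * pS = (g s : ℂ) • pS := fun s hs =>
    mul_sum_star_smul (U := fun s : KS => (clock s.1 : D.Hilb →L[ℂ] D.Hilb))
      (f := fun s => g s) (fun a b => congrArg Subtype.val (clock_add a.1 b.1))
      (fun a b => hg a a.2 b b.2) ⟨s, hs⟩
  have hcomm : ∀ s ∈ KS, (clock s : D.Hilb →L[ℂ] D.Hilb) * pT =
      pT * (clock s : D.Hilb →L[ℂ] D.Hilb) := by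
    intro s hs
    rw [Finset.mul_sum, Finset.sum_mul]
    refine Finset.sum_congr rfl fun t _ => ?_
    have h := clock_mul_shift s t.1
    rw [hK s hs t t.2, Circle.coe_one, one_smul] at h
    rw [mul_smul_comm, smul_mul_assoc]
    exact congrArg _ (congrArg Subtype.val h)
  have hf0 : f 0 = 1 := by simpa using hf 0 KT.zero_mem 0 KT.zero_mem
  have hg0 : g 0 = 1 := by simpa using hg 0 KS.zero_mem 0 KS.zero_mem
  -- `pS` multiplies the basis vector at `r` by this sum, so `r` is chosen to make it nonzero.
  obtain ⟨r, hr⟩ := exists_sum_eval_ne_zero (K := KS) (c := fun s => ((g s)⁻¹ : Circle).1)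
    (Circle.coe_ne_zero _)
  let φ : D.Hilb := lp.single 2 r (1 : ℂ)
  have hφ : ∀ s : D.Hom0 0, φ s = if s = r then 1 else 0 := by
    intro s
    by_cases h : s = r
    · subst h
      simp [φ]
    · simp [φ, h]
  have hpSφ : ∀ s, (pS φ : D.Hom0 0 → ℂ) s =
      (∑ γ : KS, ((g γ)⁻¹ : Circle).1 * (eval γ.1 s : ℂ)) * φ s := by
    intro s
    rw [← coeffAt_apply, map_sum, Finset.sum_mul]
    refine Finset.sum_congr rfl fun γ _ => ?_
    rw [map_smul, coeffAt_apply, clock_apply, smul_eq_mul, mul_assoc]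
  -- Only the shift by zero returns the basis vector to `r`, so the coefficient there is not
  -- affected by the other terms of `pT`.
  have hval : (pT (pS φ) : D.Hom0 0 → ℂ) r =
      ∑ γ : KS, ((g γ)⁻¹ : Circle).1 * (eval γ.1 r : ℂ) := by
    rw [← coeffAt_apply, map_sum, Finset.sum_eq_single 0]
    · rw [map_smul, coeffAt_apply, shift_apply, hpSφ, AddSubgroup.coe_zero, hf0, hφ]
      simp
    · intro t _ ht
      rw [map_smul, coeffAt_apply, shift_apply, hpSφ, hφ, if_neg, mul_zero, smul_zero]
      intro h
      exact ht (Subtype.ext (by simpa using h))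
    · simp
  have hψ : pT (pS φ) ≠ 0 := by
    intro h
    rw [h] at hval
    exact hr hval.symm
  have hT : ∀ t ∈ KT, (shift t : D.Hilb →L[ℂ] D.Hilb) (pT (pS φ)) = (f t : ℂ) • pT (pS φ) :=
    fun t ht => DFunLike.congr_fun (hpT t ht) (pS φ)
  have hS : ∀ s ∈ KS, (clock s : D.Hilb →L[ℂ] D.Hilb) (pT (pS φ)) = (g s : ℂ) • pT (pS φ) := by
    intro s hs
    have h1 := DFunLike.congr_fun (hcomm s hs) (pS φ)
    have h2 := DFunLike.congr_fun (hpS s hs) φ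
    refine h1.trans ?_
    change pT (((clock s : D.Hilb →L[ℂ] D.Hilb) * pS) φ) = _
    rw [h2]
    exact map_smul pT _ _
  refine ⟨((‖pT (pS φ)‖⁻¹ : ℝ) : ℂ) • pT (pS φ), ?_, fun t ht => ?_, fun s hs => ?_⟩
  · rw [norm_smul, Complex.norm_real, norm_inv, norm_norm, inv_mul_cancel₀ (norm_ne_zero_iff.2 hψ)]
  · rw [map_smul, hT t ht, smul_comm]
  · rw [map_smul, hS s hs, smul_comm]

/-- Characters of mutually commuting groups of shifts and clocks are values of states. -/
lemma exists_state_of_characters (KT : AddSubgroup (D.Hom0 0)) (KS : AddSubgroup (D.DualHom0 0))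
    (hK : ∀ s ∈ KS, ∀ t ∈ KT, eval s t = 1) (f : D.Hom0 0 → Circle) (g : D.DualHom0 0 → Circle)
    (hf : ∀ t ∈ KT, ∀ t' ∈ KT, f (t + t') = f t * f t')
    (hg : ∀ s ∈ KS, ∀ s' ∈ KS, g (s + s') = g s * g s') :
    ∃ ω ∈ stateSpace D.quasiLocal, (∀ t ∈ KT, ω (shift t) = f t) ∧
      ∀ s ∈ KS, ω (clock s) = g s := by
  let B : Set (WeakDual ℂ D.quasiLocal) :=
    (WeakDual.toStrongDual ⁻¹' Metric.closedBall 0 1) ∩ stateSpace D.quasiLocal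
  -- Banach–Alaoglu; the norm bound is part of `B` because positivity alone is not used here to
  -- derive it.
  have hB : IsCompact B := (WeakDual.isCompact_closedBall _ _).inter_right (isClosed_stateSpace _)
  let C : KT × KS → Set (WeakDual ℂ D.quasiLocal) := fun a =>
    {ω | ω (shift a.1.1) = f a.1 ∧ ω (clock a.2.1) = g a.2}
  have hC : ∀ a, IsClosed (C a) := fun a =>
    (isClosed_eq (WeakDual.eval_continuous _) continuous_const).inter
      (isClosed_eq (WeakDual.eval_continuous _) continuous_const)
  obtain ⟨ω, hω, hωC⟩ := hB.inter_iInter_nonempty C hC fun u => by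
    -- Finitely many conditions involve finitely many simplices, and the elements supported there
    -- form finite groups, so a vector state meets them all.
    let Λ : Finset D.Simplex := u.biUnion fun a => a.1.1.support ∪ a.2.1.support
    have := Fintype.ofFinite (supportedIn KT Λ)
    have := Fintype.ofFinite (supportedIn KS Λ)
    obtain ⟨ψ, hψ, hT, hS⟩ := exists_joint_eigenvector (supportedIn KT Λ) (supportedIn KS Λ)
      (fun s hs t ht => hK s hs.1 t ht.1) f g (fun t ht t' ht' => hf t ht.1 t' ht'.1)
      (fun s hs s' hs' => hg s hs.1 s' hs'.1)
    refine ⟨vectorState ψ hψ, ⟨?_, vectorState_mem_stateSpace ψ hψ⟩, ?_⟩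
    · exact (mem_closedBall_zero_iff (E := StrongDual ℂ D.quasiLocal)).2
        (norm_vectorState_le ψ hψ)
    · refine Set.mem_iInter₂.2 fun a ha => ?_
      have hsub : a.1.1.support ∪ a.2.1.support ⊆ Λ :=
        Finset.subset_biUnion_of_mem (fun a : KT × KS => a.1.1.support ∪ a.2.1.support) ha
      refine ⟨vectorState_of_eigenvector ψ hψ (hT _ ⟨a.1.2, fun i hi => ?_⟩),
        vectorState_of_eigenvector ψ hψ (hS _ ⟨a.2.2, fun i hi => ?_⟩)⟩
      · by_contra h
        exact hi (hsub (Finset.mem_union_left _ (DFinsupp.mem_support_iff.2 h)))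
      · by_contra h
        exact hi (hsub (Finset.mem_union_right _ (DFinsupp.mem_support_iff.2 h)))
  refine ⟨ω, hω.2, fun t ht => ?_, fun s hs => ?_⟩
  · exact (Set.mem_iInter.1 hωC (⟨t, ht⟩, 0)).1
  · exact (Set.mem_iInter.1 hωC (0, ⟨s, hs⟩)).2

/-! ### Frustration-free ground states are the stabilizer states -/

section GroundStates

variable {ω : WeakDual ℂ D.quasiLocal}

lemma starOp_eq (x : D.Simplex) [Fintype (D.G (deg (-1) x))] : starOp x =
    groupAverage fun g : D.G (deg (-1) x) => shift (coboundary (-1) 0 (DFinsupp.single x g)) := by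
  rw [starOp, groupAverage, finsum_eq_sum_of_fintype, Nat.card_eq_fintype_card]

lemma plaqOp_eq (x : D.Simplex) [Fintype (D.Gdual (deg 1 x))] : plaqOp x =
    groupAverage fun α : D.Gdual (deg 1 x) => clock (boundary 1 0 (DFinsupp.single x α)) := by
  -- The normalization by the order of the group is the one by the order of its dual.
  have h : Nat.card (D.G (deg 1 x)) = Fintype.card (D.Gdual (deg 1 x)) := by
    rw [← Nat.card_eq_fintype_card]
    exact (card_circleChar _).symm
  rw [plaqOp, groupAverage, finsum_eq_sum_of_fintype, h]

lemma shift_single_add (x : D.Simplex) (g h : D.G (deg (-1) x)) :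
    shift (coboundary (-1) 0 (DFinsupp.single x (g + h))) =
      shift (coboundary (-1) 0 (DFinsupp.single x g)) *
        shift (coboundary (-1) 0 (DFinsupp.single x h)) := by
  rw [DFinsupp.single_add, map_add, shift_add]

lemma star_shift_single (x : D.Simplex) (g : D.G (deg (-1) x)) :
    star (shift (coboundary (-1) 0 (DFinsupp.single x g))) =
      shift (coboundary (-1) 0 (DFinsupp.single x (-g))) := by
  rw [DFinsupp.single_neg, map_neg, star_shift]

lemma clock_single_add (x : D.Simplex) (α β : D.Gdual (deg 1 x)) :
    clock (boundary 1 0 (DFinsupp.single x (α + β))) =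
      clock (boundary 1 0 (DFinsupp.single x α)) *
        clock (boundary 1 0 (DFinsupp.single x β)) := by
  rw [DFinsupp.single_add, map_add, clock_add]

lemma star_clock_single (x : D.Simplex) (α : D.Gdual (deg 1 x)) :
    star (clock (boundary 1 0 (DFinsupp.single x α))) =
      clock (boundary 1 0 (DFinsupp.single x (-α))) := by
  rw [DFinsupp.single_neg, map_neg, star_clock]

lemma star_starOp (x : D.Simplex) : star (starOp x) = starOp x := by
  have := Fintype.ofFinite (D.G (deg (-1) x))
  rw [starOp_eq, star_groupAverage (star_shift_single x)]

lemma starOp_mul_self (x : D.Simplex) : starOp x * starOp x = starOp x := by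
  have := Fintype.ofFinite (D.G (deg (-1) x))
  rw [starOp_eq, groupAverage_mul_self (shift_single_add x)]

lemma star_plaqOp (x : D.Simplex) : star (plaqOp x) = plaqOp x := by
  have := Fintype.ofFinite (D.Gdual (deg 1 x))
  rw [plaqOp_eq, star_groupAverage (star_clock_single x)]

lemma plaqOp_mul_self (x : D.Simplex) : plaqOp x * plaqOp x = plaqOp x := by
  have := Fintype.ofFinite (D.Gdual (deg 1 x))
  rw [plaqOp_eq, groupAverage_mul_self (clock_single_add x)]

/-- The range is generated by the coboundaries of single-site elements, and a unitary with value 1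
can be absorbed, so the value 1 is inherited by products. -/
lemma forall_starOp_eq_one_iff (hω : ω ∈ stateSpace D.quasiLocal) :
    (∀ x, ω (starOp x) = 1) ↔ ∀ t ∈ (coboundary (D := D) (-1) 0).range, ω (shift t) = 1 := by
  have h1 : ∀ x : D.Simplex, ω (starOp x) = 1 ↔
      ∀ g, ω (shift (coboundary (-1) 0 (DFinsupp.single x g))) = 1 := by
    intro x
    have := Fintype.ofFinite (D.G (deg (-1) x))
    rw [starOp_eq]
    exact state_groupAverage_eq_one_iff hω.2 hω.1 (shift_single_add x) (star_shift_single x)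
  simp only [h1]
  constructor
  · rintro h _ ⟨t, rfl⟩
    induction t using DFinsupp.induction with
    | h0 => rw [map_zero, shift_zero, hω.1]
    | ha x g t _ _ ih =>
      rw [map_add, shift_add, state_mul_isometry hω.2 hω.1 (U := shift _) ((weylSystem D).star_P_mul _)
        (by simp) ih, one_mul, h]
  · exact fun h x g => h _ ⟨_, rfl⟩

lemma forall_plaqOp_eq_one_iff (hω : ω ∈ stateSpace D.quasiLocal) :
    (∀ x, ω (plaqOp x) = 1) ↔ ∀ s ∈ (boundary (D := D) 1 0).range, ω (clock s) = 1 := by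
  have h1 : ∀ x : D.Simplex, ω (plaqOp x) = 1 ↔
      ∀ α, ω (clock (boundary 1 0 (DFinsupp.single x α))) = 1 := by
    intro x
    have := Fintype.ofFinite (D.Gdual (deg 1 x))
    rw [plaqOp_eq]
    exact state_groupAverage_eq_one_iff hω.2 hω.1 (clock_single_add x) (star_clock_single x)
  simp only [h1]
  constructor
  · rintro h _ ⟨s, rfl⟩
    induction s using DFinsupp.induction with
    | h0 => rw [map_zero, clock_zero, hω.1]
    | ha x α s _ _ ih =>
      rw [map_add, clock_add, state_mul_isometry hω.2 hω.1 (U := clock _) ((weylSystem D).star_Q_mul _)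
        (by simp) ih, one_mul, h]
  · exact fun h x α => h _ ⟨_, rfl⟩

/-- States that equal `1` on all star and plaquette projections are ground states. -/
lemma isGroundState_of_eq_one (hω : ω ∈ stateSpace D.quasiLocal)
    (hs : ∀ x, ω (starOp x) = 1) (hp : ∀ x, ω (plaqOp x) = 1) : IsGroundState ω := by
  refine ⟨hω, fun A _ => Filter.Eventually.of_forall fun Λ => ?_⟩
  exact state_commutator_nonneg hω.2 hω.1 _ _ (fun x => ⟨star_starOp x, starOp_mul_self x, hs x⟩)
    (fun x => ⟨star_plaqOp x, plaqOp_mul_self x, hp x⟩) A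

lemma isFrustrationFree_iff (ω : WeakDual ℂ D.quasiLocal) : IsFrustrationFree ω ↔
    ω ∈ (weylSystem D).stabilizerStates (coboundary (-1) 0).range (boundary 1 0).range := by
  constructor
  · rintro ⟨hg, h⟩
    exact ⟨hg.1, (forall_starOp_eq_one_iff hg.1).1 fun x => (h x x).1,
      (forall_plaqOp_eq_one_iff hg.1).1 fun x => (h x x).2⟩
  · rintro ⟨hω, hT, hS⟩
    have hs := (forall_starOp_eq_one_iff hω).2 hT
    have hp := (forall_plaqOp_eq_one_iff hω).2 hS
    exact ⟨isGroundState_of_eq_one hω hs hp, fun x y => ⟨hs x, hp y⟩⟩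

end GroundStates

/-! ### Cocycles and cycles as annihilators -/

/-- One direction is transposition. For the other, single-site characters detect a nonzero value of
the coboundary, since characters of a finite group separate points. -/
lemma mem_ker_coboundary_iff (p q : ℤ) (t : D.Hom0 p) : t ∈ (coboundary (D := D) p q).ker ↔
    ∀ s ∈ (boundary (D := D) q p).range, eval s t = 1 := by
  rw [AddMonoidHom.mem_ker]
  constructor
  · rintro h _ ⟨s, rfl⟩
    rw [← eval_coboundary, h, eval_zero_right]
  · intro h
    refine DFinsupp.ext fun x => ?_
    by_contra hx
    obtain ⟨α, hα⟩ := Gdual.exists_val_ne_one hx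
    refine hα ?_
    rw [← eval_single_left, eval_coboundary]
    exact h _ ⟨_, rfl⟩

lemma mem_ker_boundary_iff (p q : ℤ) (s : D.DualHom0 p) : s ∈ (boundary (D := D) p q).ker ↔
    ∀ t ∈ (coboundary (D := D) q p).range, eval s t = 1 := by
  rw [AddMonoidHom.mem_ker]
  constructor
  · rintro h _ ⟨t, rfl⟩
    rw [eval_coboundary, h, eval_zero_left]
  · intro h
    refine eval_injective fun t => ?_
    rw [← eval_coboundary, eval_zero_left]
    exact h _ ⟨_, rfl⟩

end HAQDM

end

/-! ### Conclusion for the quantum double model -/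

theorem mainTheorem6 {V : Type u} [LinearOrder V] (D : HAQDM.{u, w} V) (hfin : Finite D.HH) :
    ∃ k d : ℕ, (k : ℝ) = (2 : ℝ) ^ D.c ∧ (d : ℝ) = (2 : ℝ) ^ D.q ∧
      Nonempty (D.pureFG ≃ₜ Fin k ×
        pureStates (EuclideanSpace ℂ (Fin d) →L[ℂ] EuclideanSpace ℂ (Fin d))) ∧
      Nonempty (D.pureFG ≃ₜ Fin k × ℙ ℂ (EuclideanSpace ℂ (Fin d))) := by
  obtain ⟨k, d, hk, hcard, ⟨e⟩⟩ := D.weylSystem.exists_homeomorph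
    (HAQDM.mem_ker_coboundary_iff 0 1) (HAQDM.mem_ker_boundary_iff 0 (-1))
    (by
      rintro _ ⟨t, rfl⟩
      exact HAQDM.coboundary_coboundary (by norm_num) (by norm_num) t)
    hfin HAQDM.exists_state_of_characters
  -- The commutator subgroup is, by unfolding, the radical of the Weyl system.
  have hII : k = Nat.card D.II := hk
  have hpos : 0 < k * (d * d) := hcard ▸ Nat.card_pos
  have hk0 : (0 : ℝ) < k := by exact_mod_cast Nat.pos_of_mul_pos_right hpos
  have hd0 : (0 : ℝ) < d := by
    exact_mod_cast Nat.pos_of_mul_pos_right (Nat.pos_of_mul_pos_left hpos)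
  have hset : D.pureFG = D.weylSystem.stabilizerStates (HAQDM.coboundary (-1) 0).range
      (HAQDM.boundary 1 0).range ∩ pureStates D.quasiLocal :=
    Set.ext fun ω => and_congr_left fun _ => HAQDM.isFrustrationFree_iff ω
  obtain ⟨e'⟩ := nonempty_pureStates_homeomorph d
  have h := (Homeomorph.setCongr hset).trans e
  refine ⟨k, d, ?_, ?_, ⟨h.trans ((Homeomorph.refl _).prodCongr e'.symm)⟩, ⟨h⟩⟩
  · rw [HAQDM.c, ← hII, Real.rpow_logb (by norm_num) (by norm_num) hk0]
  -- The quotient of the two orders is `d * d`, and the factor one half in `q` takes the square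
  -- root.
  · have hq : D.q = Real.logb 2 d := by
      have hHH : (Nat.card D.HH : ℝ) = k * (d * d) := by exact_mod_cast hcard
      rw [HAQDM.q, ← hII, hHH, mul_div_cancel_left₀ _ hk0.ne',
        Real.logb_mul hd0.ne' hd0.ne']
      ring
    rw [hq, Real.rpow_logb (by norm_num) (by norm_num) hd0]
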